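/- Let $Y$ be a smooth $3$-manifold (Hausdorff, second countable, without boundary) with a contact form $\alpha$ (a smooth $1$-form with $\alpha\wedge d\alpha$ nowhere zero), and let $\xi=\ker\alpha$. Let $S$ be a closed surface (a compact smooth $2$-manifold without boundary), let $V\subset S$ be open, and let $j_t:S\to Y$, $t\in[0,1]$, be a smooth family of smooth embeddings such that for all $t\in[0,1]$ * $j_t|_V=j_0|_V$; * $j_t$ and $j_0$ induce the same characteristic foliation on $S$, i.e. $\{v\in T_pS : dj_t(v)\in\xi\}=\{v\in T_pS : dj_0(v)\in\xi\}$ for all $p\in S$. A contact isotopy is a family of diffeomorphisms $\psi_t:Y\to Y$, $t\in[0,1]$, smooth in $(t,y)$, with $\psi_0=\mathrm{id}$ and $d\psi_t(\xi)=\xi$. It is generated by a smooth family of functions $H_t:Y\to\mathbb R$, $t\in[0,1]$, if $\frac{d}{dt}\psi_t=X_{H_t}\circ\psi_t$, where $X_H$ is the contact vector field determined by $\alpha(X_H)=H$ and $dH+\iota_{X_H}d\alpha=\mu\alpha$ for some function $\mu$. The support of $\psi_t$ at time $t$ is the closure of $\{\psi_t(y) : \frac{d}{dt}\psi_t(y)\neq0\}$.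 Let $U\subset\mathbb R\times Y$ be any open set such that, for every $t\in[0,1]$, the slice $U_t=\{y : (t,y)\in U\}$ contains $j_t(S\setminus V)$. Then: **(a)** There is a contact isotopy $\psi_t$, generated by some smooth $H_t$, such that for all $t\in[0,1]$ 1. $\psi_t\circ j_0=j_t$; 2. the support of $\psi_t$ at time $t$ is contained in $U_t$, and $H_t$ has compact support contained in $U_t$. **(b)** Let moreover $\phi_t:S\times\mathbb R\to Y$, $t\in[0,1]$, be a smooth family of smooth embeddings extending $j_t$, i.e. $\phi_t(p,0)=j_t(p)$, such that $\phi_t|_{V\times\mathbb R}=\phi_0|_{V\times\mathbb R}$. Then $\psi_t$ and $H_t$ in (a) can be chosen so that in addition, for all $t\in[0,1]$, the support of $H_t$ is contained in $\phi_t((S\setminus V)\times\mathbb R)$. -/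

import Mathlib

open Set
open scoped Manifold ContDiff

noncomputable section

namespace ContactGeom

section Forms

variable {Y : Type*} [TopologicalSpace Y] [ChartedSpace (EuclideanSpace ℝ (Fin 3)) Y]

/-- A (not necessarily smooth) differential 1-form on a 3-manifold `Y`. -/
abbrev OneForm (Y : Type*) [TopologicalSpace Y] [ChartedSpace (EuclideanSpace ℝ (Fin 3)) Y] :
    Type _ :=
  ∀ y : Y, TangentSpace (𝓡 3) y →L[ℝ] ℝ

/-- Smoothness of a 1-form, as a section of the cotangent bundle. -/
def OneForm.IsSmooth [IsManifold (𝓡 3) ∞ Y] (α : OneForm Y) : Prop :=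
  ContMDiff (𝓡 3) ((𝓡 3).prod 𝓘(ℝ, EuclideanSpace ℝ (Fin 3) →L[ℝ] ℝ)) ∞
    (fun y : Y ↦ Bundle.TotalSpace.mk' (EuclideanSpace ℝ (Fin 3) →L[ℝ] ℝ)
      (E := fun y : Y ↦ TangentSpace (𝓡 3) y →L[ℝ] Bundle.Trivial Y ℝ y) y (α y))

/-- The expression of `α` in the preferred chart `x` around `y₀`, i.e. the 1-form `(x⁻¹)^* α` on
the image of the chart. -/
def OneForm.inChart (α : OneForm Y) (y₀ : Y) (x : EuclideanSpace ℝ (Fin 3)) :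
    EuclideanSpace ℝ (Fin 3) →L[ℝ] ℝ :=
  (α ((extChartAt (𝓡 3) y₀).symm x)).comp
    (mfderiv 𝓘(ℝ, EuclideanSpace ℝ (Fin 3)) (𝓡 3) (extChartAt (𝓡 3) y₀).symm x)

/-- The exterior derivative `dα_y(u, v)`, computed in the preferred chart around `y` by the formula
`(∂_u α)(v) - (∂_v α)(u)`. -/
def OneForm.d (α : OneForm Y) (y : Y) (u v : TangentSpace (𝓡 3) y) : ℝ :=
  let x := extChartAt (𝓡 3) y
  let D : EuclideanSpace ℝ (Fin 3) →L[ℝ] EuclideanSpace ℝ (Fin 3) →L[ℝ] ℝ :=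
    fderiv ℝ (α.inChart y) (x y)
  let u' : EuclideanSpace ℝ (Fin 3) := mfderiv (𝓡 3) 𝓘(ℝ, EuclideanSpace ℝ (Fin 3)) x y u
  let v' : EuclideanSpace ℝ (Fin 3) := mfderiv (𝓡 3) 𝓘(ℝ, EuclideanSpace ℝ (Fin 3)) x y v
  D u' v' - D v' u'

/-- The 3-form `α ∧ dα`. -/
def OneForm.wedgeD (α : OneForm Y) (y : Y) (u v w : TangentSpace (𝓡 3) y) : ℝ :=
  α y u * α.d y v w + α y v * α.d y w u + α y w * α.d y u v

/-- `α` is a contact form: a smooth 1-form such that `α ∧ dα` vanishes nowhere. -/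
structure IsContactForm [IsManifold (𝓡 3) ∞ Y] (α : OneForm Y) : Prop where
  smooth : α.IsSmooth
  wedge_ne_zero : ∀ y : Y, ∃ u v w : TangentSpace (𝓡 3) y, α.wedgeD y u v w ≠ 0

/-- The plane `ξ_y = ker α_y`. -/
def contactPlane (α : OneForm Y) (y : Y) : Submodule ℝ (TangentSpace (𝓡 3) y) :=
  LinearMap.ker (α y).toLinearMap

/-- `X ∈ T_y Y` is the value at `y` of the contact vector field of the contact Hamiltonian `h`:
`α(X) = h` and `dh + ι_X dα = μ α` at `y` for some real number `μ`. -/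
def IsContactHamiltonianVector (α : OneForm Y) (h : Y → ℝ) (y : Y)
    (X : TangentSpace (𝓡 3) y) : Prop :=
  let dh : TangentSpace (𝓡 3) y →L[ℝ] ℝ := mfderiv (𝓡 3) 𝓘(ℝ, ℝ) h y
  α y X = h y ∧ ∃ μ : ℝ, ∀ v : TangentSpace (𝓡 3) y, dh v + α.d y X v = μ * α y v

/-- A smooth family, parametrized by `t ∈ [0,1]`, of smooth embeddings of `M` into `Y`.
(Only the values for `t ∈ [0,1]` matter.) -/
structure IsEmbeddingFamily {E H M : Type*} [NormedAddCommGroup E] [NormedSpace ℝ E]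
    [TopologicalSpace H] (I : ModelWithCorners ℝ E H) [TopologicalSpace M] [ChartedSpace H M]
    (f : ℝ → M → Y) : Prop where
  smooth : ContMDiffOn (𝓘(ℝ, ℝ).prod I) (𝓡 3) ∞ (fun z : ℝ × M ↦ f z.1 z.2) (Icc 0 1 ×ˢ univ)
  embedding : ∀ t ∈ Icc (0 : ℝ) 1, Manifold.IsSmoothEmbedding I (𝓡 3) ∞ (f t)

/-- The characteristic foliation that `ker α` induces on a surface `S` through `f : S → Y`: the
singular line field `p ↦ {v ∈ T_p S | df_p(v) ∈ ξ_{f(p)}}`. -/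
def characteristicFoliation {S : Type*} [TopologicalSpace S]
    [ChartedSpace (EuclideanSpace ℝ (Fin 2)) S] (α : OneForm Y) (f : S → Y) (p : S) :
    Submodule ℝ (TangentSpace (𝓡 2) p) :=
  (contactPlane α (f p)).comap (mfderiv (𝓡 2) (𝓡 3) f p).toLinearMap

/-- The velocity `d/dt ψ_t(y)` at time `t ∈ [0,1]` (one-sided at the end points). -/
def velocity (ψ : ℝ → Y → Y) (t : ℝ) (y : Y) : TangentSpace (𝓡 3) (ψ t y) :=
  mfderivWithin 𝓘(ℝ, ℝ) (𝓡 3) (fun s : ℝ ↦ ψ s y) (Icc 0 1) t (1 : ℝ)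

/-- The support at time `t` of an isotopy: the closure of `{ψ_t(y) | d/dt ψ_t(y) ≠ 0}`. -/
def supportAt (ψ : ℝ → Y → Y) (t : ℝ) : Set Y :=
  closure {z | ∃ y, ψ t y = z ∧ velocity ψ t y ≠ 0}

/-- A contact isotopy `(ψ_t)_{t ∈ [0,1]}` of `(Y, ker α)`: a smooth isotopy of diffeomorphisms
starting at the identity, with `dψ_t(ξ) = ξ`. -/
structure IsContactIsotopy (α : OneForm Y) (ψ : ℝ → Diffeomorph (𝓡 3) (𝓡 3) Y Y ∞) : Prop where
  smooth : ContMDiffOn (𝓘(ℝ, ℝ).prod (𝓡 3)) (𝓡 3) ∞ (fun z : ℝ × Y ↦ ψ z.1 z.2)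
    (Icc 0 1 ×ˢ univ)
  zero : ∀ y, ψ 0 y = y
  contact : ∀ t ∈ Icc (0 : ℝ) 1, ∀ y,
    (contactPlane α y).map (mfderiv (𝓡 3) (𝓡 3) (ψ t) y).toLinearMap = contactPlane α (ψ t y)

/-- The isotopy `ψ_t` is generated by the (smooth, time-dependent) contact Hamiltonian `H_t`, i.e.
`d/dt ψ_t(y) = X_{H_t}(ψ_t(y))` for `t ∈ [0,1]`. -/
structure IsGeneratedBy (α : OneForm Y) (ψ : ℝ → Y → Y) (H : ℝ → Y → ℝ) : Prop where
  smooth : ContMDiffOn (𝓘(ℝ, ℝ).prod (𝓡 3)) 𝓘(ℝ, ℝ) ∞ (fun z : ℝ × Y ↦ H z.1 z.2)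
    (Icc 0 1 ×ˢ univ)
  velocity_eq : ∀ t ∈ Icc (0 : ℝ) 1, ∀ y,
    IsContactHamiltonianVector α (H t) (ψ t y) (velocity ψ t y)

end Forms

end ContactGeom

end

/-!
A moving surface is carried along by a contact isotopy as soon as there is a contact Hamiltonian
`H t` whose contact vector field at the point `j t p` is the velocity of `t ↦ j t p`. Such
Hamiltonians are constructed locally and patched together.

*Local construction* (`IsContactForm.exists_local_hamiltonian`). Extend the surfaces to a family
of parametrizations `F (t, (z, s))` of open sets of `Y`, with `F (t, (z, 0))` running through the
surface, and let `P` be the pullback of `α` by `F`. On the surface the Hamiltonian has to be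
`P ∂ₜ`, and the equation `dH + ι_X dα = μ α` in the directions tangent to the surface says that the
time derivative of the characteristic form `β t = P|_{s = 0}` is `μ β t`. Because the
characteristic foliations agree, `β t` vanishes on the kernel of `β t₀`, and since `dβ t₀ ≠ 0` at
the points where `β t₀` vanishes, some coefficient of `β t₀` has no degenerate zero. Division by
this coefficient (`exists_smooth_division`) gives `β t = g t · β t₀` with `g` smooth, so
`μ = ∂ₜ g / g`. The equation in the direction `∂ₛ` prescribes the `s`-derivative of the Hamiltonian
along the surface, so an affine function of `s` does the job. Over the set where `F` does not
depend on time it vanishes identically, which gives the control of the support.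

The parametrizations come from the extension `φ` of the surface if there is one
(`IsContactForm.hasLocalHamiltonian_of_thickening`); otherwise a vector transverse to the surface in
a chart of `Y` is used (`IsContactForm.hasLocalHamiltonian_of_embedding`).

*Patching* (`IsContactForm.exists_contactIsotopy_of_hasLocalHamiltonian`). The set of all
`(t, j t p)` with `p ∉ V` is compact, and a partition of unity combines finitely many local
Hamiltonians. The contact vector at `j t p` is unchanged
(`IsContactForm.contactVec_sum_mul`): at the points `p ∉ V` the weights sum to `1` nearby, and at
the points `p ∈ V` all contact vectors involved are the velocity of a constant curve.

*Integration* (`IsContactForm.exists_contactIsotopy`). The contact vector field has compact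
support, so it has a flow, depending smoothly on time up to the end points of `[0,1]`
(`IsSmoothField.exists_flow`). The flow preserves the contact planes because the time derivative of
the pullback of `α` is a multiple of it, and it moves `j 0 p` along `j t p` by uniqueness of
trajectories.
-/

namespace ContactGeom

open Filter Topology Function

/-! ### Calculus within subsets of normed spaces -/

section ParametricIntegral

universe u

/-- Differentiation under the integral sign within a convex set, which need not be open. -/
theorem hasFDerivWithinAt_intervalIntegral {Z F : Type*} [NormedAddCommGroup Z] [NormedSpace ℝ Z]
    [NormedAddCommGroup F] [NormedSpace ℝ F] [CompleteSpace F]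
    {s : Set Z} (hs : Convex ℝ s) {h : Z → ℝ → F} {h' : Z → ℝ → Z →L[ℝ] F}
    (hd : ∀ z ∈ s, ∀ θ ∈ Icc (0 : ℝ) 1, HasFDerivWithinAt (h · θ) (h' z θ) s z)
    (hc : ContinuousOn (uncurry h) (s ×ˢ Icc 0 1))
    (hc' : ContinuousOn (uncurry h') (s ×ˢ Icc 0 1)) {z₀ : Z} (hz₀ : z₀ ∈ s) :
    HasFDerivWithinAt (fun z ↦ ∫ θ in (0 : ℝ)..1, h z θ) (∫ θ in (0 : ℝ)..1, h' z₀ θ) s z₀ := by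
  have hmk : ∀ z ∈ s, ContinuousOn (fun θ : ℝ ↦ (z, θ)) (Icc 0 1) := fun z _ ↦
    (Continuous.prodMk_right z).continuousOn
  have hci : ∀ z ∈ s, ContinuousOn (h z) (uIcc 0 1) := fun z hz ↦ by
    rw [uIcc_of_le zero_le_one]
    exact hc.comp (hmk z hz) fun θ hθ ↦ ⟨hz, hθ⟩
  have hci' : ContinuousOn (h' z₀) (uIcc 0 1) := by
    rw [uIcc_of_le zero_le_one]
    exact hc'.comp (hmk z₀ hz₀) fun θ hθ ↦ ⟨hz₀, hθ⟩
  refine HasFDerivWithinAt.of_isLittleO (Asymptotics.isLittleO_iff.2 fun c hc0 ↦ ?_)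
  have htube : ∀ᶠ z in 𝓝 z₀, ∀ θ ∈ Icc (0 : ℝ) 1, z ∈ s ∧ θ ∈ Icc (0 : ℝ) 1 →
      ‖h' z θ - h' z₀ θ‖ ≤ c := by
    refine isCompact_Icc.eventually_forall_of_forall_eventually (P := fun z θ ↦
      z ∈ s ∧ θ ∈ Icc (0 : ℝ) 1 → ‖h' z θ - h' z₀ θ‖ ≤ c) fun θ hθ ↦ ?_
    have h1 : ContinuousWithinAt (fun w : Z × ℝ ↦ ‖h' w.1 w.2 - h' z₀ w.2‖) (s ×ˢ Icc 0 1)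
        (z₀, θ) := by
      refine (ContinuousWithinAt.sub (hc' (z₀, θ) ⟨hz₀, hθ⟩) ?_).norm
      have h2 : ContinuousWithinAt (h' z₀) (Icc 0 1) (z₀, θ).2 := by
        rw [uIcc_of_le zero_le_one] at hci'
        exact hci' θ hθ
      exact h2.comp continuousWithinAt_snd fun w hw ↦ hw.2
    have h3 : ∀ᶠ w in 𝓝[s ×ˢ Icc 0 1] (z₀, θ), ‖h' w.1 w.2 - h' z₀ w.2‖ < c :=
      h1.eventually_lt_const (by simpa using hc0)
    rw [eventually_nhdsWithin_iff] at h3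
    filter_upwards [h3] with w hw hw'
    exact (hw ⟨hw'.1, hw'.2⟩).le
  obtain ⟨δ, hδ, hball⟩ := Metric.eventually_nhds_iff_ball.1 htube
  filter_upwards [inter_mem_nhdsWithin s (Metric.ball_mem_nhds z₀ hδ)] with z hz
  have hkey : ∀ θ ∈ Icc (0 : ℝ) 1, ‖h z θ - h z₀ θ - h' z₀ θ (z - z₀)‖ ≤ c * ‖z - z₀‖ := by
    intro θ hθ
    refine Convex.norm_image_sub_le_of_norm_hasFDerivWithin_le' (s := s ∩ Metric.ball z₀ δ)
      (f' := fun w ↦ h' w θ) (fun w hw ↦ (hd w hw.1 θ hθ).mono inter_subset_left)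
      (fun w hw ↦ hball w hw.2 θ hθ ⟨hw.1, hθ⟩) (hs.inter (convex_ball _ _))
      ⟨hz₀, Metric.mem_ball_self hδ⟩ hz
  have hint : ∀ w ∈ s, IntervalIntegrable (h w) MeasureTheory.volume 0 1 := fun w hw ↦
    (hci w hw).intervalIntegrable
  have hint' := hci'.intervalIntegrable (μ := MeasureTheory.volume)
  have hint2 : IntervalIntegrable (fun θ ↦ h' z₀ θ (z - z₀)) MeasureTheory.volume 0 1 :=
    (hci'.clm_apply continuousOn_const).intervalIntegrable
  rw [ContinuousLinearMap.intervalIntegral_apply hint', ← intervalIntegral.integral_sub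
    (hint z hz.1) (hint z₀ hz₀), ← intervalIntegral.integral_sub
    ((hint z hz.1).sub (hint z₀ hz₀)) hint2]
  refine (intervalIntegral.norm_integral_le_of_norm_le_const (C := c * ‖z - z₀‖)
    fun θ hθ ↦ hkey θ ?_).trans (by simp)
  rw [uIoc_of_le zero_le_one] at hθ
  exact Ioc_subset_Icc_self hθ

theorem continuousOn_intervalIntegral {Z F : Type*} [NormedAddCommGroup Z]
    [NormedAddCommGroup F] [NormedSpace ℝ F]
    {s : Set Z} {h : Z → ℝ → F} (hc : ContinuousOn (uncurry h) (s ×ˢ Icc 0 1)) :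
    ContinuousOn (fun z ↦ ∫ θ in (0 : ℝ)..1, h z θ) s := by
  rw [continuousOn_iff_continuous_domRestrict]
  have h1 : Continuous (uncurry fun (z : s) (θ : ℝ) ↦ h z (projIcc 0 1 zero_le_one θ)) := by
    refine hc.comp_continuous (f := fun w : s × ℝ ↦
      ((w.1 : Z), (projIcc (0 : ℝ) 1 zero_le_one w.2 : ℝ))) (by fun_prop) fun w ↦
      ⟨w.1.2, (projIcc (0 : ℝ) 1 zero_le_one w.2).2⟩
  refine (intervalIntegral.continuous_parametric_intervalIntegral_of_continuous' h1 0 1).congr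
    fun z ↦ intervalIntegral.integral_congr fun θ hθ ↦ ?_
  rw [uIcc_of_le zero_le_one] at hθ
  simp [projIcc_of_mem zero_le_one hθ]

/-- The induction on `n` passes to the derivative, which is again an integral over `[0,1]`. -/
theorem contDiffOn_intervalIntegral_nat {Z : Type u} [NormedAddCommGroup Z] [NormedSpace ℝ Z]
    {s : Set Z} (hs : Convex ℝ s) (hu : UniqueDiffOn ℝ s) (n : ℕ) :
    ∀ {F : Type u} [NormedAddCommGroup F] [NormedSpace ℝ F] [CompleteSpace F] {h : Z → ℝ → F},
      ContDiffOn ℝ n (uncurry h) (s ×ˢ Icc 0 1) →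
      ContDiffOn ℝ n (fun z ↦ ∫ θ in (0 : ℝ)..1, h z θ) s := by
  have hu2 : UniqueDiffOn ℝ (s ×ˢ Icc (0 : ℝ) 1) := hu.prod (uniqueDiffOn_Icc zero_lt_one)
  induction n with
  | zero =>
    intro F _ _ _ h hh
    exact contDiffOn_zero.2 (continuousOn_intervalIntegral hh.continuousOn)
  | succ n ih =>
    intro F _ _ _ h hh
    rw [Nat.cast_add, Nat.cast_one] at hh ⊢
    obtain ⟨-, f', hf', hd⟩ := (contDiffOn_succ_iff_hasFDerivWithinAt_of_uniqueDiffOn hu2).1 hh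
    refine (contDiffOn_succ_iff_hasFDerivWithinAt_of_uniqueDiffOn hu).2 ⟨by simp, fun z ↦
      ∫ θ in (0 : ℝ)..1, (f' (z, θ)).comp (ContinuousLinearMap.inl ℝ Z ℝ), ih
        (h := fun z θ ↦ (f' (z, θ)).comp (ContinuousLinearMap.inl ℝ Z ℝ)) ?_, fun z hz ↦ ?_⟩
    · exact hf'.clm_comp contDiffOn_const
    · refine hasFDerivWithinAt_intervalIntegral hs
        (h' := fun z θ ↦ (f' (z, θ)).comp (ContinuousLinearMap.inl ℝ Z ℝ)) (fun z hz θ hθ ↦ ?_)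
        hh.continuousOn (hf'.clm_comp contDiffOn_const).continuousOn hz
      have h1 := hd (z, θ) ⟨hz, hθ⟩
      exact HasFDerivWithinAt.comp z (f := fun w ↦ (w, θ)) h1
        (hasFDerivAt_prodMk_left z θ).hasFDerivWithinAt fun w hw ↦ ⟨hw, hθ⟩

theorem contDiffOn_intervalIntegral {Z F : Type u} [NormedAddCommGroup Z] [NormedSpace ℝ Z]
    [NormedAddCommGroup F] [NormedSpace ℝ F] [CompleteSpace F]
    {s : Set Z} (hs : Convex ℝ s) (hu : UniqueDiffOn ℝ s) {h : Z → ℝ → F}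
    (hh : ContDiffOn ℝ ∞ (uncurry h) (s ×ˢ Icc 0 1)) :
    ContDiffOn ℝ ∞ (fun z ↦ ∫ θ in (0 : ℝ)..1, h z θ) s :=
  contDiffOn_infty.2 fun n ↦ contDiffOn_intervalIntegral_nat hs hu n (contDiffOn_infty.1 hh n)

end ParametricIntegral

section Inverse

variable {E F : Type*} [NormedAddCommGroup E] [NormedSpace ℝ E]
  [NormedAddCommGroup F] [NormedSpace ℝ F]

/-- If the partial derivative along the second factor is invertible, then so is the derivative of
`(t, x) ↦ (t, f t x)`. -/
theorem isInvertible_fst_prod {L : ℝ × E →L[ℝ] F}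
    (hL : (L.comp (ContinuousLinearMap.inr ℝ ℝ E)).IsInvertible) :
    ((ContinuousLinearMap.fst ℝ ℝ E).prod L).IsInvertible := by
  obtain ⟨A, hA⟩ := hL
  have hA' : ∀ x, A x = L (0, x) := fun x ↦ by
    have := congrArg (fun M : E →L[ℝ] F ↦ M x) hA
    simpa using this
  have hsplit : ∀ w : ℝ × E, L w = L (w.1, 0) + A w.2 := fun w ↦ by
    rw [hA', ← map_add]
    simp
  refine ⟨ContinuousLinearEquiv.equivOfInverse ((ContinuousLinearMap.fst ℝ ℝ E).prod L)
    ((ContinuousLinearMap.fst ℝ ℝ F).prod ((A.symm : F →L[ℝ] E).comp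
      (ContinuousLinearMap.snd ℝ ℝ F - (L.comp (ContinuousLinearMap.inl ℝ ℝ E)).comp
        (ContinuousLinearMap.fst ℝ ℝ F)))) ?_ ?_, rfl⟩
  · intro w
    ext1
    · simp
    · simp [hsplit w]
  · intro w
    ext1
    · simp
    · simp only [ContinuousLinearMap.prod_apply, ContinuousLinearMap.coe_fst']
      rw [hsplit]
      simp

theorem hasFDerivAt_slice {f : ℝ → E → F} {I : Set ℝ} {O : Set E} (hO : IsOpen O)
    {t : ℝ} (ht : t ∈ I) {x : E} (hx : x ∈ O) {L : ℝ × E →L[ℝ] F}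
    (hf : HasFDerivWithinAt (uncurry f) L (I ×ˢ O) (t, x)) :
    HasFDerivAt (f t) (L.comp (ContinuousLinearMap.inr ℝ ℝ E)) x := by
  have h1 : HasFDerivWithinAt (f t) (L.comp (ContinuousLinearMap.inr ℝ ℝ E)) O x :=
    HasFDerivWithinAt.comp x (f := fun w ↦ (t, w)) hf
      (hasFDerivAt_prodMk_right t x).hasFDerivWithinAt fun w hw ↦ ⟨ht, hw⟩
  exact h1.hasFDerivAt (hO.mem_nhds hx)

variable [CompleteSpace E]

/-- A continuous right inverse of a smooth map with invertible derivatives is smooth; the sets need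
not be open, so that this applies at boundary points. -/
theorem contDiffOn_of_rightInvOn {f : E → F} {g : F → E} {s : Set E} {t : Set F}
    (ht : UniqueDiffOn ℝ t) (hs : UniqueDiffOn ℝ s) (hf : ContDiffOn ℝ ∞ f s)
    (hg : ContinuousOn g t) (hmaps : MapsTo g t s) (hfg : ∀ y ∈ t, f (g y) = y)
    (hinv : ∀ y ∈ t, (fderivWithin ℝ f s (g y)).IsInvertible) :
    ContDiffOn ℝ ∞ g t := by
  have hder : ∀ y ∈ t, HasFDerivWithinAt g (fderivWithin ℝ f s (g y)).inverse t y := by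
    intro y hy
    obtain ⟨e, he⟩ := hinv y hy
    have h1 : HasFDerivWithinAt f (e : E →L[ℝ] F) s (g y) := by
      rw [he]
      exact ((hf.differentiableOn (by simp)) _ (hmaps hy)).hasFDerivWithinAt
    have h2 := h1.of_local_left_inverse (g := g) (s := t) (a := y)
      (tendsto_nhdsWithin_iff.2 ⟨hg y hy, eventually_nhdsWithin_of_forall fun z hz ↦ hmaps hz⟩) hy
      (eventually_nhdsWithin_of_forall hfg)
    rwa [← he, ContinuousLinearMap.inverse_equiv]
  refine contDiffOn_infty.2 fun n ↦ ?_
  induction n with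
  | zero => exact contDiffOn_zero.2 hg
  | succ n ih =>
    rw [Nat.cast_add, Nat.cast_one]
    refine (contDiffOn_succ_iff_hasFDerivWithinAt_of_uniqueDiffOn ht).2 ⟨by simp, _, ?_, hder⟩
    intro y hy
    obtain ⟨e, he⟩ := hinv y hy
    have h1 : ContDiffAt ℝ n ContinuousLinearMap.inverse (fderivWithin ℝ f s (g y)) := by
      rw [← he]
      exact contDiffAt_map_inverse e
    have h2 : ContDiffOn ℝ n (fun y ↦ fderivWithin ℝ f s (g y)) t :=
      (hf.fderivWithin hs (by exact_mod_cast le_top) : ContDiffOn ℝ n _ _).comp ih hmaps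
    exact h1.comp_contDiffWithinAt y (h2 y hy)

/-- The inverse function theorem for a family of maps that depends smoothly on `t ∈ [0,1]`. The
inverse maps are found by reparametrizing time by `t = sin² τ`, which removes the end points; their
smoothness up to the end points follows from `contDiffOn_of_rightInvOn`. -/
theorem exists_inverse_family {f : ℝ → E → F} {O : Set E} (hO : IsOpen O)
    (hf : ContDiffOn ℝ ∞ (uncurry f) (Icc 0 1 ×ˢ O)) {t₀ : ℝ} (ht₀ : t₀ ∈ Icc (0 : ℝ) 1)
    {x₀ : E} (hx₀ : x₀ ∈ O) (hinv : (fderiv ℝ (f t₀) x₀).IsInvertible) :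
    ∃ (N : Set (ℝ × F)) (W : Set E) (g : ℝ → F → E), IsOpen N ∧ (t₀, f t₀ x₀) ∈ N ∧
      IsOpen W ∧ x₀ ∈ W ∧ W ⊆ O ∧ ContDiffOn ℝ ∞ (uncurry g) (N ∩ Icc 0 1 ×ˢ univ) ∧
      (∀ t ∈ Icc (0 : ℝ) 1, ∀ y, (t, y) ∈ N → g t y ∈ W ∧ f t (g t y) = y) ∧
      ∀ t ∈ Icc (0 : ℝ) 1, ∀ x ∈ W, (t, f t x) ∈ N → g t (f t x) = x := by
  set σ : ℝ → ℝ := fun τ ↦ Real.sin τ ^ 2 with hσ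
  set θ : ℝ → ℝ := fun t ↦ Real.arcsin (Real.sqrt t) with hθ
  have hθc : Continuous θ := Real.continuous_arcsin.comp Real.continuous_sqrt
  have hσI : ∀ τ, σ τ ∈ Icc (0 : ℝ) 1 := fun τ ↦ ⟨sq_nonneg _, Real.sin_sq_le_one τ⟩
  have hσθ : ∀ t ∈ Icc (0 : ℝ) 1, σ (θ t) = t := fun t ht ↦ by
    have h1 : Real.sqrt t ≤ 1 := Real.sqrt_le_one.2 ht.2
    have h2 := Real.sqrt_nonneg t
    simp only [hσ, hθ]
    rw [Real.sin_arcsin (by linarith) h1, Real.sq_sqrt ht.1]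
  have hσd : ContDiff ℝ ∞ σ := Real.contDiff_sin.pow 2
  set q : ℝ → E → F := fun τ x ↦ f (σ τ) x with hq
  have hqd : ContDiffOn ℝ ∞ (uncurry q) (univ ×ˢ O) :=
    hf.comp (f := fun w : ℝ × E ↦ (σ w.1, w.2))
      ((hσd.comp contDiff_fst).prodMk contDiff_snd).contDiffOn fun w hw ↦ ⟨hσI _, hw.2⟩
  have hUO : IsOpen ((univ : Set ℝ) ×ˢ O) := isOpen_univ.prod hO
  have hqder : ∀ τ, ∀ x ∈ O, HasFDerivAt (uncurry q) (fderiv ℝ (uncurry q) (τ, x)) (τ, x) :=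
    fun τ x hx ↦ ((hqd.contDiffAt (hUO.mem_nhds ⟨mem_univ _, hx⟩)).differentiableAt
      (by simp)).hasFDerivAt
  have hqslice : ∀ τ, ∀ x ∈ O, (fderiv ℝ (uncurry q) (τ, x)).comp
      (ContinuousLinearMap.inr ℝ ℝ E) = fderiv ℝ (f (σ τ)) x := fun τ x hx ↦
    (hasFDerivAt_slice (f := q) hO (mem_univ τ) hx
      (hqder τ x hx).hasFDerivWithinAt).fderiv.symm
  set p : ℝ × E → ℝ × F := fun w ↦ (w.1, q w.1 w.2) with hp
  have hpd : ContDiffOn ℝ ∞ p (univ ×ˢ O) := contDiff_fst.contDiffOn.prodMk hqd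
  have hx₀' : ((θ t₀, x₀) : ℝ × E) ∈ (univ : Set ℝ) ×ˢ O := ⟨mem_univ _, hx₀⟩
  have hpa := hpd.contDiffAt (hUO.mem_nhds hx₀')
  obtain ⟨A, hA⟩ := isInvertible_fst_prod (L := fderiv ℝ (uncurry q) (θ t₀, x₀))
    (by rw [hqslice _ _ hx₀, hσθ _ ht₀]; exact hinv)
  have hpA : HasFDerivAt p (A : ℝ × E →L[ℝ] ℝ × F) (θ t₀, x₀) := by
    rw [hA]
    exact (hasFDerivAt_fst (p := ((θ t₀, x₀) : ℝ × E))).prodMk (hqder (θ t₀) x₀ hx₀)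
  set e := hpa.toOpenPartialHomeomorph p hpA (by simp) with he
  have hecoe : ∀ w, e w = p w := fun w ↦ rfl
  have hsrc : ((θ t₀, x₀) : ℝ × E) ∈ e.source :=
    hpa.mem_toOpenPartialHomeomorph_source hpA (by simp)
  -- a product neighbourhood on which `p` is injective with invertible derivatives
  have hopen : ∀ᶠ w : ℝ × E in 𝓝 (θ t₀, x₀), w ∈ e.source ∧ w.2 ∈ O ∧
      ((fderiv ℝ (uncurry q) w).comp (ContinuousLinearMap.inr ℝ ℝ E)).IsInvertible := by
    refine (e.open_source.eventually_mem hsrc).and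
      (((hUO.eventually_mem hx₀').mono fun w hw ↦ hw.2).and ?_)
    have hc : ContinuousAt (fun w ↦ (fderiv ℝ (uncurry q) w).comp
        (ContinuousLinearMap.inr ℝ ℝ E)) (θ t₀, x₀) :=
      (((hqd.contDiffAt (hUO.mem_nhds hx₀')).fderiv_right (m := 0) (by simp)).continuousAt).clm_comp
        continuousAt_const
    have hmem : (fderiv ℝ (uncurry q) (θ t₀, x₀)).comp (ContinuousLinearMap.inr ℝ ℝ E) ∈
        range ((↑) : (E ≃L[ℝ] F) → E →L[ℝ] F) := by
      rw [hqslice _ _ hx₀, hσθ _ ht₀]; exact hinv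
    exact hc.eventually (ContinuousLinearEquiv.isOpen.mem_nhds hmem)
  rw [nhds_prod_eq] at hopen
  obtain ⟨P, hP, Q, hQ, hPQ⟩ := eventually_prod_iff.1 hopen
  obtain ⟨B, hBP, hBo, hB⟩ := mem_nhds_iff.1 hP
  obtain ⟨W, hWQ, hWo, hW⟩ := mem_nhds_iff.1 hQ
  have hBW : ∀ {τ x}, τ ∈ B → x ∈ W → (τ, x) ∈ e.source ∧ x ∈ O ∧
      ((fderiv ℝ (uncurry q) (τ, x)).comp (ContinuousLinearMap.inr ℝ ℝ E)).IsInvertible :=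
    fun hτ hx ↦ hPQ (hBP hτ) (hWQ hx)
  have hT : IsOpen (e.target ∩ e.symm ⁻¹' (B ×ˢ W)) :=
    e.symm.isOpen_inter_preimage (hBo.prod hWo)
  set N : Set (ℝ × F) := (fun w : ℝ × F ↦ (θ w.1, w.2)) ⁻¹' (e.target ∩ e.symm ⁻¹' (B ×ˢ W))
    with hN
  have hmapc : Continuous fun w : ℝ × F ↦ (θ w.1, w.2) := by fun_prop
  have hNo : IsOpen N := hT.preimage hmapc
  set g : ℝ → F → E := fun t y ↦ (e.symm (θ t, y)).2 with hg
  have hgN : ∀ t ∈ Icc (0 : ℝ) 1, ∀ y, (t, y) ∈ N →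
      θ t ∈ B ∧ g t y ∈ W ∧ f t (g t y) = y := by
    intro t ht y hy
    have h1 : p (e.symm (θ t, y)) = (θ t, y) := e.right_inv hy.1
    have h2 : (e.symm (θ t, y)).1 = θ t := congrArg Prod.fst h1
    have h3 : f (σ (e.symm (θ t, y)).1) (e.symm (θ t, y)).2 = y := congrArg Prod.snd h1
    rw [h2, hσθ t ht] at h3
    exact ⟨h2 ▸ hy.2.1, hy.2.2, h3⟩
  have hleft : ∀ t ∈ Icc (0 : ℝ) 1, θ t ∈ B → ∀ x ∈ W, e.symm (θ t, f t x) = (θ t, x) := by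
    intro t ht htB x hx
    have h1 := e.left_inv (hBW htB hx).1
    rw [hecoe] at h1
    simpa only [hp, hq, hσθ t ht] using h1
  refine ⟨N, W, g, hNo, ?_, hWo, hW, fun x hx ↦ (hBW hB hx).2.1, ?_,
    fun t ht y hy ↦ (hgN t ht y hy).2, fun t ht x hx hy ↦ ?_⟩
  · have h2 := e.map_source hsrc
    rw [hecoe] at h2
    simp only [hp, hq, hσθ t₀ ht₀] at h2
    refine ⟨h2, ?_⟩
    rw [mem_preimage, hleft t₀ ht₀ hB x₀ hW]
    exact ⟨hB, hW⟩
  · have huE : UniqueDiffOn ℝ (Icc (0 : ℝ) 1 ×ˢ O) :=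
      (uniqueDiffOn_Icc zero_lt_one).prod hO.uniqueDiffOn
    have huF : UniqueDiffOn ℝ (N ∩ Icc (0 : ℝ) 1 ×ˢ univ) := by
      rw [inter_comm]
      exact ((uniqueDiffOn_Icc zero_lt_one).prod uniqueDiffOn_univ).inter hNo
    have hgc : ContinuousOn (uncurry g) (N ∩ Icc (0 : ℝ) 1 ×ˢ univ) :=
      continuous_snd.comp_continuousOn (e.continuousOn_symm.comp hmapc.continuousOn
        fun w hw ↦ hw.1.1)
    have key := contDiffOn_of_rightInvOn (f := fun w : ℝ × E ↦ (w.1, f w.1 w.2))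
      (g := fun w : ℝ × F ↦ (w.1, g w.1 w.2)) huF huE (contDiff_fst.contDiffOn.prodMk hf)
      (continuous_fst.continuousOn.prodMk hgc)
      (fun w hw ↦ ⟨hw.2.1, (hBW hB (hgN w.1 hw.2.1 w.2 hw.1).2.1).2.1⟩)
      (fun w hw ↦ Prod.ext rfl (hgN w.1 hw.2.1 w.2 hw.1).2.2) (fun w hw ↦ ?_)
    · exact contDiff_snd.comp_contDiffOn (f := fun w : ℝ × F ↦ (w.1, g w.1 w.2)) key
    · obtain ⟨hwB, hwW, -⟩ := hgN w.1 hw.2.1 w.2 hw.1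
      obtain ⟨-, hwO, hwi⟩ := hBW hwB hwW
      have hmem : (w.1, g w.1 w.2) ∈ Icc (0 : ℝ) 1 ×ˢ O := ⟨hw.2.1, hwO⟩
      have h1 := (hf.differentiableOn (by simp) _ hmem).hasFDerivWithinAt
      have h2 := (hasFDerivAt_fst (𝕜 := ℝ) (p := (w.1, g w.1 w.2))).hasFDerivWithinAt
        (s := Icc (0 : ℝ) 1 ×ˢ O)
      have h3 : HasFDerivWithinAt (fun w : ℝ × E ↦ (w.1, f w.1 w.2)) _ (Icc (0 : ℝ) 1 ×ˢ O)
          (w.1, g w.1 w.2) := h2.prodMk h1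
      rw [h3.fderivWithin (huE _ hmem)]
      apply isInvertible_fst_prod
      rw [← (hasFDerivAt_slice hO hw.2.1 hwO h1).fderiv]
      rwa [hqslice _ _ hwO, hσθ _ hw.2.1] at hwi
  · have h3 := (hgN t ht _ hy).1
    simp only [hg]
    rw [hleft t ht h3 x hx]

end Inverse

section Division

/-- Hadamard division with parameters: if `u` has no degenerate zero at `z₀`, then near `z₀` every
smooth family `v t`, `t ∈ [0,1]`, vanishing on the zero set of `u` is a smooth multiple of `u`.
In coordinates straightening `u`, the quotient is the integral of the derivative of `v` along
segments starting on the zero set. -/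
theorem exists_smooth_division {E : Type} [NormedAddCommGroup E] [NormedSpace ℝ E]
    [CompleteSpace E] {u : E → ℝ} {O : Set E} (hO : IsOpen O) {z₀ : E} (hz₀ : z₀ ∈ O)
    (hu : ContDiffOn ℝ ∞ u O) (h0 : u z₀ ≠ 0 ∨ fderiv ℝ u z₀ ≠ 0) :
    ∃ O' : Set E, IsOpen O' ∧ z₀ ∈ O' ∧ O' ⊆ O ∧ (∀ z ∈ O', ∃ᶠ w in 𝓝 z, u w ≠ 0) ∧
      ∀ v : ℝ → E → ℝ, ContDiffOn ℝ ∞ (uncurry v) (Icc 0 1 ×ˢ O) →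
        (∀ t ∈ Icc (0 : ℝ) 1, ∀ z ∈ O, u z = 0 → v t z = 0) →
        ∃ g : ℝ → E → ℝ, ContDiffOn ℝ ∞ (uncurry g) (Icc 0 1 ×ˢ O') ∧
          ∀ t ∈ Icc (0 : ℝ) 1, ∀ z ∈ O', v t z = g t z * u z := by
  by_cases hu0 : u z₀ = 0
  swap
  · have hopen : IsOpen (O ∩ u ⁻¹' {0}ᶜ) :=
      hu.continuousOn.isOpen_inter_preimage hO isOpen_compl_singleton
    refine ⟨O ∩ u ⁻¹' {0}ᶜ, hopen, ⟨hz₀, hu0⟩, inter_subset_left, fun z hz ↦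
      Eventually.frequently ((hopen.eventually_mem hz).mono fun w hw ↦ hw.2), fun v hv hv0 ↦
      ⟨fun t z ↦ v t z / u z, ?_, fun t ht z hz ↦ ?_⟩⟩
    · refine ContDiffOn.div (hv.mono (prod_mono_right inter_subset_left))
        (hu.comp contDiffOn_snd fun w hw ↦ hw.2.1) fun w hw ↦ hw.2.2
    · have : u z ≠ 0 := hz.2
      field_simp
  have hdu : fderiv ℝ u z₀ ≠ 0 := h0.resolve_left (not_not.2 hu0)
  set l := fderiv ℝ u z₀ with hl
  obtain ⟨e, he⟩ : ∃ e, l e = 1 := by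
    obtain ⟨e, he⟩ : ∃ e, l e ≠ 0 := by
      by_contra! h
      exact hdu (ContinuousLinearMap.ext h)
    exact ⟨(l e)⁻¹ • e, by simp [he]⟩
  -- in the coordinate `Θ z` the function `u` becomes the affine function `l (· - z₀)`
  set Θ : E → E := fun z ↦ z + (u z - l (z - z₀)) • e with hΘ
  have hΘd : ContDiffOn ℝ ∞ Θ O := contDiffOn_id.add
    ((hu.sub (l.contDiff.comp (contDiff_id.sub contDiff_const)).contDiffOn).smul contDiffOn_const)
  have hlΘ : ∀ z, l (Θ z - z₀) = u z := fun z ↦ by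
    simp only [hΘ, add_sub_right_comm, map_add, map_smul, he, smul_eq_mul]
    ring
  have hΘz : Θ z₀ = z₀ := by simp [hΘ, hu0]
  have hΘder : HasFDerivAt Θ (ContinuousLinearMap.id ℝ E) z₀ := by
    have h1 : HasFDerivAt u l z₀ :=
      ((hu.contDiffAt (hO.mem_nhds hz₀)).differentiableAt (by simp)).hasFDerivAt
    have h2 : HasFDerivAt (fun z ↦ l (z - z₀)) l z₀ := by
      exact l.hasFDerivAt.comp z₀ ((hasFDerivAt_id z₀).sub_const z₀)
    have h3 : HasFDerivAt Θ (ContinuousLinearMap.id ℝ E + (l - l).smulRight e) z₀ :=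
      (hasFDerivAt_id z₀).add ((h1.sub h2).smul_const e)
    have h4 : (0 : E →L[ℝ] ℝ).smulRight e = 0 := by ext; simp
    rwa [sub_self, h4, add_zero] at h3
  obtain ⟨N, W, σ, hNo, hzN, hWo, hzW, hWO, hσd, hσr, hσl⟩ := exists_inverse_family
    (f := fun _ : ℝ ↦ Θ) hO (hΘd.comp contDiffOn_snd fun w hw ↦ hw.2) (t₀ := 0) (by simp) hz₀
    (by
      rw [hΘder.fderiv]
      exact ⟨ContinuousLinearEquiv.refl ℝ E, rfl⟩)
  rw [hΘz] at hzN
  have h01 : (0 : ℝ) ∈ Icc (0 : ℝ) 1 := by simp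
  have hN0 : IsOpen {y : E | ((0 : ℝ), y) ∈ N} := hNo.preimage (by fun_prop)
  obtain ⟨r, hr, hrN⟩ := Metric.isOpen_iff.1 hN0 z₀ hzN
  set B := Metric.ball z₀ r with hB
  -- `π` projects to the zero set along `e`; it multiplies distances to `z₀` by at most `c`
  set c := 1 + ‖l‖ * ‖e‖ with hc
  have hc1 : 1 ≤ c := by simp only [hc]; linarith [mul_nonneg (norm_nonneg l) (norm_nonneg e)]
  set B' := Metric.ball z₀ (r / c) with hB'
  set π : E → E := fun ζ ↦ ζ - l (ζ - z₀) • e with hπ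
  have hπB : ∀ ζ ∈ B', π ζ ∈ B := fun ζ hζ ↦ by
    rw [hB', mem_ball_iff_norm] at hζ
    rw [hB, mem_ball_iff_norm]
    have h1 : π ζ - z₀ = (ζ - z₀) - l (ζ - z₀) • e := by simp only [hπ]; abel
    calc ‖π ζ - z₀‖ ≤ ‖ζ - z₀‖ + ‖l (ζ - z₀) • e‖ := by rw [h1]; exact norm_sub_le _ _
      _ ≤ ‖ζ - z₀‖ + ‖l‖ * ‖ζ - z₀‖ * ‖e‖ := by
        rw [norm_smul]
        gcongr
        exact l.le_opNorm _
      _ = c * ‖ζ - z₀‖ := by rw [hc]; ring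
      _ < c * (r / c) := by gcongr
      _ = r := by field_simp
  have hBB' : B' ⊆ B := Metric.ball_subset_ball (div_le_self hr.le hc1)
  -- the segment from `π ζ` to `ζ`
  set γ : E → ℝ → E := fun ζ θ ↦ π ζ + (θ * l (ζ - z₀)) • e with hγ
  have hγB : ∀ ζ ∈ B', ∀ θ ∈ Icc (0 : ℝ) 1, γ ζ θ ∈ B := fun ζ hζ θ hθ ↦ by
    have h1 := (convex_ball z₀ r).add_smul_sub_mem (hπB ζ hζ) (hBB' hζ) hθ
    have h2 : π ζ + θ • (ζ - π ζ) = γ ζ θ := by simp [hπ, hγ, mul_smul]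
    rwa [h2] at h1
  have hlπ : ∀ ζ, l (π ζ - z₀) = 0 := fun ζ ↦ by
    have h1 : π ζ - z₀ = (ζ - z₀) - l (ζ - z₀) • e := by simp only [hπ]; abel
    rw [h1, map_sub, map_smul, he]
    simp
  have hdudc : ContinuousOn (fderiv ℝ u) O := hu.continuousOn_fderiv_of_isOpen hO (by simp)
  have hO'1 : IsOpen (W ∩ Θ ⁻¹' B') :=
    (hΘd.continuousOn.mono hWO).isOpen_inter_preimage hWo Metric.isOpen_ball
  have hO'2 : IsOpen ((W ∩ Θ ⁻¹' B') ∩ fderiv ℝ u ⁻¹' {0}ᶜ) :=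
    (hdudc.mono (inter_subset_left.trans hWO)).isOpen_inter_preimage hO'1 isOpen_compl_singleton
  have hrc : 0 < r / c := by positivity
  refine ⟨_, hO'2, ⟨⟨hzW, ?_⟩, hdu⟩, fun z hz ↦ hWO hz.1.1, fun z hz ↦ ?_, fun v hv hv0 ↦ ?_⟩
  · rw [mem_preimage, hΘz]
    exact Metric.mem_ball_self hrc
  · rw [Filter.Frequently]
    intro h
    have h1 : u =ᶠ[𝓝 z] fun _ ↦ 0 := h.mono fun w hw ↦ not_not.1 hw
    exact hz.2 (by rw [h1.fderiv_eq]; simp)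
  have hσB : ∀ ζ ∈ B, σ 0 ζ ∈ W ∧ Θ (σ 0 ζ) = ζ := fun ζ hζ ↦ hσr 0 h01 ζ (hrN hζ)
  set V : ℝ → E → ℝ := fun t ζ ↦ v t (σ 0 ζ) with hV
  have huB : UniqueDiffOn ℝ (Icc (0 : ℝ) 1 ×ˢ B) :=
    (uniqueDiffOn_Icc zero_lt_one).prod Metric.isOpen_ball.uniqueDiffOn
  have hVd : ContDiffOn ℝ ∞ (uncurry V) (Icc 0 1 ×ˢ B) := by
    refine hv.comp (f := fun w : ℝ × E ↦ (w.1, σ 0 w.2)) (contDiffOn_fst.prodMk ?_)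
      fun w hw ↦ ⟨hw.1, hWO (hσB _ hw.2).1⟩
    exact hσd.comp (f := fun w : ℝ × E ↦ ((0 : ℝ), w.2)) (contDiffOn_const.prodMk contDiffOn_snd)
      fun w hw ↦ ⟨hrN hw.2, h01, mem_univ _⟩
  set D : ℝ × E → ℝ × E →L[ℝ] ℝ := fderivWithin ℝ (uncurry V) (Icc 0 1 ×ˢ B) with hD
  have hDd : ContDiffOn ℝ ∞ D (Icc 0 1 ×ˢ B) := hVd.fderivWithin huB (by simp)
  set G : ℝ × E → ℝ := fun w ↦ ∫ θ in (0 : ℝ)..1, D (w.1, γ w.2 θ) (0, e) with hG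
  have hGd : ContDiffOn ℝ ∞ G (Icc 0 1 ×ˢ B') := by
    refine contDiffOn_intervalIntegral (Z := ℝ × E) (h := fun w θ ↦ D (w.1, γ w.2 θ) (0, e))
      ((convex_Icc _ _).prod (convex_ball _ _))
      ((uniqueDiffOn_Icc zero_lt_one).prod Metric.isOpen_ball.uniqueDiffOn) ?_
    refine ContDiffOn.clm_apply ?_ contDiffOn_const
    refine hDd.comp (f := fun w : (ℝ × E) × ℝ ↦ (w.1.1, γ w.1.2 w.2)) ?_
      fun w hw ↦ ⟨hw.1.1, hγB _ hw.1.2 _ hw.2⟩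
    have hl' : ContDiff ℝ ∞ l := l.contDiff
    refine ContDiff.contDiffOn ?_
    simp only [hγ, hπ]
    fun_prop
  have hkey : ∀ t ∈ Icc (0 : ℝ) 1, ∀ ζ ∈ B', V t ζ = G (t, ζ) * l (ζ - z₀) := by
    intro t ht ζ hζ
    have hderiv : ∀ θ ∈ uIcc (0 : ℝ) 1, HasDerivAt (fun θ ↦ V t (γ ζ θ))
        (D (t, γ ζ θ) (0, e) * l (ζ - z₀)) θ := by
      intro θ hθ
      rw [uIcc_of_le zero_le_one] at hθ
      have h1 := hasFDerivAt_slice Metric.isOpen_ball ht (hγB ζ hζ θ hθ)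
        (hVd.differentiableOn (by simp) (t, γ ζ θ) ⟨ht, hγB ζ hζ θ hθ⟩).hasFDerivWithinAt
      have h2 : HasDerivAt (γ ζ) (l (ζ - z₀) • e) θ := by
        have h3 := (((hasDerivAt_id θ).mul_const (l (ζ - z₀))).smul_const e).const_add (π ζ)
        rwa [one_mul] at h3
      have h3 : D (t, γ ζ θ) (0, e) * l (ζ - z₀) =
          ((D (t, γ ζ θ)).comp (ContinuousLinearMap.inr ℝ ℝ E)) (l (ζ - z₀) • e) := by
        rw [map_smul, smul_eq_mul, mul_comm]
        rfl
      rw [h3]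
      exact h1.comp_hasDerivAt θ h2
    have hint : ContinuousOn (fun θ ↦ D (t, γ ζ θ) (0, e) * l (ζ - z₀)) (uIcc (0 : ℝ) 1) := by
      rw [uIcc_of_le zero_le_one]
      refine ContinuousOn.mul ?_ continuousOn_const
      refine ContinuousOn.clm_apply ?_ continuousOn_const
      refine hDd.continuousOn.comp (f := fun θ : ℝ ↦ (t, γ ζ θ)) ?_
        fun θ hθ ↦ ⟨ht, hγB ζ hζ θ hθ⟩
      simp only [hγ]
      fun_prop
    have h4 := intervalIntegral.integral_eq_sub_of_hasDerivAt hderiv hint.intervalIntegrable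
    have h5 : γ ζ 1 = ζ := by simp [hγ, hπ]
    have h6 : V t (γ ζ 0) = 0 := by
      have h7 : γ ζ 0 = π ζ := by simp [hγ]
      rw [h7]
      obtain ⟨h8, h9⟩ := hσB _ (hπB ζ hζ)
      refine hv0 t ht _ (hWO h8) ?_
      rw [← hlΘ, h9, hlπ]
    rw [h5, h6, sub_zero, intervalIntegral.integral_mul_const] at h4
    exact h4.symm
  refine ⟨fun t z ↦ G (t, Θ z), ?_, fun t ht z hz ↦ ?_⟩
  · exact hGd.comp (f := fun w : ℝ × E ↦ (w.1, Θ w.2)) (contDiffOn_fst.prodMk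
      (hΘd.comp contDiffOn_snd fun w hw ↦ hWO hw.2.1.1)) fun w hw ↦ ⟨hw.1, hw.2.1.2⟩
  · have h1 := hkey t ht (Θ z) hz.1.2
    have h2 : σ 0 (Θ z) = z := hσl 0 h01 z hz.1.1 (hrN (hBB' hz.1.2))
    simp only [hV] at h1
    rwa [h2, hlΘ] at h1

end Division

/-! ### Smooth dependence of solutions of ordinary differential equations on parameters -/

section ODE

universe u

/-- Uniformity in `t ∈ [0,1]`, by compactness of `[0,1]`. -/
theorem eventually_forall_norm_sub_lt {P G : Type*} [TopologicalSpace P] [NormedAddCommGroup G]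
    {f : ℝ → P → G} (hf : ContinuousOn (uncurry f) (Icc 0 1 ×ˢ univ)) (p₀ : P) {ε : ℝ}
    (hε : 0 < ε) : ∀ᶠ p in 𝓝 p₀, ∀ t ∈ Icc (0 : ℝ) 1, ‖f t p - f t p₀‖ < ε := by
  have h0 : ∀ᶠ p in 𝓝 p₀, ∀ t ∈ Icc (0 : ℝ) 1, t ∈ Icc (0 : ℝ) 1 → ‖f t p - f t p₀‖ < ε := by
    refine isCompact_Icc.eventually_forall_of_forall_eventually
      (P := fun p t ↦ t ∈ Icc (0 : ℝ) 1 → ‖f t p - f t p₀‖ < ε) fun t ht ↦ ?_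
    have h1 : ContinuousWithinAt (fun w : P × ℝ ↦ ‖f w.2 w.1 - f w.2 p₀‖) (univ ×ˢ Icc 0 1)
        (p₀, t) := by
      refine (ContinuousWithinAt.sub ?_ ?_).norm
      · exact (hf (t, p₀) ⟨ht, mem_univ _⟩).comp (f := fun w : P × ℝ ↦ (w.2, w.1))
          (x := (p₀, t)) (by fun_prop) fun w hw ↦ ⟨hw.2, mem_univ _⟩
      · exact (hf (t, p₀) ⟨ht, mem_univ _⟩).comp (f := fun w : P × ℝ ↦ (w.2, p₀))
          (x := (p₀, t)) (by fun_prop) fun w hw ↦ ⟨hw.2, mem_univ _⟩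
    have h3 := h1.eventually_lt_const (u := ε) (by simpa using hε)
    rw [eventually_nhdsWithin_iff] at h3
    filter_upwards [h3] with w hw hw'
    exact hw ⟨mem_univ _, hw'⟩
  exact h0.mono fun p hp t ht ↦ hp t ht ht

/-- Grönwall's inequality on `[0,1]`, both forward and backward from the time `s`. -/
theorem norm_le_of_norm_deriv_le {G : Type*} [NormedAddCommGroup G] [NormedSpace ℝ G]
    {y y' : ℝ → G} {s K δ ε : ℝ} (hs : s ∈ Icc (0 : ℝ) 1) (hK : 1 ≤ K) (hε : 0 ≤ ε)
    (hd : ∀ t ∈ Icc (0 : ℝ) 1, HasDerivWithinAt y (y' t) (Icc 0 1) t) (h0 : ‖y s‖ ≤ δ)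
    (hb : ∀ t ∈ Icc (0 : ℝ) 1, ‖y' t‖ ≤ K * ‖y t‖ + ε) {t : ℝ} (ht : t ∈ Icc (0 : ℝ) 1) :
    ‖y t‖ ≤ (δ + ε) * Real.exp K := by
  have hδ : 0 ≤ δ := (norm_nonneg _).trans h0
  have hK0 : 0 < K := by linarith
  have hgr : ∀ x, 0 ≤ x → x ≤ 1 → gronwallBound δ K ε x ≤ (δ + ε) * Real.exp K := by
    intro x hx hx1
    rw [gronwallBound_of_K_ne_0 hK0.ne']
    have h1 : Real.exp (K * x) ≤ Real.exp K := Real.exp_le_exp.2 (by nlinarith)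
    have h2 : ε / K ≤ ε := div_le_self hε hK
    have h3 : 1 ≤ Real.exp (K * x) := Real.one_le_exp (by positivity)
    have h4 : ε / K * (Real.exp (K * x) - 1) ≤ ε * Real.exp K := by
      apply mul_le_mul h2 (by linarith) (by linarith) hε
    have h5 : δ * Real.exp (K * x) ≤ δ * Real.exp K := by gcongr
    simp only
    linarith
  have hcont : ContinuousOn y (Icc 0 1) := fun t ht ↦ (hd t ht).continuousWithinAt
  rcases le_total s t with hst | hst
  · refine (norm_le_gronwallBound_of_norm_deriv_right_le (a := s) (b := 1) (f' := y')
      (hcont.mono (Icc_subset_Icc_left hs.1)) (fun x hx ↦ ?_) h0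
      (fun x hx ↦ hb x ⟨hs.1.trans hx.1, hx.2.le⟩) t ⟨hst, ht.2⟩).trans
      (hgr _ (by linarith) (by linarith [ht.2, hs.1]))
    exact (hd x ⟨hs.1.trans hx.1, hx.2.le⟩).mono_of_mem_nhdsWithin
      (mem_of_superset (Icc_mem_nhdsGE hx.2) (Icc_subset_Icc_left (hs.1.trans hx.1)))
  · have hneg : ∀ x ∈ Icc (-s) 0, -x ∈ Icc (0 : ℝ) 1 := fun x hx ↦
      ⟨by linarith [hx.2], by linarith [hx.1, hs.2]⟩
    have h1 := norm_le_gronwallBound_of_norm_deriv_right_le (a := -s) (b := 0)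
      (f := fun x ↦ y (-x)) (f' := fun x ↦ -y' (-x)) (δ := δ) (K := K) (ε := ε)
      (hcont.comp continuousOn_neg hneg) (fun x hx ↦ ?_) (by simpa using h0)
      (fun x hx ↦ by simpa using hb (-x) (hneg x ⟨hx.1, hx.2.le⟩)) (-t)
      ⟨by linarith, by linarith [ht.1]⟩
    · rw [neg_neg] at h1
      exact h1.trans (hgr _ (by linarith) (by linarith [ht.1, hs.2]))
    · have h2 := (hd (-x) (hneg x ⟨hx.1, hx.2.le⟩)).scomp (s := Icc (-s) 0) x
        (hasDerivAt_neg x).hasDerivWithinAt hneg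
      rw [neg_one_smul] at h2
      exact h2.mono_of_mem_nhdsWithin
        (mem_of_superset (Icc_mem_nhdsGE hx.2) (Icc_subset_Icc_left hx.1))

/-- A bounded, uniformly Lipschitz time-dependent vector field has integral curves on `[0,1]`. -/
theorem exists_integralCurve_of_lipschitz {E : Type*} [NormedAddCommGroup E] [NormedSpace ℝ E]
    [CompleteSpace E] {X : ℝ → E → E} {K L : NNReal}
    (hK : ∀ t ∈ Icc (0 : ℝ) 1, LipschitzWith K (X t))
    (hc : ∀ x, ContinuousOn (X · x) (Icc 0 1)) (hL : ∀ t ∈ Icc (0 : ℝ) 1, ∀ x, ‖X t x‖ ≤ L)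
    {s : ℝ} (hs : s ∈ Icc (0 : ℝ) 1) (x : E) :
    ∃ γ : ℝ → E, γ s = x ∧ ∀ t ∈ Icc (0 : ℝ) 1, HasDerivWithinAt γ (X t (γ t)) (Icc 0 1) t := by
  have h : IsPicardLindelof X (⟨s, hs⟩ : Icc (0 : ℝ) 1) x L 0 L K :=
    { lipschitzOnWith := fun t ht ↦ (hK t ht).lipschitzOnWith
      continuousOn := fun x _ ↦ hc x
      norm_le := fun t ht x _ ↦ hL t ht x
      mul_max_le := by
        have h1 : max (1 - s) (s - 0) ≤ 1 := max_le (by linarith [hs.1]) (by linarith [hs.2])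
        simp only [NNReal.coe_zero, sub_zero] at h1 ⊢
        exact mul_le_of_le_one_right L.2 h1 }
  exact h.exists_eq_forall_mem_Icc_hasDerivWithinAt₀

/-- Global solvability of linear differential equations. The coefficient is cut off outside a ball
that Grönwall's inequality prevents the solution from leaving. -/
theorem exists_solution_linear {G : Type*} [NormedAddCommGroup G] [NormedSpace ℝ G]
    [FiniteDimensional ℝ G] {L : ℝ → G →L[ℝ] G} (hL : ContinuousOn L (Icc 0 1)) {s : ℝ}
    (hs : s ∈ Icc (0 : ℝ) 1) (y₀ : G) :
    ∃ y : ℝ → G, y s = y₀ ∧ ∀ t ∈ Icc (0 : ℝ) 1, HasDerivWithinAt y (L t (y t)) (Icc 0 1) t := by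
  have : CompleteSpace G := FiniteDimensional.complete ℝ G
  obtain ⟨K₀, hK₀⟩ := isCompact_Icc.exists_bound_of_continuousOn hL
  set K := max K₀ 1 with hK
  have hK1 : 1 ≤ K := le_max_right _ _
  have hKb : ∀ t ∈ Icc (0 : ℝ) 1, ‖L t‖ ≤ K := fun t ht ↦ (hK₀ t ht).trans (le_max_left _ _)
  set R := ‖y₀‖ * Real.exp K + 1 with hR
  have hR0 : 0 < R := by positivity
  let ρ : ContDiffBump (0 : G) := ⟨R, R + 1, hR0, by linarith⟩
  set c : G → G := fun y ↦ ρ y • y with hc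
  have hcd : ContDiff ℝ 1 c := ρ.contDiff.smul contDiff_id
  have hcs : HasCompactSupport c := ρ.hasCompactSupport.smul_right
  obtain ⟨C, hC⟩ := hcd.lipschitzWith_of_hasCompactSupport hcs (by simp)
  obtain ⟨M, hM⟩ := hcd.continuous.bounded_above_of_compact_support hcs
  have hcle : ∀ y, ‖c y‖ ≤ ‖y‖ := fun y ↦ by
    rw [hc, norm_smul, Real.norm_of_nonneg ρ.nonneg]
    exact mul_le_of_le_one_left (norm_nonneg _) ρ.le_one
  have hM0 : 0 ≤ M := (norm_nonneg _).trans (hM 0)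
  have hK0 : 0 ≤ K := zero_le_one.trans hK1
  obtain ⟨y, hy0, hy⟩ := exists_integralCurve_of_lipschitz (X := fun t y ↦ L t (c y))
    (K := ⟨K, hK0⟩ * C) (L := ⟨K * M, mul_nonneg hK0 hM0⟩)
    (fun t ht ↦ (LipschitzWith.weaken (L t).lipschitz (hKb t ht)).comp hC)
    (fun x ↦ hL.clm_apply continuousOn_const) (fun t ht x ↦ ((L t).le_opNorm _).trans
      (mul_le_mul (hKb t ht) (hM x) (norm_nonneg _) hK0)) hs y₀
  · refine ⟨y, hy0, fun t ht ↦ ?_⟩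
    have h1 := norm_le_of_norm_deriv_le (ε := 0) hs hK1 le_rfl hy (by rw [hy0]) (fun t ht ↦ by
      rw [add_zero]
      refine ((L t).le_opNorm _).trans ?_
      gcongr
      · exact hKb t ht
      · exact hcle _) ht
    have h2 : c (y t) = y t := by
      rw [hc]
      simp only
      rw [ρ.one_of_mem_closedBall, one_smul]
      rw [mem_closedBall_zero_iff]
      simp only [add_zero] at h1
      exact h1.trans (by simp [ρ, hR])
    have := hy t ht
    rwa [h2] at this

section Dependence

variable {P F : Type*} [NormedAddCommGroup P] [NormedSpace ℝ P] [FiniteDimensional ℝ P]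
  [NormedAddCommGroup F] [NormedSpace ℝ F]

/-- The first-order Taylor expansion of `X t` at `γ t`, uniform in `t`. -/
theorem exists_taylor_along {X : ℝ → F → F} {D : ℝ → F → F →L[ℝ] F}
    (hD : ∀ t ∈ Icc (0 : ℝ) 1, ∀ x, HasFDerivAt (X t) (D t x) x)
    (hDc : ContinuousOn (uncurry D) (Icc 0 1 ×ˢ univ)) {γ : ℝ → F}
    (hγ : ContinuousOn γ (Icc 0 1)) {ε : ℝ} (hε : 0 < ε) :
    ∃ δ > 0, ∀ t ∈ Icc (0 : ℝ) 1, ∀ x, ‖x - γ t‖ < δ →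
      ‖X t x - X t (γ t) - D t (γ t) (x - γ t)‖ ≤ ε * ‖x - γ t‖ := by
  have h1 : ContinuousOn (uncurry fun t v ↦ D t (γ t + v)) (Icc 0 1 ×ˢ univ) := by
    refine hDc.comp (f := fun w : ℝ × F ↦ (w.1, γ w.1 + w.2)) (continuousOn_fst.prodMk
      ((hγ.comp continuousOn_fst fun w hw ↦ hw.1).add continuousOn_snd))
      fun w hw ↦ ⟨hw.1, mem_univ _⟩
  obtain ⟨δ, hδ, h2⟩ := Metric.eventually_nhds_iff_ball.1
    (eventually_forall_norm_sub_lt h1 (0 : F) hε)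
  refine ⟨δ, hδ, fun t ht x hx ↦ ?_⟩
  refine Convex.norm_image_sub_le_of_norm_hasFDerivWithin_le' (s := Metric.ball (γ t) δ)
    (f' := D t) (fun w _ ↦ (hD t ht w).hasFDerivWithinAt) (fun w hw ↦ ?_) (convex_ball _ _)
    (Metric.mem_ball_self hδ) (mem_ball_iff_norm.2 hx)
  have h3 := h2 (w - γ t) (by simpa [dist_eq_norm] using hw) t ht
  simp only [add_sub_cancel, add_zero] at h3
  exact h3.le

variable [FiniteDimensional ℝ F]

/-- Differentiability of solutions with respect to a parameter: the partial derivative `A` is the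
solution of the linearized equation. -/
theorem exists_variational_solution {X : ℝ → F → F} {D : ℝ → F → F →L[ℝ] F}
    (hD : ∀ t ∈ Icc (0 : ℝ) 1, ∀ x, HasFDerivAt (X t) (D t x) x)
    (hDc : ContinuousOn (uncurry D) (Icc 0 1 ×ˢ univ)) {Φ : ℝ → P → F}
    (hΦc : ContinuousOn (uncurry Φ) (Icc 0 1 ×ˢ univ))
    (hΦ : ∀ t ∈ Icc (0 : ℝ) 1, ∀ p, HasDerivWithinAt (Φ · p) (X t (Φ t p)) (Icc 0 1) t)
    {s : ℝ} (hs : s ∈ Icc (0 : ℝ) 1) {A₀ : P → P →L[ℝ] F}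
    (hA₀ : ∀ p, HasFDerivAt (Φ s) (A₀ p) p) (hA₀c : Continuous A₀) :
    ∃ A : ℝ → P → P →L[ℝ] F, (∀ p, A s p = A₀ p) ∧
      (∀ t ∈ Icc (0 : ℝ) 1, ∀ p,
        HasDerivWithinAt (A · p) ((D t (Φ t p)).comp (A t p)) (Icc 0 1) t) ∧
      ContinuousOn (uncurry A) (Icc 0 1 ×ˢ univ) ∧
      ∀ t ∈ Icc (0 : ℝ) 1, ∀ p, HasFDerivWithinAt (uncurry Φ)
        ((ContinuousLinearMap.toSpanSingleton ℝ (X t (Φ t p))).coprod (A t p))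
        (Icc 0 1 ×ˢ univ) (t, p) := by
  -- the coefficient of the linearized equation
  have hLc : ContinuousOn (uncurry fun t p ↦ D t (Φ t p)) (Icc 0 1 ×ˢ univ) :=
    hDc.comp (f := fun w : ℝ × P ↦ (w.1, Φ w.1 w.2)) (continuousOn_fst.prodMk hΦc)
      fun w hw ↦ ⟨hw.1, mem_univ _⟩
  have hslice : ∀ p, MapsTo (fun t : ℝ ↦ (t, p)) (Icc 0 1) (Icc (0 : ℝ) 1 ×ˢ (univ : Set P)) :=
    fun p t ht ↦ ⟨ht, mem_univ _⟩
  have hLc1 : ∀ p, ContinuousOn (fun t ↦ D t (Φ t p)) (Icc 0 1) := fun p ↦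
    hLc.comp (f := fun t : ℝ ↦ (t, p)) (by fun_prop) (hslice p)
  have hΦc1 : ∀ p, ContinuousOn (fun t ↦ Φ t p) (Icc 0 1) := fun p ↦
    hΦc.comp (f := fun t : ℝ ↦ (t, p)) (by fun_prop) (hslice p)
  have hex : ∀ p, ∃ y : ℝ → P →L[ℝ] F, y s = A₀ p ∧ ∀ t ∈ Icc (0 : ℝ) 1,
      HasDerivWithinAt y ((D t (Φ t p)).comp (y t)) (Icc 0 1) t := fun p ↦
    exists_solution_linear (G := P →L[ℝ] F)
      (L := fun t ↦ ContinuousLinearMap.compL ℝ P F F (D t (Φ t p)))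
      ((ContinuousLinearMap.compL ℝ P F F).continuous.comp_continuousOn (hLc1 p)) hs (A₀ p)
  choose B hB0 hB using hex
  set A : ℝ → P → P →L[ℝ] F := fun t p ↦ B p t with hA
  have hAd : ∀ t ∈ Icc (0 : ℝ) 1, ∀ p,
      HasDerivWithinAt (A · p) ((D t (Φ t p)).comp (A t p)) (Icc 0 1) t := fun t ht p ↦ hB p t ht
  have hAc1 : ∀ p, ContinuousOn (fun t ↦ A t p) (Icc 0 1) := fun p t ht ↦
    (hAd t ht p).continuousWithinAt
  have hAs : ∀ p, A s p = A₀ p := hB0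
  -- local uniform bounds for the coefficient
  have hbound : ∀ p₀, ∃ K, 1 ≤ K ∧ (∀ t ∈ Icc (0 : ℝ) 1, ‖D t (Φ t p₀)‖ ≤ K) ∧
      (∀ t ∈ Icc (0 : ℝ) 1, ‖A t p₀‖ ≤ K) ∧
      ∀ᶠ p in 𝓝 p₀, ∀ t ∈ Icc (0 : ℝ) 1, ‖D t (Φ t p)‖ ≤ K := by
    intro p₀
    obtain ⟨K₁, hK₁⟩ := isCompact_Icc.exists_bound_of_continuousOn (hLc1 p₀)
    obtain ⟨K₂, hK₂⟩ := isCompact_Icc.exists_bound_of_continuousOn (hAc1 p₀)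
    have h1 := le_max_left K₁ K₂
    have h2 := le_max_right K₁ K₂
    refine ⟨max K₁ K₂ + 1, ?_, fun t ht ↦ by linarith [hK₁ t ht],
      fun t ht ↦ by linarith [hK₂ t ht], ?_⟩
    · have := (norm_nonneg _).trans (hK₁ s hs)
      linarith
    · filter_upwards [eventually_forall_norm_sub_lt hLc p₀ zero_lt_one] with p hp t ht
      have h3 := norm_le_norm_add_norm_sub (D t (Φ t p₀)) (D t (Φ t p))
      have h4 := hp t ht
      rw [norm_sub_rev] at h3
      linarith [hK₁ t ht]
  -- continuity of `A` in the parameter, uniformly in time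
  have hAunif : ∀ p₀, ∀ η > 0, ∀ᶠ p in 𝓝 p₀, ∀ t ∈ Icc (0 : ℝ) 1, ‖A t p - A t p₀‖ < η := by
    intro p₀ η hη
    obtain ⟨K, hK1, -, hKA, hKev⟩ := hbound p₀
    set ε := η / (2 * (1 + K) * Real.exp K) with hε
    have hε0 : 0 < ε := by positivity
    have hA0ev : ∀ᶠ p in 𝓝 p₀, ‖A₀ p - A₀ p₀‖ < ε := by
      simpa [dist_eq_norm] using Metric.tendsto_nhds.1 hA₀c.continuousAt ε hε0
    filter_upwards [hKev, eventually_forall_norm_sub_lt hLc p₀ hε0, hA0ev] with p h1 h2 h3 t ht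
    have h4 := norm_le_of_norm_deriv_le (y := fun t ↦ A t p - A t p₀)
      (y' := fun t ↦ (D t (Φ t p)).comp (A t p) - (D t (Φ t p₀)).comp (A t p₀)) (δ := ε)
      (ε := ε * K) hs hK1 (by positivity) (fun t ht ↦ (hAd t ht p).sub (hAd t ht p₀))
      (by simpa only [hAs] using h3.le) (fun t ht ↦ ?_) ht
    · have h5 : (ε + ε * K) * Real.exp K = η / 2 := by
        rw [hε]
        field_simp
      linarith
    · have h5 : (D t (Φ t p)).comp (A t p) - (D t (Φ t p₀)).comp (A t p₀) =
          (D t (Φ t p)).comp (A t p - A t p₀) + (D t (Φ t p) - D t (Φ t p₀)).comp (A t p₀) := by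
        ext v
        simp
      rw [h5]
      refine (norm_add_le _ _).trans (add_le_add ?_ ?_)
      · exact (ContinuousLinearMap.opNorm_comp_le _ _).trans
          (mul_le_mul_of_nonneg_right (h1 t ht) (norm_nonneg _))
      · exact (ContinuousLinearMap.opNorm_comp_le _ _).trans
          (mul_le_mul (h2 t ht).le (hKA t ht) (norm_nonneg _) hε0.le)
  refine ⟨A, hAs, hAd, ?_, fun t₀ ht₀ p₀ ↦ ?_⟩
  · rintro ⟨t₀, p₀⟩ ⟨ht₀, -⟩
    refine Metric.tendsto_nhds.2 fun η hη ↦ ?_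
    have h1 : ∀ᶠ t in 𝓝[Icc 0 1] t₀, ‖A t p₀ - A t₀ p₀‖ < η / 2 := by
      simpa [dist_eq_norm] using Metric.tendsto_nhds.1 (hAc1 p₀ t₀ ht₀) (η / 2) (by positivity)
    have h2 := (h1.and self_mem_nhdsWithin).prod_mk (hAunif p₀ (η / 2) (by positivity))
    rw [nhdsWithin_prod_eq, nhdsWithin_univ]
    filter_upwards [h2] with w hw
    rw [dist_eq_norm]
    have h3 := norm_add_le (A w.1 w.2 - A w.1 p₀) (A w.1 p₀ - A t₀ p₀)
    rw [sub_add_sub_cancel] at h3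
    have h4 := hw.2 w.1 hw.1.2
    have h5 := hw.1.1
    simp only [uncurry]
    linarith
  -- the uniform first-order expansion in the parameter
  have hexp : ∀ c > 0, ∀ᶠ p in 𝓝 p₀, ∀ t ∈ Icc (0 : ℝ) 1,
      ‖Φ t p - Φ t p₀ - A t p₀ (p - p₀)‖ ≤ c * ‖p - p₀‖ := by
    intro c hc
    obtain ⟨K, hK1, hKD, hKA, -⟩ := hbound p₀
    set ε := min 1 (c / ((1 + K) * Real.exp (K + 1))) with hε
    have hε0 : 0 < ε := by positivity
    have hε1 : ε ≤ 1 := min_le_left _ _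
    obtain ⟨δ, hδ, htay⟩ := exists_taylor_along hD hDc (hΦc1 p₀) hε0
    have h0 : ∀ᶠ p in 𝓝 p₀, ‖Φ s p - Φ s p₀ - A₀ p₀ (p - p₀)‖ ≤ ε * ‖p - p₀‖ :=
      (hasFDerivAt_iff_isLittleO.1 (hA₀ p₀)).def hε0
    filter_upwards [eventually_forall_norm_sub_lt hΦc p₀ hδ, h0] with p h1 h2 t ht
    have h4 := norm_le_of_norm_deriv_le (K := K + 1)
      (y := fun t ↦ Φ t p - Φ t p₀ - A t p₀ (p - p₀))
      (y' := fun t ↦ X t (Φ t p) - X t (Φ t p₀) - (D t (Φ t p₀)).comp (A t p₀) (p - p₀))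
      (δ := ε * ‖p - p₀‖) (ε := ε * K * ‖p - p₀‖) hs (by linarith) (by positivity)
      (fun t ht ↦ ((hΦ t ht p).sub (hΦ t ht p₀)).sub
        ((hAd t ht p₀).clm_apply (hasDerivWithinAt_const t _ (p - p₀)) |>.congr_deriv (by simp)))
      (by simpa only [hAs] using h2) (fun t ht ↦ ?_) ht
    · refine h4.trans ?_
      have h5 : (ε * ‖p - p₀‖ + ε * K * ‖p - p₀‖) * Real.exp (K + 1) =
          ε * ((1 + K) * Real.exp (K + 1)) * ‖p - p₀‖ := by ring
      rw [h5]
      gcongr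
      have hpos : 0 < (1 + K) * Real.exp (K + 1) := by positivity
      exact (le_div_iff₀ hpos).1 (min_le_right _ _)
    · set e := Φ t p - Φ t p₀ - A t p₀ (p - p₀) with he
      have h5 := htay t ht (Φ t p) (h1 t ht)
      have h6 : Φ t p - Φ t p₀ = e + A t p₀ (p - p₀) := by rw [he]; abel
      have h7 : X t (Φ t p) - X t (Φ t p₀) - (D t (Φ t p₀)).comp (A t p₀) (p - p₀) =
          (X t (Φ t p) - X t (Φ t p₀) - D t (Φ t p₀) (Φ t p - Φ t p₀)) + D t (Φ t p₀) e := by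
        rw [h6, map_add]
        simp only [ContinuousLinearMap.comp_apply]
        abel
      have h8 : ‖Φ t p - Φ t p₀‖ ≤ ‖e‖ + K * ‖p - p₀‖ := by
        rw [h6]
        refine (norm_add_le _ _).trans ?_
        gcongr
        exact ((A t p₀).le_opNorm _).trans (by gcongr; exact hKA t ht)
      rw [h7]
      refine (norm_add_le _ _).trans ?_
      have h9 : ‖D t (Φ t p₀) e‖ ≤ K * ‖e‖ :=
        ((D t (Φ t p₀)).le_opNorm _).trans (by gcongr; exact hKD t ht)
      have h10 : ε * ‖Φ t p - Φ t p₀‖ ≤ ε * (‖e‖ + K * ‖p - p₀‖) := by gcongr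
      have h11 : ε * ‖e‖ ≤ 1 * ‖e‖ := by gcongr
      linarith
  refine HasFDerivWithinAt.of_isLittleO (Asymptotics.isLittleO_iff.2 fun c hc ↦ ?_)
  have h1 := (hasDerivWithinAt_iff_isLittleO.1 (hΦ t₀ ht₀ p₀)).def (half_pos hc)
  have h2 : ∀ᶠ t in 𝓝[Icc 0 1] t₀, ‖A t p₀ - A t₀ p₀‖ < c / 4 := by
    simpa [dist_eq_norm] using Metric.tendsto_nhds.1 (hAc1 p₀ t₀ ht₀) (c / 4) (by positivity)
  have h3 := ((h1.and h2).and self_mem_nhdsWithin).prod_mk (hexp (c / 4) (by positivity))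
  rw [nhdsWithin_prod_eq, nhdsWithin_univ]
  filter_upwards [h3] with w hw
  obtain ⟨⟨⟨hw1, hw2⟩, hw3⟩, hw4⟩ := hw
  have hw5 := hw4 w.1 hw3
  have e1 : uncurry Φ w - uncurry Φ (t₀, p₀) - ((ContinuousLinearMap.toSpanSingleton ℝ
      (X t₀ (Φ t₀ p₀))).coprod (A t₀ p₀)) (w - (t₀, p₀)) =
      (Φ w.1 w.2 - Φ w.1 p₀ - A w.1 p₀ (w.2 - p₀)) +
      (Φ w.1 p₀ - Φ t₀ p₀ - (w.1 - t₀) • X t₀ (Φ t₀ p₀)) +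
      (A w.1 p₀ - A t₀ p₀) (w.2 - p₀) := by
    simp only [uncurry, ContinuousLinearMap.coprod_apply,
      ContinuousLinearMap.toSpanSingleton_apply, Prod.fst_sub, Prod.snd_sub,
      sub_apply]
    abel
  have e2 : ‖w.1 - t₀‖ ≤ ‖w - (t₀, p₀)‖ := norm_fst_le (w - (t₀, p₀))
  have e3 : ‖w.2 - p₀‖ ≤ ‖w - (t₀, p₀)‖ := norm_snd_le (w - (t₀, p₀))
  rw [e1]
  have e4 : ‖(A w.1 p₀ - A t₀ p₀) (w.2 - p₀)‖ ≤ c / 4 * ‖w.2 - p₀‖ :=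
    ((A w.1 p₀ - A t₀ p₀).le_opNorm _).trans (by gcongr)
  have e5 : c / 4 * ‖w.2 - p₀‖ ≤ c / 4 * ‖w - (t₀, p₀)‖ := by gcongr
  have e6 : c / 2 * ‖w.1 - t₀‖ ≤ c / 2 * ‖w - (t₀, p₀)‖ := by gcongr
  refine (norm_add₃_le).trans ?_
  linarith

end Dependence

/-- Solutions of a differential equation with `C^n` right-hand side depend `C^n` on a parameter that
enters through `C^n` initial values. The induction on `n` applies the statement to the equation
together with its linearization. -/
theorem contDiffOn_solution_nat {P : Type u} [NormedAddCommGroup P] [NormedSpace ℝ P]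
    [FiniteDimensional ℝ P] {s : ℝ} (hs : s ∈ Icc (0 : ℝ) 1) (n : ℕ) :
    ∀ {F : Type u} [NormedAddCommGroup F] [NormedSpace ℝ F] [FiniteDimensional ℝ F]
      {X : ℝ → F → F} {Φ : ℝ → P → F}, ContDiffOn ℝ n (uncurry X) (Icc 0 1 ×ˢ univ) →
      ContinuousOn (uncurry Φ) (Icc 0 1 ×ˢ univ) → ContDiff ℝ n (Φ s) →
      (∀ t ∈ Icc (0 : ℝ) 1, ∀ p, HasDerivWithinAt (Φ · p) (X t (Φ t p)) (Icc 0 1) t) →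
      ContDiffOn ℝ n (uncurry Φ) (Icc 0 1 ×ˢ univ) := by
  induction n with
  | zero =>
    intro F _ _ _ X Φ _ hΦc _ _
    exact contDiffOn_zero.2 hΦc
  | succ n ih =>
    intro F _ _ _ X Φ hX hΦc h0 hΦ
    have huF : UniqueDiffOn ℝ (Icc (0 : ℝ) 1 ×ˢ (univ : Set F)) :=
      (uniqueDiffOn_Icc zero_lt_one).prod uniqueDiffOn_univ
    have huP : UniqueDiffOn ℝ (Icc (0 : ℝ) 1 ×ˢ (univ : Set P)) :=
      (uniqueDiffOn_Icc zero_lt_one).prod uniqueDiffOn_univ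
    rw [Nat.cast_add, Nat.cast_one] at hX h0 ⊢
    obtain ⟨-, X', hX', hXd⟩ :=
      (contDiffOn_succ_iff_hasFDerivWithinAt_of_uniqueDiffOn huF).1 hX
    set D : ℝ → F → F →L[ℝ] F := fun t x ↦ (X' (t, x)).comp (ContinuousLinearMap.inr ℝ ℝ F)
      with hD
    have hDd : ∀ t ∈ Icc (0 : ℝ) 1, ∀ x, HasFDerivAt (X t) (D t x) x := fun t ht x ↦
      hasFDerivAt_slice isOpen_univ ht (mem_univ x) (hXd (t, x) ⟨ht, mem_univ _⟩)
    have hDn : ContDiffOn ℝ n (uncurry D) (Icc 0 1 ×ˢ univ) := hX'.clm_comp contDiffOn_const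
    obtain ⟨A, hAs, hAd, hAc, hΦd⟩ := exists_variational_solution hDd hDn.continuousOn hΦc hΦ hs
      (A₀ := fderiv ℝ (Φ s)) (fun p ↦ ((h0.differentiable (by simp)) p).hasFDerivAt)
      (h0.continuous_fderiv (by simp))
    have hXn : ContDiffOn ℝ n (uncurry X) (Icc 0 1 ×ˢ univ) := hX.of_le (by simp)
    have hΦs : ContDiff ℝ n (Φ s) := h0.of_le (by simp)
    have hpair : ContDiffOn ℝ n (uncurry fun t p ↦ (Φ t p, A t p)) (Icc 0 1 ×ˢ univ) := by
      refine ih (F := F × (P →L[ℝ] F)) (X := fun t w ↦ (X t w.1, (D t w.1).comp w.2)) ?_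
        (hΦc.prodMk hAc) ?_ fun t ht p ↦ (hΦ t ht p).prodMk (hAd t ht p)
      · have hm : ContDiff ℝ n fun w : ℝ × F × (P →L[ℝ] F) ↦ (w.1, w.2.1) := by fun_prop
        have hm' : MapsTo (fun w : ℝ × F × (P →L[ℝ] F) ↦ (w.1, w.2.1)) (Icc 0 1 ×ˢ univ)
            (Icc (0 : ℝ) 1 ×ˢ univ) := fun w hw ↦ ⟨hw.1, mem_univ _⟩
        exact (hXn.comp hm.contDiffOn hm').prodMk ((hDn.comp hm.contDiffOn hm').clm_comp
          (contDiff_snd.comp contDiff_snd).contDiffOn)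
      · have : A s = fderiv ℝ (Φ s) := funext hAs
        rw [this]
        exact hΦs.prodMk (h0.fderiv_right le_rfl)
    refine (contDiffOn_succ_iff_hasFDerivWithinAt_of_uniqueDiffOn huP).2 ⟨by simp,
      fun w ↦ (ContinuousLinearMap.toSpanSingleton ℝ (X w.1 (Φ w.1 w.2))).coprod (A w.1 w.2),
      ?_, fun w hw ↦ hΦd w.1 hw.1 w.2⟩
    have hΦn : ContDiffOn ℝ n (uncurry Φ) (Icc 0 1 ×ˢ univ) := contDiff_fst.comp_contDiffOn hpair
    have hAn : ContDiffOn ℝ n (uncurry A) (Icc 0 1 ×ˢ univ) := contDiff_snd.comp_contDiffOn hpair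
    have hXΦ : ContDiffOn ℝ n (fun w : ℝ × P ↦ X w.1 (Φ w.1 w.2)) (Icc 0 1 ×ˢ univ) :=
      hXn.comp (f := fun w : ℝ × P ↦ (w.1, Φ w.1 w.2)) (contDiffOn_fst.prodMk hΦn)
        fun w hw ↦ ⟨hw.1, mem_univ _⟩
    have hts : ContDiffOn ℝ n (fun w : ℝ × P ↦ ContinuousLinearMap.toSpanSingleton ℝ
        (X w.1 (Φ w.1 w.2))) (Icc 0 1 ×ˢ univ) :=
      (ContinuousLinearMap.toSpanSingletonCLE (𝕜 := ℝ) (E := F)).contDiff.comp_contDiffOn hXΦ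
    have hsum := (hts.clm_comp (contDiffOn_const (c := ContinuousLinearMap.fst ℝ ℝ P))).add
      (hAn.clm_comp (contDiffOn_const (c := ContinuousLinearMap.snd ℝ ℝ P)))
    refine hsum.congr fun w _ ↦ ?_
    ext v <;> simp [uncurry]

/-- The global flow of a bounded, uniformly Lipschitz smooth vector field on `[0,1]`. -/
theorem exists_smooth_flow_of_lipschitz {F : Type u} [NormedAddCommGroup F] [NormedSpace ℝ F]
    [FiniteDimensional ℝ F] {X : ℝ → F → F} (hX : ContDiffOn ℝ ∞ (uncurry X) (Icc 0 1 ×ˢ univ))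
    {K L : NNReal} (hK : ∀ t ∈ Icc (0 : ℝ) 1, LipschitzWith K (X t))
    (hL : ∀ t ∈ Icc (0 : ℝ) 1, ∀ x, ‖X t x‖ ≤ L) {s : ℝ} (hs : s ∈ Icc (0 : ℝ) 1) :
    ∃ Φ : ℝ → F → F, (∀ x, Φ s x = x) ∧ ContDiffOn ℝ ∞ (uncurry Φ) (Icc 0 1 ×ˢ univ) ∧
      ∀ t ∈ Icc (0 : ℝ) 1, ∀ x, HasDerivWithinAt (Φ · x) (X t (Φ t x)) (Icc 0 1) t := by
  have : CompleteSpace F := FiniteDimensional.complete ℝ F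
  have hc : ∀ x, ContinuousOn (X · x) (Icc 0 1) := fun x ↦
    hX.continuousOn.comp (f := fun t : ℝ ↦ (t, x)) (by fun_prop) fun t ht ↦ ⟨ht, mem_univ _⟩
  choose γ hγ0 hγ using exists_integralCurve_of_lipschitz hK hc hL hs
  refine ⟨fun t x ↦ γ x t, hγ0, ?_, fun t ht x ↦ hγ x t ht⟩
  have hLip : ∀ t ∈ Icc (0 : ℝ) 1, LipschitzWith (Real.toNNReal (Real.exp (max K 1)))
      fun x ↦ γ x t := by
    intro t ht
    refine LipschitzWith.of_dist_le_mul fun x y ↦ ?_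
    have h1 := norm_le_of_norm_deriv_le (K := max K 1) (ε := 0) hs (le_max_right _ _) le_rfl
      (fun t ht ↦ (hγ x t ht).sub (hγ y t ht)) le_rfl (fun t ht ↦ by
        rw [add_zero, Pi.sub_apply, ← dist_eq_norm, ← dist_eq_norm]
        refine ((hK t ht).dist_le_mul _ _).trans ?_
        gcongr
        exact le_max_left _ _) ht
    simp only [Pi.sub_apply, hγ0, add_zero] at h1
    rw [dist_eq_norm, dist_eq_norm, Real.coe_toNNReal _ (Real.exp_nonneg _), mul_comm]
    exact h1
  have hΦc : ContinuousOn (uncurry fun t x ↦ γ x t) (Icc 0 1 ×ˢ univ) := by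
    have h1 := continuousOn_prod_of_continuousOn_lipschitzOnWith
      (f := fun w : F × ℝ ↦ γ w.1 w.2) (s := univ) (t := Icc (0 : ℝ) 1) _
      (fun x _ t ht ↦ (hγ x t ht).continuousWithinAt) fun t ht ↦ (hLip t ht).lipschitzOnWith
    exact h1.comp (f := fun w : ℝ × F ↦ (w.2, w.1)) (by fun_prop) fun w hw ↦ ⟨hw.2, hw.1⟩
  refine contDiffOn_infty.2 fun n ↦ contDiffOn_solution_nat hs n (contDiffOn_infty.1 hX n) hΦc ?_
    fun t ht x ↦ hγ x t ht
  have : (fun x ↦ γ x s) = id := funext hγ0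
  simp only [this]
  exact contDiff_id

end ODE

/-! ### Derivatives in charts -/

section Charts

variable {E : Type*} [NormedAddCommGroup E] [NormedSpace ℝ E]
  {M : Type*} [TopologicalSpace M] [ChartedSpace E M]

/-- The derivative of the preferred chart around `y₀` at the point `y`, on the model space. -/
noncomputable def dchart (y₀ y : M) : E →L[ℝ] E :=
  mfderiv 𝓘(ℝ, E) 𝓘(ℝ, E) (extChartAt 𝓘(ℝ, E) y₀) y

/-- The derivative at `x` of the inverse of the preferred chart around `y₀`. -/
noncomputable def dchartSymm (y₀ : M) (x : E) : E →L[ℝ] E :=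
  mfderiv 𝓘(ℝ, E) 𝓘(ℝ, E) (extChartAt 𝓘(ℝ, E) y₀).symm x

variable {Z : Type*} [NormedAddCommGroup Z] [NormedSpace ℝ Z] {f : Z → M} {S : Set Z} {q : Z}

/-- The derivative within `S` of a map `f` from a normed space to a manifold, on the model space. -/
noncomputable def derivOn (f : Z → M) (S : Set Z) (q : Z) : Z →L[ℝ] E :=
  mfderivWithin 𝓘(ℝ, Z) 𝓘(ℝ, E) f S q

theorem hasMFDerivWithinAt_derivOn (hf : ContMDiffWithinAt 𝓘(ℝ, Z) 𝓘(ℝ, E) ∞ f S q) :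
    HasMFDerivWithinAt 𝓘(ℝ, Z) 𝓘(ℝ, E) f S q (derivOn (E := E) (Z := Z) f S q) :=
  (hf.mdifferentiableWithinAt (by simp)).hasMFDerivWithinAt

variable [IsManifold 𝓘(ℝ, E) ∞ M]

theorem dchartSymm_comp_dchart (y₀ : M) {y : M} (hy : y ∈ (extChartAt 𝓘(ℝ, E) y₀).source) :
    (dchartSymm y₀ (extChartAt 𝓘(ℝ, E) y₀ y)).comp (dchart y₀ y) =
      ContinuousLinearMap.id ℝ E := by
  have h := mfderivWithin_extChartAt_symm_comp_mfderiv_extChartAt' (I := 𝓘(ℝ, E)) hy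
  rw [ModelWithCorners.range_eq_univ, mfderivWithin_univ] at h
  exact h

theorem dchartSymm_dchart (y₀ : M) {y : M} (hy : y ∈ (extChartAt 𝓘(ℝ, E) y₀).source) (v : E) :
    dchartSymm y₀ (extChartAt 𝓘(ℝ, E) y₀ y) (dchart y₀ y v) = v :=
  congrArg (fun L : E →L[ℝ] E ↦ L v) (dchartSymm_comp_dchart y₀ hy)

theorem dchart_self (y : M) : dchart y y = ContinuousLinearMap.id ℝ E :=
  mfderiv_extChartAt_self

theorem hasMFDerivAt_chart (y₀ : M) {y : M} (hy : y ∈ (extChartAt 𝓘(ℝ, E) y₀).source) :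
    HasMFDerivAt 𝓘(ℝ, E) 𝓘(ℝ, E) (extChartAt 𝓘(ℝ, E) y₀) y (dchart (E := E) y₀ y) := by
  rw [extChartAt_source] at hy
  exact (mdifferentiableAt_extChartAt hy).hasMFDerivAt

theorem hasMFDerivAt_chart_symm (y₀ : M) {x : E} (hx : x ∈ (extChartAt 𝓘(ℝ, E) y₀).target) :
    HasMFDerivAt 𝓘(ℝ, E) 𝓘(ℝ, E) (extChartAt 𝓘(ℝ, E) y₀).symm x (dchartSymm (E := E) y₀ x) := by
  have h := mdifferentiableWithinAt_extChartAt_symm (I := 𝓘(ℝ, E)) hx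
  rw [ModelWithCorners.range_eq_univ, mdifferentiableWithinAt_univ] at h
  exact h.hasMFDerivAt

theorem hasFDerivWithinAt_chart_comp {L : Z →L[ℝ] E}
    (hf : HasMFDerivWithinAt 𝓘(ℝ, Z) 𝓘(ℝ, E) f S q L) (y₀ : M)
    (hq : f q ∈ (extChartAt 𝓘(ℝ, E) y₀).source) :
    HasFDerivWithinAt (fun p ↦ extChartAt 𝓘(ℝ, E) y₀ (f p)) ((dchart y₀ (f q)).comp L) S q :=
  hasMFDerivWithinAt_iff_hasFDerivWithinAt.1
    ((hasMFDerivAt_chart y₀ hq).comp_hasMFDerivWithinAt q hf)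

theorem hasFDerivWithinAt_chart_derivOn (hf : ContMDiffWithinAt 𝓘(ℝ, Z) 𝓘(ℝ, E) ∞ f S q) (y₀ : M)
    (hq : f q ∈ (extChartAt 𝓘(ℝ, E) y₀).source) :
    HasFDerivWithinAt (fun p ↦ extChartAt 𝓘(ℝ, E) y₀ (f p))
      ((dchart y₀ (f q)).comp (derivOn f S q)) S q :=
  hasFDerivWithinAt_chart_comp (hasMFDerivWithinAt_derivOn hf) y₀ hq

theorem contDiffOn_chart_comp (hf : ContMDiffOn 𝓘(ℝ, Z) 𝓘(ℝ, E) ∞ f S) (y₀ : M) :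
    ContDiffOn ℝ ∞ (fun p ↦ extChartAt 𝓘(ℝ, E) y₀ (f p))
      (S ∩ f ⁻¹' (extChartAt 𝓘(ℝ, E) y₀).source) := by
  rw [← contMDiffOn_iff_contDiffOn]
  refine (contMDiffOn_extChartAt (I := 𝓘(ℝ, E)) (x := y₀) (n := ∞)).comp
    (hf.mono inter_subset_left) fun p hp ↦ ?_
  have := hp.2
  rwa [mem_preimage, extChartAt_source] at this

end Charts

/-! ### Pullbacks of 1-forms -/

section Pullback

/-- The exterior derivative of the pullback `a ∘ f · Df`: the second derivatives of `f` cancel. -/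
theorem fderivWithin_pullback_sub {E Z : Type*} [NormedAddCommGroup E] [NormedSpace ℝ E]
    [NormedAddCommGroup Z] [NormedSpace ℝ Z] {a : E → E →L[ℝ] ℝ} {f : Z → E} {S : Set Z}
    (hS : UniqueDiffOn ℝ S) {q : Z} (hq : q ∈ S) (hq' : q ∈ closure (interior S))
    (hf : ContDiffWithinAt ℝ ∞ f S q) (ha : DifferentiableAt ℝ a (f q)) (ξ η : Z) :
    fderivWithin ℝ (fun p ↦ (a (f p)).comp (fderivWithin ℝ f S p)) S q ξ η -
      fderivWithin ℝ (fun p ↦ (a (f p)).comp (fderivWithin ℝ f S p)) S q η ξ =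
    fderiv ℝ a (f q) (fderivWithin ℝ f S q ξ) (fderivWithin ℝ f S q η) -
      fderiv ℝ a (f q) (fderivWithin ℝ f S q η) (fderivWithin ℝ f S q ξ) := by
  have hsymm : IsSymmSndFDerivWithinAt ℝ f S q :=
    hf.isSymmSndFDerivWithinAt (by
      rw [minSmoothness_of_isRCLikeNormedField]
      exact WithTop.coe_le_coe.2 (le_top : (2 : ℕ∞) ≤ ⊤)) hS hq' hq
  have h1 : HasFDerivWithinAt f (fderivWithin ℝ f S q) S q :=
    (hf.differentiableWithinAt (by simp)).hasFDerivWithinAt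
  have h2 : HasFDerivWithinAt (fderivWithin ℝ f S) (fderivWithin ℝ (fderivWithin ℝ f S) S q) S q :=
    ((hf.fderivWithin_right (m := ∞) hS (by simp) hq).differentiableWithinAt
      (by simp)).hasFDerivWithinAt
  have h3 := (ha.hasFDerivAt.comp_hasFDerivWithinAt q h1).clm_comp h2
  have h4 := h3.fderivWithin (hS q hq)
  simp only [comp_def] at h4
  rw [h4]
  have h5 := hsymm.eq ξ η
  simp [h5]

variable {Y : Type*} [TopologicalSpace Y] [ChartedSpace (EuclideanSpace ℝ (Fin 3)) Y]

/-- The value of a 1-form at a point, on the model space. -/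
def OneForm.eval (α : OneForm Y) (y : Y) : EuclideanSpace ℝ (Fin 3) →L[ℝ] ℝ := α y

theorem OneForm.inChart_eq (α : OneForm Y) (y₀ : Y) (x : EuclideanSpace ℝ (Fin 3)) :
    α.inChart y₀ x = (α.eval ((extChartAt (𝓡 3) y₀).symm x)).comp (dchartSymm y₀ x) := rfl

/-- The exterior derivative of a 1-form at a point, as a bilinear map on the model space. -/
noncomputable def OneForm.dform (α : OneForm Y) (y : Y) :
    EuclideanSpace ℝ (Fin 3) →L[ℝ] EuclideanSpace ℝ (Fin 3) →L[ℝ] ℝ :=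
  fderiv ℝ (α.inChart y) (extChartAt (𝓡 3) y y) -
    (fderiv ℝ (α.inChart y) (extChartAt (𝓡 3) y y)).flip

theorem OneForm.dform_swap (α : OneForm Y) (y : Y) (u v : EuclideanSpace ℝ (Fin 3)) :
    α.dform y u v = -α.dform y v u := by
  simp [OneForm.dform]

variable [IsManifold (𝓡 3) ∞ Y]

theorem OneForm.inChart_chart (α : OneForm Y) (y₀ : Y) {y : Y}
    (hy : y ∈ (extChartAt (𝓡 3) y₀).source) :
    (α.inChart y₀ (extChartAt (𝓡 3) y₀ y)).comp (dchart y₀ y) = α.eval y := by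
  rw [OneForm.inChart_eq, ContinuousLinearMap.comp_assoc, dchartSymm_comp_dchart y₀ hy,
    (extChartAt (𝓡 3) y₀).left_inv hy, ContinuousLinearMap.comp_id]

theorem OneForm.IsSmooth.contDiffOn_inChart {α : OneForm Y} (hα : α.IsSmooth) (y₀ : Y) :
    ContDiffOn ℝ ∞ (α.inChart y₀) (extChartAt (𝓡 3) y₀).target := by
  set e := trivializationAt (EuclideanSpace ℝ (Fin 3) →L[ℝ] ℝ)
    (fun y : Y ↦ TangentSpace (𝓡 3) y →L[ℝ] Bundle.Trivial Y ℝ y) y₀ with he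
  have hsub : (extChartAt (𝓡 3) y₀).source ⊆ e.baseSet := by
    rw [he, hom_trivializationAt_baseSet, extChartAt_source]
    intro y hy
    simpa using hy
  have h1 := (e.contMDiffOn_section_iff (IB := 𝓡 3) (n := ∞) (s := α)
    (isOpen_extChartAt_source y₀) hsub).1 hα.contMDiffOn
  rw [← contMDiffOn_iff_contDiffOn]
  have h2 := h1.comp (contMDiffOn_extChartAt_symm (I := 𝓡 3) (n := ∞) y₀)
    fun x hx ↦ (extChartAt (𝓡 3) y₀).map_target hx
  refine h2.congr fun x hx ↦ ?_
  have hy := (extChartAt (𝓡 3) y₀).map_target hx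
  rw [extChartAt_source] at hy
  have h3 := TangentBundle.symmL_trivializationAt (I := 𝓡 3) hy
  rw [ModelWithCorners.range_eq_univ, mfderivWithin_univ, (extChartAt (𝓡 3) y₀).right_inv hx] at h3
  change α.inChart y₀ x = ContinuousLinearMap.inCoordinates (EuclideanSpace ℝ (Fin 3))
    (TangentSpace (𝓡 3)) ℝ (Bundle.Trivial Y ℝ) y₀ ((extChartAt (𝓡 3) y₀).symm x) y₀
    ((extChartAt (𝓡 3) y₀).symm x) (α ((extChartAt (𝓡 3) y₀).symm x))
  rw [ContinuousLinearMap.inCoordinates, h3]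
  ext v
  simp
  rfl

theorem OneForm.d_eq (α : OneForm Y) (y : Y) (u v : EuclideanSpace ℝ (Fin 3)) :
    α.d y u v = α.dform y u v := by
  have h : ∀ w : EuclideanSpace ℝ (Fin 3), mfderiv (𝓡 3) 𝓘(ℝ, EuclideanSpace ℝ (Fin 3))
      (extChartAt (𝓡 3) y) y w = w := fun w ↦
    congrArg (fun L : EuclideanSpace ℝ (Fin 3) →L[ℝ] EuclideanSpace ℝ (Fin 3) ↦ L w)
      (dchart_self y)
  simp only [OneForm.d]
  rw [h u, h v]
  rfl

variable {Z : Type*} [NormedAddCommGroup Z] [NormedSpace ℝ Z] {f : Z → Y} {S : Set Z}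

/-- The pullback of a 1-form by a map `f` from a subset `S` of a normed space. -/
noncomputable def OneForm.pull (α : OneForm Y) (f : Z → Y) (S : Set Z) (q : Z) : Z →L[ℝ] ℝ :=
  (α.eval (f q)).comp (derivOn f S q)

theorem OneForm.pull_eq (α : OneForm Y) (hS : UniqueDiffOn ℝ S)
    (hf : ContMDiffOn 𝓘(ℝ, Z) (𝓡 3) ∞ f S) (y₀ : Y) {q : Z} (hq : q ∈ S)
    (hqs : f q ∈ (extChartAt (𝓡 3) y₀).source) :
    α.pull f S q = (α.inChart y₀ (extChartAt (𝓡 3) y₀ (f q))).comp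
      (fderivWithin ℝ (fun p ↦ extChartAt (𝓡 3) y₀ (f p)) S q) := by
  rw [(hasFDerivWithinAt_chart_derivOn (hf q hq) y₀ hqs).fderivWithin (hS q hq),
    ← ContinuousLinearMap.comp_assoc, α.inChart_chart y₀ hqs]
  rfl

theorem OneForm.contDiffOn_pull {α : OneForm Y} (hα : α.IsSmooth) (hS : UniqueDiffOn ℝ S)
    (hf : ContMDiffOn 𝓘(ℝ, Z) (𝓡 3) ∞ f S) : ContDiffOn ℝ ∞ (α.pull f S) S := by
  intro q hq
  set y₀ := f q
  have hmem : f ⁻¹' (extChartAt (𝓡 3) y₀).source ∈ 𝓝[S] q :=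
    hf.continuousOn q hq (extChartAt_source_mem_nhds y₀)
  have h1 : ContDiffWithinAt ℝ ∞ (fun p ↦ extChartAt (𝓡 3) y₀ (f p)) S q :=
    (contDiffOn_chart_comp hf y₀ q ⟨hq, mem_extChartAt_source y₀⟩).mono_of_mem_nhdsWithin
      (inter_mem self_mem_nhdsWithin hmem)
  have h2 : ContDiffWithinAt ℝ ∞ (α.inChart y₀) univ (extChartAt (𝓡 3) y₀ (f q)) :=
    ((hα.contDiffOn_inChart y₀).contDiffAt (extChartAt_target_mem_nhds y₀)).contDiffWithinAt
  have h3 := (h2.comp q h1 (mapsTo_univ _ _)).clm_comp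
    (h1.fderivWithin_right (m := ∞) hS (by simp) hq)
  refine h3.congr_of_eventuallyEq ?_ (α.pull_eq hS hf y₀ hq (mem_extChartAt_source y₀))
  filter_upwards [hmem, self_mem_nhdsWithin] with p hp hpS
  exact α.pull_eq hS hf y₀ hpS hp

/-- The exterior derivative commutes with pullbacks. -/
theorem OneForm.fderivWithin_pull_sub {α : OneForm Y} (hα : α.IsSmooth) (hS : UniqueDiffOn ℝ S)
    (hf : ContMDiffOn 𝓘(ℝ, Z) (𝓡 3) ∞ f S) {q : Z} (hq : q ∈ S)
    (hq' : q ∈ closure (interior S)) (ξ η : Z) :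
    fderivWithin ℝ (α.pull f S) S q ξ η - fderivWithin ℝ (α.pull f S) S q η ξ =
      α.dform (f q) (derivOn f S q ξ) (derivOn f S q η) := by
  have hys : f q ∈ (extChartAt (𝓡 3) (f q)).source := mem_extChartAt_source (f q)
  have hmem : f ⁻¹' (extChartAt (𝓡 3) (f q)).source ∈ 𝓝[S] q :=
    hf.continuousOn q hq (extChartAt_source_mem_nhds (f q))
  have h1 : ContDiffWithinAt ℝ ∞ (fun p ↦ extChartAt (𝓡 3) (f q) (f p)) S q :=
    (contDiffOn_chart_comp hf (f q) q ⟨hq, hys⟩).mono_of_mem_nhdsWithin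
      (inter_mem self_mem_nhdsWithin hmem)
  have h2 : DifferentiableAt ℝ (α.inChart (f q)) (extChartAt (𝓡 3) (f q) (f q)) :=
    ((hα.contDiffOn_inChart (f q)).contDiffAt (extChartAt_target_mem_nhds (f q))).differentiableAt
      (by simp)
  have h3 : α.pull f S =ᶠ[𝓝[S] q] fun p ↦
      (α.inChart (f q) (extChartAt (𝓡 3) (f q) (f p))).comp
      (fderivWithin ℝ (fun p ↦ extChartAt (𝓡 3) (f q) (f p)) S p) := by
    filter_upwards [hmem, self_mem_nhdsWithin] with p hp hpS
    exact α.pull_eq hS hf (f q) hpS hp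
  have h4 := (hasFDerivWithinAt_chart_derivOn (hf q hq) (f q) hys).fderivWithin (hS q hq)
  rw [dchart_self, ContinuousLinearMap.id_comp] at h4
  rw [h3.fderivWithin_eq_of_mem hq, fderivWithin_pullback_sub hS hq hq' h1 h2, h4]
  rfl

/-- The exterior derivative computed in an arbitrary preferred chart. -/
theorem OneForm.dform_dchartSymm {α : OneForm Y} (hα : α.IsSmooth) (y₀ : Y)
    {x : EuclideanSpace ℝ (Fin 3)} (hx : x ∈ (extChartAt (𝓡 3) y₀).target)
    (u v : EuclideanSpace ℝ (Fin 3)) :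
    α.dform ((extChartAt (𝓡 3) y₀).symm x) (dchartSymm y₀ x u) (dchartSymm y₀ x v) =
      fderiv ℝ (α.inChart y₀) x u v - fderiv ℝ (α.inChart y₀) x v u := by
  have ho : IsOpen (extChartAt (𝓡 3) y₀).target := isOpen_extChartAt_target y₀
  have h1 : ∀ z ∈ (extChartAt (𝓡 3) y₀).target, derivOn (extChartAt (𝓡 3) y₀).symm
        (extChartAt (𝓡 3) y₀).target z = dchartSymm y₀ z := fun z hz ↦
    mfderivWithin_of_mem_nhds (ho.mem_nhds hz)
  have h2 := OneForm.fderivWithin_pull_sub hα ho.uniqueDiffOn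
    (contMDiffOn_extChartAt_symm (I := 𝓡 3) (n := ∞) y₀) hx
    (subset_closure (by rwa [ho.interior_eq])) u v
  have h3 : α.pull (extChartAt (𝓡 3) y₀).symm (extChartAt (𝓡 3) y₀).target =ᶠ[𝓝 x]
      α.inChart y₀ := by
    filter_upwards [ho.mem_nhds hx] with z hz
    rw [OneForm.pull, h1 z hz]
    rfl
  rw [h1 x hx, fderivWithin_of_mem_nhds (ho.mem_nhds hx), h3.fderiv_eq] at h2
  exact h2.symm

end Pullback

/-! ### Contact linear algebra -/

section ContactAlgebra

variable {E : Type*} [NormedAddCommGroup E] [NormedSpace ℝ E]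

/-- The pair `(a, Ω)` of a covector and a skew bilinear form satisfies `a ∧ Ω ≠ 0`. -/
structure IsContactPair (a : E →L[ℝ] ℝ) (Ω : E →L[ℝ] E →L[ℝ] ℝ) : Prop where
  swap : ∀ u v, Ω u v = -Ω v u
  wedge_ne_zero : ∃ u v w, a u * Ω v w + a v * Ω w u + a w * Ω u v ≠ 0

variable {a : E →L[ℝ] ℝ} {Ω : E →L[ℝ] E →L[ℝ] ℝ}

theorem IsContactPair.self_eq_zero (h : IsContactPair a Ω) (u : E) : Ω u u = 0 := by
  linarith [h.swap u u]

theorem IsContactPair.exists_ne_zero (h : IsContactPair a Ω) : ∃ r, a r ≠ 0 := by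
  obtain ⟨u, v, w, huvw⟩ := h.wedge_ne_zero
  by_contra! h0
  simp [h0] at huvw

/-- The only `(X, μ)` with `a X = 0` and `ι_X Ω = μ a` is `(0, 0)`. In a basis on which
`a ∧ Ω ≠ 0`, the coordinates of `X` are found by elimination. -/
theorem IsContactPair.eq_zero (h : IsContactPair a Ω) (hE : Module.finrank ℝ E = 3) {X : E} {μ : ℝ}
    (h1 : a X = 0) (h2 : ∀ v, Ω X v = μ * a v) : X = 0 ∧ μ = 0 := by
  have hX : X = 0 := by
    obtain ⟨u, v, w, huvw⟩ := h.wedge_ne_zero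
    have hu := h.self_eq_zero u
    have hv := h.self_eq_zero v
    have hw := h.self_eq_zero w
    have s1 := h.swap v u
    have s2 := h.swap w v
    have s3 := h.swap u w
    have hlin : LinearIndependent ℝ ![u, v, w] := by
      rw [Fintype.linearIndependent_iff]
      intro g hg
      simp only [Fin.sum_univ_three, Matrix.cons_val_zero, Matrix.cons_val_one,
        Matrix.cons_val] at hg
      have e0 : g 0 * a u + g 1 * a v + g 2 * a w = 0 := by simpa using congrArg a hg
      have eu : g 0 * Ω u u + g 1 * Ω v u + g 2 * Ω w u = 0 := by
        simpa using congrArg (fun x ↦ Ω x u) hg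
      have ev : g 0 * Ω u v + g 1 * Ω v v + g 2 * Ω w v = 0 := by
        simpa using congrArg (fun x ↦ Ω x v) hg
      have ew : g 0 * Ω u w + g 1 * Ω v w + g 2 * Ω w w = 0 := by
        simpa using congrArg (fun x ↦ Ω x w) hg
      rw [hu, s1] at eu
      rw [hv, s2] at ev
      rw [hw, s3] at ew
      intro i
      refine (mul_eq_zero.1
        (?_ : g i * (a u * Ω v w + a v * Ω w u + a w * Ω u v) = 0)).resolve_right huvw
      fin_cases i
      · simp only [Fin.zero_eta]
        linear_combination Ω v w * e0 - a v * ew + a w * ev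
      · simp only [Fin.mk_one]
        linear_combination Ω w u * e0 - a w * eu + a u * ew
      · simp only [Fin.reduceFinMk]
        linear_combination Ω u v * e0 - a u * ev + a v * eu
    have : FiniteDimensional ℝ E := Module.finite_of_finrank_pos (by omega)
    have hspan : Submodule.span ℝ (range ![u, v, w]) = ⊤ :=
      hlin.span_eq_top_of_card_eq_finrank' (by simp [hE])
    have hmem : X ∈ Submodule.span ℝ (range ![u, v, w]) := hspan ▸ Submodule.mem_top
    obtain ⟨g, hg⟩ := (Submodule.mem_span_range_iff_exists_fun ℝ).1 hmem
    simp only [Fin.sum_univ_three, Matrix.cons_val_zero, Matrix.cons_val_one,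
      Matrix.cons_val] at hg
    have e0 : g 0 * a u + g 1 * a v + g 2 * a w = 0 := by
      rw [← h1, ← hg]
      simp
    have e : ∀ y, g 0 * Ω u y + g 1 * Ω v y + g 2 * Ω w y = μ * a y := fun y ↦ by
      rw [← h2, ← hg]
      simp
    have eu := e u
    have ev := e v
    have ew := e w
    rw [hu, s1] at eu
    rw [hv, s2] at ev
    rw [hw, s3] at ew
    have h0 : g 0 = 0 := by
      refine (mul_eq_zero.1 (?_ : _ * (a u * Ω v w + a v * Ω w u + a w * Ω u v) = 0)).resolve_right
        huvw
      linear_combination Ω v w * e0 - a v * ew + a w * ev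
    have h1 : g 1 = 0 := by
      refine (mul_eq_zero.1 (?_ : _ * (a u * Ω v w + a v * Ω w u + a w * Ω u v) = 0)).resolve_right
        huvw
      linear_combination Ω w u * e0 - a w * eu + a u * ew
    have h2 : g 2 = 0 := by
      refine (mul_eq_zero.1 (?_ : _ * (a u * Ω v w + a v * Ω w u + a w * Ω u v) = 0)).resolve_right
        huvw
      linear_combination Ω u v * e0 - a u * ev + a v * eu
    rw [← hg, h0, h1, h2]
    simp
  refine ⟨hX, ?_⟩
  obtain ⟨r, hr⟩ := h.exists_ne_zero
  have := h2 r
  rw [hX] at this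
  simpa [hr] using this.symm

/-- The form `Ω` does not vanish on a plane contained in `ker a`. -/
theorem IsContactPair.exists_ne_zero_of_injective (h : IsContactPair a Ω)
    (hE : Module.finrank ℝ E = 3) {Z : Type*} [NormedAddCommGroup Z] [NormedSpace ℝ Z]
    (hZ : Module.finrank ℝ Z = 2) {P : Z →L[ℝ] E} (hP : Injective P) (h0 : ∀ z, a (P z) = 0) :
    ∃ z w, Ω (P z) (P w) ≠ 0 := by
  by_contra! hc
  have : FiniteDimensional ℝ E := Module.finite_of_finrank_pos (by omega)
  have : FiniteDimensional ℝ Z := Module.finite_of_finrank_pos (by omega)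
  obtain ⟨r, hr⟩ := h.exists_ne_zero
  -- a vector `z ≠ 0` of the plane with `Ω (P z) r = 0`
  have hker : LinearMap.ker ((Ω.flip r).comp P).toLinearMap ≠ ⊥ :=
    LinearMap.ker_ne_bot_of_finrank_lt (by simp [hZ])
  obtain ⟨z, hz, hz0⟩ := Submodule.exists_mem_ne_zero_of_ne_bot hker
  have hz' : Ω (P z) r = 0 := hz
  have hrange : LinearMap.range P.toLinearMap = LinearMap.ker a.toLinearMap := by
    refine Submodule.eq_of_le_of_finrank_eq ?_ ?_
    · rintro _ ⟨w, rfl⟩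
      exact h0 w
    · rw [LinearMap.finrank_range_of_inj hP, hZ]
      have h1 := LinearMap.finrank_range_add_finrank_ker a.toLinearMap
      have h2 : LinearMap.range a.toLinearMap = ⊤ :=
        LinearMap.range_eq_top.2 (LinearMap.surjective fun h3 ↦ hr (DFunLike.congr_fun h3 r))
      rw [h2, finrank_top, hE, Module.finrank_self] at h1
      omega
  have hall : ∀ v, Ω (P z) v = 0 * a v := fun v ↦ by
    have hv : v - (a v / a r) • r ∈ LinearMap.range P.toLinearMap := by
      rw [hrange, LinearMap.mem_ker]
      simp [hr]
    obtain ⟨w, hw⟩ := hv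
    have hv' : v = P w + (a v / a r) • r := by
      rw [show P w = v - (a v / a r) • r from hw]
      abel
    rw [hv', map_add, map_smul, hc, hz']
    simp
  exact hz0 (hP ((h.eq_zero hE (h0 z) hall).1.trans (map_zero P).symm))

/-- The linear map `(X, μ) ↦ (a X, ι_X Ω - μ a)`. -/
noncomputable def contactMap (a : E →L[ℝ] ℝ) (Ω : E →L[ℝ] E →L[ℝ] ℝ) :
    E × ℝ →L[ℝ] ℝ × (E →L[ℝ] ℝ) :=
  (a.comp (ContinuousLinearMap.fst ℝ E ℝ)).prod
    (Ω.comp (ContinuousLinearMap.fst ℝ E ℝ) -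
      (ContinuousLinearMap.toSpanSingleton ℝ a).comp (ContinuousLinearMap.snd ℝ E ℝ))

theorem contactMap_apply (a : E →L[ℝ] ℝ) (Ω : E →L[ℝ] E →L[ℝ] ℝ) (w : E × ℝ) :
    contactMap a Ω w = (a w.1, Ω w.1 - w.2 • a) := rfl

theorem contactMap_eq_iff (a : E →L[ℝ] ℝ) (Ω : E →L[ℝ] E →L[ℝ] ℝ) (X : E) (μ c : ℝ)
    (b : E →L[ℝ] ℝ) :
    contactMap a Ω (X, μ) = (c, -b) ↔ a X = c ∧ ∀ v, b v + Ω X v = μ * a v := by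
  rw [contactMap_apply, Prod.mk.injEq]
  refine and_congr Iff.rfl ⟨fun h v ↦ ?_, fun h ↦ ?_⟩
  · have := DFunLike.congr_fun h v
    simp only [sub_apply, smul_apply, smul_eq_mul,
      neg_apply] at this
    linarith
  · ext v
    simp only [sub_apply, smul_apply, smul_eq_mul,
      neg_apply]
    linarith [h v]

theorem IsContactPair.isInvertible_contactMap (h : IsContactPair a Ω)
    (hE : Module.finrank ℝ E = 3) : (contactMap a Ω).IsInvertible := by
  have : FiniteDimensional ℝ E := Module.finite_of_finrank_pos (by omega)
  have hinj : Injective (contactMap a Ω).toLinearMap := by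
    rw [← LinearMap.ker_eq_bot, LinearMap.ker_eq_bot']
    rintro ⟨X, μ⟩ hX
    have h1 := (contactMap_eq_iff a Ω X μ 0 0).1 (by rw [neg_zero]; exact hX)
    have h2 := h.eq_zero hE h1.1 fun v ↦ by simpa using h1.2 v
    rw [h2.1, h2.2]
    rfl
  have hdual : Module.finrank ℝ (E →L[ℝ] ℝ) = 3 := by
    rw [← LinearEquiv.finrank_eq (LinearMap.toContinuousLinearMap (𝕜 := ℝ) (E := E) (F' := ℝ)),
      Module.finrank_linearMap, hE, Module.finrank_self]
  have hfin : Module.finrank ℝ (E × ℝ) = Module.finrank ℝ (ℝ × (E →L[ℝ] ℝ)) := by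
    rw [Module.finrank_prod, Module.finrank_prod, hdual, hE, Module.finrank_self]
  refine ⟨(LinearMap.linearEquivOfInjective _ hinj hfin).toContinuousLinearEquiv, ?_⟩
  ext w <;> rfl

theorem IsContactPair.inverse_eq_iff (h : IsContactPair a Ω) (hE : Module.finrank ℝ E = 3)
    {z : ℝ × (E →L[ℝ] ℝ)} {w : E × ℝ} :
    (contactMap a Ω).inverse z = w ↔ contactMap a Ω w = z := by
  obtain ⟨e, he⟩ := h.isInvertible_contactMap hE
  rw [← he, ContinuousLinearMap.inverse_equiv]
  exact ⟨fun h ↦ by rw [← h]; simp, fun h ↦ by rw [← h]; simp⟩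

end ContactAlgebra

/-! ### Contact vector fields -/

section ContactVectorField

variable {Y : Type*} [TopologicalSpace Y] [ChartedSpace (EuclideanSpace ℝ (Fin 3)) Y]

/-- The differential of a function on `Y` at a point, on the model space. -/
noncomputable def dscalar (h : Y → ℝ) (y : Y) : EuclideanSpace ℝ (Fin 3) →L[ℝ] ℝ :=
  mfderiv (𝓡 3) 𝓘(ℝ, ℝ) h y

/-- The contact vector field of the contact Hamiltonian `h`, on the model space: the first component
of the solution `(X, μ)` of `α X = h`, `ι_X dα - μ α = -dh`. For a contact form this linear system
is invertible. -/
noncomputable def contactVec (α : OneForm Y) (h : Y → ℝ) (y : Y) : EuclideanSpace ℝ (Fin 3) :=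
  ((contactMap (α.eval y) (α.dform y)).inverse (h y, -dscalar h y)).1

variable [IsManifold (𝓡 3) ∞ Y] {α : OneForm Y}

theorem isContactHamiltonianVector_iff_exists (h : Y → ℝ) (y : Y)
    (X : EuclideanSpace ℝ (Fin 3)) : IsContactHamiltonianVector α h y X ↔
      α.eval y X = h y ∧ ∃ μ : ℝ, ∀ v, dscalar h y v + α.dform y X v = μ * α.eval y v := by
  have hd : ∀ v : EuclideanSpace ℝ (Fin 3), α.d y X v = α.dform y X v := α.d_eq y X
  constructor
  · rintro ⟨h1, μ, h2⟩
    refine ⟨h1, μ, fun v ↦ ?_⟩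
    rw [← hd v]
    exact h2 v
  · rintro ⟨h1, μ, h2⟩
    refine ⟨h1, μ, fun v ↦ ?_⟩
    have h3 := h2 v
    rw [← hd v] at h3
    exact h3

theorem IsContactForm.isContactPair (hα : IsContactForm α) (y : Y) :
    IsContactPair (α.eval y) (α.dform y) := by
  refine ⟨α.dform_swap y, ?_⟩
  obtain ⟨u, v, w, h⟩ := hα.wedge_ne_zero y
  exact ⟨u, v, w, fun h0 ↦ h ((congrArg₂ (· + ·) (congrArg₂ (· + ·)
    (congrArg (α.eval y u * ·) (α.d_eq y v w)) (congrArg (α.eval y v * ·) (α.d_eq y w u)))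
    (congrArg (α.eval y w * ·) (α.d_eq y u v))).trans h0)⟩

theorem IsContactForm.isContactHamiltonianVector_iff (hα : IsContactForm α) (h : Y → ℝ) (y : Y)
    (X : EuclideanSpace ℝ (Fin 3)) :
    IsContactHamiltonianVector α h y X ↔ X = contactVec α h y := by
  have hp := hα.isContactPair y
  have hE : Module.finrank ℝ (EuclideanSpace ℝ (Fin 3)) = 3 := by simp
  rw [isContactHamiltonianVector_iff_exists]
  constructor
  · rintro ⟨h1, μ, h2⟩
    rw [contactVec, (hp.inverse_eq_iff hE).2 ((contactMap_eq_iff _ _ X μ _ _).2 ⟨h1, h2⟩)]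
  · rintro rfl
    obtain ⟨h1, h2⟩ := (contactMap_eq_iff _ _ _ _ _ _).1
      ((hp.inverse_eq_iff hE (z := (h y, -dscalar h y))).1 rfl)
    exact ⟨h1, _, h2⟩

theorem IsContactForm.isContactPair_inChart (hα : IsContactForm α) (y₀ : Y)
    {x : EuclideanSpace ℝ (Fin 3)} (hx : x ∈ (extChartAt (𝓡 3) y₀).target) :
    IsContactPair (α.inChart y₀ x)
      (fderiv ℝ (α.inChart y₀) x - (fderiv ℝ (α.inChart y₀) x).flip) := by
  refine ⟨fun u v ↦ by simp, ?_⟩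
  obtain ⟨u, v, w, h⟩ := (hα.isContactPair ((extChartAt (𝓡 3) y₀).symm x)).wedge_ne_zero
  have hs := (extChartAt (𝓡 3) y₀).map_target hx
  have hd : ∀ u, dchartSymm y₀ x (dchart y₀ ((extChartAt (𝓡 3) y₀).symm x) u) = u := fun u ↦ by
    have := dchartSymm_dchart y₀ hs u
    rwa [(extChartAt (𝓡 3) y₀).right_inv hx] at this
  set D : EuclideanSpace ℝ (Fin 3) →L[ℝ] EuclideanSpace ℝ (Fin 3) :=
    dchart y₀ ((extChartAt (𝓡 3) y₀).symm x)
  have h1 : ∀ u v, (fderiv ℝ (α.inChart y₀) x - (fderiv ℝ (α.inChart y₀) x).flip) (D u) (D v) =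
      α.dform ((extChartAt (𝓡 3) y₀).symm x) u v := fun u v ↦ by
    have := OneForm.dform_dchartSymm hα.smooth y₀ hx (D u) (D v)
    rw [hd, hd] at this
    rw [this]
    simp
  have h2 : ∀ u, α.inChart y₀ x (D u) = α.eval ((extChartAt (𝓡 3) y₀).symm x) u := fun u ↦ by
    rw [α.inChart_eq, ContinuousLinearMap.comp_apply, hd]
  refine ⟨D u, D v, D w, ?_⟩
  rw [h1, h1, h1, h2, h2, h2]
  exact h

/-- The contact vector field in a chart. -/
theorem IsContactForm.dchart_contactVec (hα : IsContactForm α) {h : Y → ℝ} (y₀ : Y)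
    {x : EuclideanSpace ℝ (Fin 3)} (hx : x ∈ (extChartAt (𝓡 3) y₀).target)
    {h' : EuclideanSpace ℝ (Fin 3) →L[ℝ] ℝ}
    (hh : HasFDerivAt (fun x ↦ h ((extChartAt (𝓡 3) y₀).symm x)) h' x)
    (hd : MDifferentiableAt (𝓡 3) 𝓘(ℝ, ℝ) h ((extChartAt (𝓡 3) y₀).symm x)) :
    dchart y₀ ((extChartAt (𝓡 3) y₀).symm x) (contactVec α h ((extChartAt (𝓡 3) y₀).symm x)) =
      ((contactMap (α.inChart y₀ x) (fderiv ℝ (α.inChart y₀) x -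
        (fderiv ℝ (α.inChart y₀) x).flip)).inverse
        (h ((extChartAt (𝓡 3) y₀).symm x), -h')).1 := by
  have hE : Module.finrank ℝ (EuclideanSpace ℝ (Fin 3)) = 3 := by simp
  have hs := (extChartAt (𝓡 3) y₀).map_target hx
  have hD := dchartSymm_dchart y₀ hs
  rw [(extChartAt (𝓡 3) y₀).right_inv hx] at hD
  have hchain : h' = (dscalar h ((extChartAt (𝓡 3) y₀).symm x)).comp (dchartSymm y₀ x) :=
    hh.unique (hasMFDerivAt_iff_hasFDerivAt.1
      (hd.hasMFDerivAt.comp x (hasMFDerivAt_chart_symm y₀ hx)))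
  set y := (extChartAt (𝓡 3) y₀).symm x
  obtain ⟨h1, μ, h2⟩ := (isContactHamiltonianVector_iff_exists h y _).1
    ((hα.isContactHamiltonianVector_iff h y _).2 rfl)
  have h3 := ((hα.isContactPair_inChart y₀ hx).inverse_eq_iff hE (z := (h y, -h'))).2
    ((contactMap_eq_iff _ _ (dchart y₀ y (contactVec α h y)) μ _ _).2 ⟨?_, fun v ↦ ?_⟩)
  · rw [h3]
  · rw [α.inChart_eq, ContinuousLinearMap.comp_apply, hD]
    exact h1
  · have h4 := OneForm.dform_dchartSymm hα.smooth y₀ hx (dchart y₀ y (contactVec α h y)) v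
    rw [hD] at h4
    have h5 := h2 (dchartSymm y₀ x v)
    rw [h4] at h5
    rw [hchain, α.inChart_eq]
    exact h5

/-- The contact vector fields of a smooth family of contact Hamiltonians are smooth in charts. -/
theorem IsContactForm.contDiffOn_dchart_contactVec (hα : IsContactForm α) {H : ℝ → Y → ℝ}
    (hH : ContMDiffOn (𝓘(ℝ, ℝ).prod (𝓡 3)) 𝓘(ℝ, ℝ) ∞ (fun z : ℝ × Y ↦ H z.1 z.2)
      (Icc 0 1 ×ˢ univ)) (y₀ : Y) :
    ContDiffOn ℝ ∞ (fun w : ℝ × EuclideanSpace ℝ (Fin 3) ↦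
      dchart y₀ ((extChartAt (𝓡 3) y₀).symm w.2)
        (contactVec α (H w.1) ((extChartAt (𝓡 3) y₀).symm w.2)))
      (Icc 0 1 ×ˢ (extChartAt (𝓡 3) y₀).target) := by
  have ho : IsOpen (extChartAt (𝓡 3) y₀).target := isOpen_extChartAt_target y₀
  have hu : UniqueDiffOn ℝ (Icc (0 : ℝ) 1 ×ˢ (extChartAt (𝓡 3) y₀).target) :=
    (uniqueDiffOn_Icc zero_lt_one).prod ho.uniqueDiffOn
  set G : ℝ → EuclideanSpace ℝ (Fin 3) → ℝ := fun t x ↦ H t ((extChartAt (𝓡 3) y₀).symm x) with hG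
  have hGd : ContDiffOn ℝ ∞ (uncurry G) (Icc 0 1 ×ˢ (extChartAt (𝓡 3) y₀).target) := by
    rw [← contMDiffOn_iff_contDiffOn]
    refine hH.comp (f := fun w : ℝ × EuclideanSpace ℝ (Fin 3) ↦
      (w.1, (extChartAt (𝓡 3) y₀).symm w.2)) ?_ fun w hw ↦ ⟨hw.1, mem_univ _⟩
    exact contDiff_fst.contMDiff.contMDiffOn.prodMk
      ((contMDiffOn_extChartAt_symm (I := 𝓡 3) (n := ∞) y₀).comp
        contDiff_snd.contMDiff.contMDiffOn fun w hw ↦ hw.2)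
  set A := fun x ↦ contactMap (α.inChart y₀ x) (fderiv ℝ (α.inChart y₀) x -
        (fderiv ℝ (α.inChart y₀) x).flip) with hA
  have ha := hα.smooth.contDiffOn_inChart y₀
  have ha' : ContDiffOn ℝ ∞ (fderiv ℝ (α.inChart y₀)) (extChartAt (𝓡 3) y₀).target :=
    ha.fderiv_of_isOpen ho (by simp)
  have hE : Module.finrank ℝ (EuclideanSpace ℝ (Fin 3)) = 3 := by simp
  have hAd : ContDiffOn ℝ ∞ A (extChartAt (𝓡 3) y₀).target := by
    have hflip : ContDiffOn ℝ ∞ (fun x ↦ (fderiv ℝ (α.inChart y₀) x).flip)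
        (extChartAt (𝓡 3) y₀).target :=
      contDiffOn_clm_apply.2 fun v ↦ contDiffOn_clm_apply.2 fun w ↦
        (ha'.clm_apply contDiffOn_const).clm_apply contDiffOn_const
    refine contDiffOn_clm_apply.2 fun w ↦ ?_
    simp only [hA, contactMap_apply]
    exact (ha.clm_apply contDiffOn_const).prodMk
      (((ha'.sub hflip).clm_apply contDiffOn_const).sub (ha.const_smul w.2))
  have hAinv : ContDiffOn ℝ ∞ (fun x ↦ (A x).inverse) (extChartAt (𝓡 3) y₀).target := by
    intro x hx
    obtain ⟨e, he⟩ := (hα.isContactPair_inChart y₀ hx).isInvertible_contactMap hE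
    have h1 : ContDiffAt ℝ ∞ ContinuousLinearMap.inverse (A x) := by
      rw [hA]
      simp only
      rw [← he]
      exact contDiffAt_map_inverse e
    exact h1.comp_contDiffWithinAt x (hAd x hx)
  set G' := fun w ↦ (fderivWithin ℝ (uncurry G) (Icc 0 1 ×ˢ (extChartAt (𝓡 3) y₀).target) w).comp
    (ContinuousLinearMap.inr ℝ ℝ (EuclideanSpace ℝ (Fin 3))) with hG'
  have hG'd : ContDiffOn ℝ ∞ G' (Icc 0 1 ×ˢ (extChartAt (𝓡 3) y₀).target) :=
    (hGd.fderivWithin hu (by simp)).clm_comp contDiffOn_const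
  have hfin := (contDiff_fst (𝕜 := ℝ)).comp_contDiffOn
    ((hAinv.comp contDiffOn_snd fun w (hw : w ∈ Icc (0 : ℝ) 1 ×ˢ (extChartAt (𝓡 3) y₀).target) ↦
      hw.2).clm_apply (hGd.prodMk hG'd.neg))
  refine hfin.congr fun w hw ↦ ?_
  have hslice := hasFDerivAt_slice ho hw.1 hw.2
    (hGd.differentiableOn (by simp) w hw).hasFDerivWithinAt
  refine hα.dchart_contactVec y₀ hw.2 hslice ?_
  have h1 : ContMDiff (𝓡 3) 𝓘(ℝ, ℝ) ∞ (H w.1) := by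
    rw [← contMDiffOn_univ]
    exact hH.comp (f := fun y : Y ↦ (w.1, y)) (contMDiff_const.prodMk contMDiff_id).contMDiffOn
      fun y _ ↦ ⟨hw.1, mem_univ _⟩
  exact h1.mdifferentiable (by simp) _

end ContactVectorField

/-! ### Trajectories of time-dependent vector fields -/

/-- Two solutions which agree at `a` agree at `b`, which may lie on either side of `a`. -/
theorem eq_of_hasDerivWithinAt_lipschitz {F : Type*} [NormedAddCommGroup F] [NormedSpace ℝ F]
    {X : ℝ → F → F} {K : NNReal} (hK : ∀ t ∈ Icc (0 : ℝ) 1, LipschitzWith K (X t))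
    {f g : ℝ → F} {a b : ℝ} (hab : uIcc a b ⊆ Icc 0 1)
    (hf : ∀ t ∈ uIcc a b, HasDerivWithinAt f (X t (f t)) (Icc 0 1) t)
    (hg : ∀ t ∈ uIcc a b, HasDerivWithinAt g (X t (g t)) (Icc 0 1) t) (h : f a = g a) :
    f b = g b := by
  have hc : ∀ {u : ℝ → F}, (∀ t ∈ uIcc a b, HasDerivWithinAt u (X t (u t)) (Icc 0 1) t) →
      ContinuousOn u (uIcc a b) := fun hu t ht ↦ (hu t ht).continuousWithinAt.mono hab
  rcases le_total a b with hle | hle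
  · rw [uIcc_of_le hle] at *
    have hr : ∀ {u : ℝ → F}, (∀ t ∈ Icc a b, HasDerivWithinAt u (X t (u t)) (Icc 0 1) t) →
        ∀ t ∈ Ico a b, HasDerivWithinAt u (X t (u t)) (Ici t) t := fun hu t ht ↦
      (hu t (Ico_subset_Icc_self ht)).mono_of_mem_nhdsWithin (Icc_mem_nhdsGE_of_mem
        ⟨(hab (Ico_subset_Icc_self ht)).1, ht.2.trans_le (hab (right_mem_Icc.2 hle)).2⟩)
    exact ODE_solution_unique_of_mem_Icc_right (s := fun _ ↦ univ)
      (fun t ht ↦ (hK t (hab (Ico_subset_Icc_self ht))).lipschitzOnWith) (hc hf) (hr hf)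
      (fun _ _ ↦ mem_univ _) (hc hg) (hr hg) (fun _ _ ↦ mem_univ _) h (right_mem_Icc.2 hle)
  · rw [uIcc_of_ge hle] at *
    have hr : ∀ {u : ℝ → F}, (∀ t ∈ Icc b a, HasDerivWithinAt u (X t (u t)) (Icc 0 1) t) →
        ∀ t ∈ Ioc b a, HasDerivWithinAt u (X t (u t)) (Iic t) t := fun hu t ht ↦
      (hu t (Ioc_subset_Icc_self ht)).mono_of_mem_nhdsWithin (Icc_mem_nhdsLE_of_mem
        ⟨(hab (left_mem_Icc.2 hle)).1.trans_lt ht.1, (hab (Ioc_subset_Icc_self ht)).2⟩)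
    exact ODE_solution_unique_of_mem_Icc_left (s := fun _ ↦ univ)
      (fun t ht ↦ (hK t (hab (Ioc_subset_Icc_self ht))).lipschitzOnWith) (hc hf) (hr hf)
      (fun _ _ ↦ mem_univ _) (hc hg) (hr hg) (fun _ _ ↦ mem_univ _) h (left_mem_Icc.2 hle)

section Trajectories

variable {E : Type*} [NormedAddCommGroup E] [NormedSpace ℝ E]
  {M : Type*} [TopologicalSpace M] [ChartedSpace E M]

/-- The curve `γ` has velocity `v` at time `t`, where only times in `[0,1]` are considered. -/
def HasVelocityAt (γ : ℝ → M) (v : E) (t : ℝ) : Prop :=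
  HasMFDerivWithinAt 𝓘(ℝ, ℝ) 𝓘(ℝ, E) γ (Icc 0 1) t (ContinuousLinearMap.toSpanSingleton ℝ v)

/-- The expression of a time-dependent vector field in the preferred chart around `y₀`. -/
noncomputable def chartField (X : ℝ → M → E) (y₀ : M) (t : ℝ) (x : E) : E :=
  dchart y₀ ((extChartAt 𝓘(ℝ, E) y₀).symm x) (X t ((extChartAt 𝓘(ℝ, E) y₀).symm x))

/-- Smoothness of a time-dependent vector field, for times in `[0,1]`: its expressions in charts
are smooth. -/
def IsSmoothField (X : ℝ → M → E) : Prop :=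
  ∀ y₀ : M, ContDiffOn ℝ ∞ (uncurry (chartField X y₀))
    (Icc 0 1 ×ˢ (extChartAt 𝓘(ℝ, E) y₀).target)

/-- The curve `γ` is a trajectory of the field `X` at all times in `J`. -/
def IsTrajectoryOn (X : ℝ → M → E) (γ : ℝ → M) (J : Set ℝ) : Prop :=
  ∀ t ∈ J, HasVelocityAt γ (X t (γ t)) t

theorem IsTrajectoryOn.mono {X : ℝ → M → E} {γ : ℝ → M} {J J' : Set ℝ}
    (h : IsTrajectoryOn X γ J) (hJ : J' ⊆ J) : IsTrajectoryOn X γ J' :=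
  fun t ht ↦ h t (hJ ht)

theorem HasVelocityAt.continuousWithinAt {γ : ℝ → M} {v : E} {t : ℝ} (h : HasVelocityAt γ v t) :
    ContinuousWithinAt γ (Icc 0 1) t :=
  HasMFDerivWithinAt.continuousWithinAt h

theorem HasVelocityAt.congr {γ γ' : ℝ → M} {v : E} {t : ℝ} (h : HasVelocityAt γ v t)
    (h' : γ' =ᶠ[𝓝[Icc 0 1] t] γ) (ht : γ' t = γ t) : HasVelocityAt γ' v t :=
  (show HasMFDerivWithinAt 𝓘(ℝ, ℝ) 𝓘(ℝ, E) γ (Icc 0 1) t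
    (ContinuousLinearMap.toSpanSingleton ℝ v) from h).congr_of_eventuallyEq h' ht

theorem hasVelocityAt_const (y : M) (t : ℝ) : HasVelocityAt (fun _ ↦ y) (0 : E) t := by
  have h : ContinuousLinearMap.toSpanSingleton ℝ (0 : E) = 0 := by ext; simp
  exact (hasMFDerivWithinAt_const y (Icc 0 1) t).congr_mfderiv h.symm

theorem chartField_chart (X : ℝ → M → E) (y₀ : M) (t : ℝ) {y : M}
    (hs : y ∈ (extChartAt 𝓘(ℝ, E) y₀).source) :
    chartField X y₀ t (extChartAt 𝓘(ℝ, E) y₀ y) = dchart y₀ y (X t y) := by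
  rw [chartField, (extChartAt 𝓘(ℝ, E) y₀).left_inv hs]

/-- Near the image of `y₀`, the expression of a smooth field in the chart around `y₀` agrees with a
bounded Lipschitz field defined on the whole model space. -/
theorem IsSmoothField.exists_cutoff [FiniteDimensional ℝ E] {X : ℝ → M → E}
    (hX : IsSmoothField X) (y₀ : M) :
    ∃ (Xc : ℝ → E → E) (K L : NNReal) (R : ℝ), 0 < R ∧
      ContDiffOn ℝ ∞ (uncurry Xc) (Icc 0 1 ×ˢ univ) ∧
      (∀ t ∈ Icc (0 : ℝ) 1, LipschitzWith K (Xc t)) ∧ (∀ t ∈ Icc (0 : ℝ) 1, ∀ x, ‖Xc t x‖ ≤ L) ∧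
      Metric.ball (extChartAt 𝓘(ℝ, E) y₀ y₀) R ⊆ (extChartAt 𝓘(ℝ, E) y₀).target ∧
      ∀ t, ∀ x ∈ Metric.ball (extChartAt 𝓘(ℝ, E) y₀ y₀) R, Xc t x = chartField X y₀ t x := by
  have hT : IsOpen (extChartAt 𝓘(ℝ, E) y₀).target := isOpen_extChartAt_target y₀
  set T := (extChartAt 𝓘(ℝ, E) y₀).target with hTdef
  set x₀ := extChartAt 𝓘(ℝ, E) y₀ y₀ with hx₀
  obtain ⟨r, hr, hrT⟩ := Metric.nhds_basis_closedBall.mem_iff.1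
    (hT.mem_nhds (mem_extChartAt_target (I := 𝓘(ℝ, E)) y₀))
  let f : ContDiffBump x₀ := ⟨r / 2, r, by linarith, by linarith⟩
  have hfT : tsupport f ⊆ T := by
    rw [f.tsupport_eq]
    exact hrT
  set Xc : ℝ → E → E := fun t x ↦ f x • chartField X y₀ t x with hXc
  have hzero : ∀ t, ∀ x, x ∉ tsupport f → Xc t x = 0 := fun t x hx ↦ by
    simp only [hXc]
    rw [image_eq_zero_of_notMem_tsupport hx, zero_smul]
  have hsm : ContDiffOn ℝ ∞ (uncurry Xc) (Icc 0 1 ×ˢ univ) := by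
    rintro ⟨t, x⟩ ⟨ht, -⟩
    by_cases hx : x ∈ tsupport f
    · have h1 : ContDiffOn ℝ ∞ (uncurry Xc) (Icc 0 1 ×ˢ T) :=
        (f.contDiff.comp contDiff_snd).contDiffOn.smul (hX y₀)
      refine (h1 (t, x) ⟨ht, hfT hx⟩).mono_of_mem_nhdsWithin ?_
      rw [nhdsWithin_prod_eq, nhdsWithin_univ]
      exact prod_mem_prod self_mem_nhdsWithin (hT.mem_nhds (hfT hx))
    · refine (contDiffWithinAt_const (c := (0 : E))).congr_of_eventuallyEq ?_ (hzero t x hx)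
      refine eventually_nhdsWithin_of_eventually_nhds ?_
      filter_upwards [((isClosed_tsupport f).isOpen_compl.preimage continuous_snd).mem_nhds
        (show (t, x) ∈ Prod.snd ⁻¹' (tsupport f)ᶜ from hx)] with w hw
      exact hzero w.1 w.2 hw
  have hcpt : IsCompact (Icc (0 : ℝ) 1 ×ˢ tsupport f) := isCompact_Icc.prod f.hasCompactSupport
  have hsub : Icc (0 : ℝ) 1 ×ˢ tsupport f ⊆ Icc 0 1 ×ˢ univ := prod_mono subset_rfl (subset_univ _)
  have hu : UniqueDiffOn ℝ (Icc (0 : ℝ) 1 ×ˢ (univ : Set E)) :=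
    (uniqueDiffOn_Icc zero_lt_one).prod uniqueDiffOn_univ
  obtain ⟨C, hC⟩ := hcpt.exists_bound_of_continuousOn (hsm.continuousOn.mono hsub)
  obtain ⟨D, hD⟩ := hcpt.exists_bound_of_continuousOn
    ((hsm.continuousOn_fderivWithin hu (by simp)).mono hsub)
  refine ⟨Xc, (max D 0).toNNReal, (max C 0).toNNReal, r / 2, by linarith, hsm,
    fun t ht ↦ ?_, fun t ht x ↦ ?_, ?_, fun t x hx ↦ ?_⟩
  · have hd : ∀ x, HasFDerivAt (Xc t) ((fderivWithin ℝ (uncurry Xc) (Icc 0 1 ×ˢ univ) (t, x)).comp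
        (ContinuousLinearMap.inr ℝ ℝ E)) x := fun x ↦
      hasFDerivAt_slice isOpen_univ ht (mem_univ x)
        (hsm.differentiableOn (by simp) (t, x) ⟨ht, mem_univ _⟩).hasFDerivWithinAt
    refine lipschitzWith_of_nnnorm_fderiv_le (𝕜 := ℝ) (fun x ↦ (hd x).differentiableAt) fun x ↦ ?_
    rw [← NNReal.coe_le_coe]
    rw [coe_nnnorm, Real.coe_toNNReal _ (le_max_right _ _)]
    by_cases hx : x ∈ tsupport f
    · rw [(hd x).fderiv]
      refine le_trans ?_ (le_max_left _ _)
      refine (ContinuousLinearMap.opNorm_comp_le _ _).trans ?_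
      refine (mul_le_of_le_one_right (norm_nonneg _)
        (ContinuousLinearMap.norm_inr_le_one ℝ ℝ E)).trans (hD _ ⟨ht, hx⟩)
    · have h0 : Xc t =ᶠ[𝓝 x] fun _ ↦ 0 := by
        filter_upwards [(isClosed_tsupport f).isOpen_compl.mem_nhds hx] with w hw
        exact hzero t w hw
      rw [h0.fderiv_eq]
      simp
  · rw [Real.coe_toNNReal _ (le_max_right _ _)]
    by_cases hx : x ∈ tsupport f
    · exact (hC (t, x) ⟨ht, hx⟩).trans (le_max_left _ _)
    · rw [hzero t x hx, norm_zero]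
      exact le_max_right _ _
  · exact (Metric.ball_subset_closedBall.trans (Metric.closedBall_subset_closedBall
      (by linarith))).trans hrT
  · simp only [hXc]
    rw [f.one_of_mem_closedBall (Metric.ball_subset_closedBall hx), one_smul]

variable [IsManifold 𝓘(ℝ, E) ∞ M]

theorem HasVelocityAt.hasDerivWithinAt_chart {γ : ℝ → M} {v : E} {t : ℝ} (h : HasVelocityAt γ v t)
    (y₀ : M) (hs : γ t ∈ (extChartAt 𝓘(ℝ, E) y₀).source) :
    HasDerivWithinAt (fun t ↦ extChartAt 𝓘(ℝ, E) y₀ (γ t)) (dchart y₀ (γ t) v) (Icc 0 1) t := by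
  have h1 := (hasFDerivWithinAt_chart_comp h y₀ hs).hasDerivWithinAt
  have h2 : ((dchart y₀ (γ t)).comp (ContinuousLinearMap.toSpanSingleton ℝ v)) 1 =
      dchart y₀ (γ t) v := by simp
  rwa [← h2]

/-- A trajectory in a chart gives a trajectory on the manifold. -/
theorem hasVelocityAt_chart_symm {X : ℝ → M → E} (y₀ : M) {c : ℝ → E} {t : ℝ}
    (hc : HasDerivWithinAt c (chartField X y₀ t (c t)) (Icc 0 1) t)
    (ht : c t ∈ (extChartAt 𝓘(ℝ, E) y₀).target) :
    HasVelocityAt (fun t ↦ (extChartAt 𝓘(ℝ, E) y₀).symm (c t))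
      (X t ((extChartAt 𝓘(ℝ, E) y₀).symm (c t))) t := by
  have h1 := (hasMFDerivAt_chart_symm y₀ ht).comp_hasMFDerivWithinAt t
    (hasMFDerivWithinAt_iff_hasFDerivWithinAt.2 hc.hasFDerivWithinAt)
  have h2 := dchartSymm_dchart y₀ ((extChartAt 𝓘(ℝ, E) y₀).map_target ht)
    (X t ((extChartAt 𝓘(ℝ, E) y₀).symm (c t)))
  rw [(extChartAt 𝓘(ℝ, E) y₀).right_inv ht] at h2
  have h3 : (dchartSymm y₀ (c t)).comp
      (ContinuousLinearMap.toSpanSingleton ℝ (chartField X y₀ t (c t))) =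
      ContinuousLinearMap.toSpanSingleton ℝ (X t ((extChartAt 𝓘(ℝ, E) y₀).symm (c t))) := by
    ext
    simpa [chartField] using h2
  exact h1.congr_mfderiv h3

variable [FiniteDimensional ℝ E]

/-- Trajectories are determined by their value at one time. -/
theorem IsTrajectoryOn.eqOn [T2Space M] {X : ℝ → M → E} (hX : IsSmoothField X) {J : Set ℝ}
    (hJ : IsPreconnected J) (hJI : J ⊆ Icc 0 1) {γ₁ γ₂ : ℝ → M} (h₁ : IsTrajectoryOn X γ₁ J)
    (h₂ : IsTrajectoryOn X γ₂ J) {s : ℝ} (hs : s ∈ J) (h : γ₁ s = γ₂ s) : EqOn γ₁ γ₂ J := by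
  have hc : ∀ {γ : ℝ → M}, IsTrajectoryOn X γ J → ContinuousOn γ J := fun hγ t ht ↦
    (hγ t ht).continuousWithinAt.mono hJI
  have hpc : PreconnectedSpace J := Subtype.preconnectedSpace hJ
  have hclopen : IsClopen {t : J | γ₁ t = γ₂ t} := by
    refine ⟨isClosed_eq (hc h₁).domRestrict (hc h₂).domRestrict, isOpen_iff_mem_nhds.2 ?_⟩
    rintro ⟨τ, hτ⟩ heq
    change ∀ᶠ t : J in 𝓝 ⟨τ, hτ⟩, γ₁ t = γ₂ t
    rw [eventually_nhds_subtype_iff J ⟨τ, hτ⟩ (fun t ↦ γ₁ t = γ₂ t)]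
    set y₀ := γ₁ τ with hy₀
    have heq' : γ₂ τ = y₀ := heq.symm
    obtain ⟨Xc, K, L, R, hR, -, hK, -, -, hXc⟩ := hX.exists_cutoff y₀
    set x₀ := extChartAt 𝓘(ℝ, E) y₀ y₀
    set N := (extChartAt 𝓘(ℝ, E) y₀).source ∩
      extChartAt 𝓘(ℝ, E) y₀ ⁻¹' Metric.ball x₀ R with hN
    have hNn : N ∈ 𝓝 y₀ := inter_mem (extChartAt_source_mem_nhds y₀)
      (continuousAt_extChartAt y₀ (Metric.ball_mem_nhds _ hR))
    have e1 : ∀ᶠ t in 𝓝[J] τ, γ₁ t ∈ N := (hc h₁) τ hτ hNn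
    have e2 : ∀ᶠ t in 𝓝[J] τ, γ₂ t ∈ N := (hc h₂) τ hτ (by rwa [heq'])
    obtain ⟨δ, hδ, hδN⟩ := Metric.mem_nhdsWithin_iff.1 (e1.and e2)
    refine Metric.mem_nhdsWithin_iff.2 ⟨δ, hδ, fun t ht ↦ ?_⟩
    have hsub : uIcc τ t ⊆ Metric.ball τ δ ∩ J :=
      subset_inter ((convex_ball τ δ).ordConnected.uIcc_subset (Metric.mem_ball_self hδ) ht.1)
        (hJ.ordConnected.uIcc_subset hτ ht.2)
    have hd : ∀ {γ : ℝ → M}, IsTrajectoryOn X γ J → (∀ u ∈ uIcc τ t, γ u ∈ N) → ∀ u ∈ uIcc τ t,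
        HasDerivWithinAt (fun u ↦ extChartAt 𝓘(ℝ, E) y₀ (γ u))
          (Xc u (extChartAt 𝓘(ℝ, E) y₀ (γ u))) (Icc 0 1) u := fun hγ hγN u hu ↦ by
      rw [hXc u _ (hγN u hu).2, chartField_chart X y₀ u (hγN u hu).1]
      exact (hγ u (hsub hu).2).hasDerivWithinAt_chart y₀ (hγN u hu).1
    have hfin := eq_of_hasDerivWithinAt_lipschitz (f := fun u ↦ extChartAt 𝓘(ℝ, E) y₀ (γ₁ u))
      (g := fun u ↦ extChartAt 𝓘(ℝ, E) y₀ (γ₂ u)) hK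
      ((hsub.trans inter_subset_right).trans hJI)
      (hd h₁ fun u hu ↦ (hδN (hsub hu)).1) (hd h₂ fun u hu ↦ (hδN (hsub hu)).2)
      (by rw [heq'])
    exact (extChartAt 𝓘(ℝ, E) y₀).injOn (hδN (hsub right_mem_uIcc)).1.1
      (hδN (hsub right_mem_uIcc)).2.1 hfin
  intro t ht
  have := hclopen.eq_univ ⟨⟨s, hs⟩, h⟩
  exact (this ▸ mem_univ (⟨t, ht⟩ : J) : (⟨t, ht⟩ : J) ∈ {t : J | γ₁ t = γ₂ t})

/-- Local flows exist near each point, on time intervals that do not depend on the start time. -/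
theorem IsSmoothField.exists_local_flow {X : ℝ → M → E} (hX : IsSmoothField X) (y₀ : M) :
    ∃ ε > 0, ∃ W : Set M, IsOpen W ∧ y₀ ∈ W ∧ ∀ s ∈ Icc (0 : ℝ) 1, ∃ Φ : ℝ → M → M,
      (∀ y ∈ W, Φ s y = y) ∧ ∀ t ∈ Icc (0 : ℝ) 1 ∩ Metric.ball s ε, ∀ y ∈ W,
        ContMDiffWithinAt (𝓘(ℝ, ℝ).prod 𝓘(ℝ, E)) 𝓘(ℝ, E) ∞ (uncurry Φ) (Icc 0 1 ×ˢ univ) (t, y) ∧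
        HasVelocityAt (fun t ↦ Φ t y) (X t (Φ t y)) t := by
  obtain ⟨Xc, K, L, R, hR, hsm, hK, hL, hT, hXc⟩ := hX.exists_cutoff y₀
  set x₀ := extChartAt 𝓘(ℝ, E) y₀ y₀ with hx₀
  refine ⟨R / (2 * (L + 1)), by positivity, (extChartAt 𝓘(ℝ, E) y₀).source ∩
      extChartAt 𝓘(ℝ, E) y₀ ⁻¹' Metric.ball x₀ (R / 2), ?_, ⟨mem_extChartAt_source y₀,
      Metric.mem_ball_self (half_pos hR)⟩, fun s hs ↦ ?_⟩
  · exact (continuousOn_extChartAt y₀).isOpen_inter_preimage (isOpen_extChartAt_source y₀)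
      Metric.isOpen_ball
  obtain ⟨Φ, hΦs, hΦ, hΦd⟩ := exists_smooth_flow_of_lipschitz hsm hK hL hs
  refine ⟨fun t y ↦ (extChartAt 𝓘(ℝ, E) y₀).symm (Φ t (extChartAt 𝓘(ℝ, E) y₀ y)),
    fun y hy ↦ by simp only [hΦs]; rw [(extChartAt 𝓘(ℝ, E) y₀).left_inv hy.1], ?_⟩
  rintro t ⟨ht, hts⟩ y ⟨hy, hyR⟩
  set x := extChartAt 𝓘(ℝ, E) y₀ y
  have hdist : ‖Φ t x - Φ s x‖ ≤ L * ‖t - s‖ :=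
    (convex_Icc (0 : ℝ) 1).norm_image_sub_le_of_norm_hasDerivWithin_le (f := (Φ · x))
      (fun τ hτ ↦ hΦd τ hτ x) (fun τ hτ ↦ hL τ hτ _) hs ht
  have hin : Φ t x ∈ Metric.ball x₀ R := by
    rw [hΦs] at hdist
    rw [mem_preimage, Metric.mem_ball] at hyR
    rw [Metric.mem_ball, Real.dist_eq, lt_div_iff₀ (by positivity)] at hts
    rw [Metric.mem_ball]
    have h1 := dist_triangle (Φ t x) x x₀
    rw [dist_eq_norm (Φ t x) x] at h1
    rw [Real.norm_eq_abs] at hdist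
    have h2 : dist x x₀ < R / 2 := hyR
    nlinarith [abs_nonneg (t - s)]
  constructor
  · have h1 : ContMDiffAt 𝓘(ℝ, E) 𝓘(ℝ, E) ∞ (extChartAt 𝓘(ℝ, E) y₀) y := by
      rw [extChartAt_source] at hy
      exact contMDiffAt_extChartAt' hy
    have h2 : ContMDiffWithinAt (𝓘(ℝ, ℝ).prod 𝓘(ℝ, E)) 𝓘(ℝ, ℝ × E) ∞
        (fun q : ℝ × M ↦ (q.1, extChartAt 𝓘(ℝ, E) y₀ q.2)) (Icc 0 1 ×ˢ univ) (t, y) :=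
      contMDiffWithinAt_fst.prodMk_space
        ((h1.comp (t, y) contMDiffAt_snd).contMDiffWithinAt)
    have h3 := (hΦ.contMDiffOn (t, x) ⟨ht, mem_univ _⟩).comp (t, y) h2 (t := Icc 0 1 ×ˢ univ)
      fun q hq ↦ ⟨hq.1, mem_univ _⟩
    exact ((contMDiffOn_extChartAt_symm (n := ∞) y₀).contMDiffAt
      ((isOpen_extChartAt_target y₀).mem_nhds (hT hin))).comp_contMDiffWithinAt (t, y) h3
  · refine hasVelocityAt_chart_symm y₀ (c := fun t ↦ Φ t x) ?_ (hT hin)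
    rw [← hXc t _ hin]
    exact hΦd t ht x

end Trajectories

/-! ### Flows of compactly supported vector fields -/

section Flow

variable {E : Type*} [NormedAddCommGroup E] [NormedSpace ℝ E]
  {M : Type*} [TopologicalSpace M] [ChartedSpace E M] [IsManifold 𝓘(ℝ, E) ∞ M]
  [FiniteDimensional ℝ E] [T2Space M] {X : ℝ → M → E}

open Classical in
/-- Trajectories on two intervals that agree at a common time are glued to one on the union. -/
theorem IsTrajectoryOn.exists_concat (hX : IsSmoothField X) {O₁ O₂ : Set ℝ}
    (h₁o : IsOpen O₁) (h₂o : IsOpen O₂) (h₁c : O₁.OrdConnected) (h₂c : O₂.OrdConnected)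
    {γ₁ γ₂ : ℝ → M} (h₁ : IsTrajectoryOn X γ₁ (Icc 0 1 ∩ O₁))
    (h₂ : IsTrajectoryOn X γ₂ (Icc 0 1 ∩ O₂)) {u : ℝ} (hu : u ∈ Icc (0 : ℝ) 1) (hu₁ : u ∈ O₁)
    (hu₂ : u ∈ O₂) (h : γ₁ u = γ₂ u) :
    ∃ γ : ℝ → M, EqOn γ γ₁ O₁ ∧ IsTrajectoryOn X γ (Icc 0 1 ∩ (O₁ ∪ O₂)) := by
  have hJ : (Icc (0 : ℝ) 1 ∩ (O₁ ∩ O₂)).OrdConnected := ordConnected_Icc.inter (h₁c.inter h₂c)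
  have heq : EqOn γ₁ γ₂ (Icc 0 1 ∩ (O₁ ∩ O₂)) :=
    (h₁.mono (inter_subset_inter_right _ inter_subset_left)).eqOn hX hJ.isPreconnected
      inter_subset_left (h₂.mono (inter_subset_inter_right _ inter_subset_right))
      ⟨hu, hu₁, hu₂⟩ h
  have e₁ : EqOn (O₁.piecewise γ₁ γ₂) γ₁ O₁ := piecewise_eqOn _ _ _
  have e₂ : EqOn (O₁.piecewise γ₁ γ₂) γ₂ (Icc 0 1 ∩ O₂) := fun t ht ↦ by
    by_cases ht₁ : t ∈ O₁
    · rw [e₁ ht₁, heq ⟨ht.1, ht₁, ht.2⟩]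
    · exact piecewise_eq_of_notMem _ _ _ ht₁
  refine ⟨O₁.piecewise γ₁ γ₂, e₁, ?_⟩
  rintro t ⟨ht, ht₁ | ht₂⟩
  · rw [e₁ ht₁]
    exact (h₁ t ⟨ht, ht₁⟩).congr
      (eventually_nhdsWithin_of_eventually_nhds (e₁.eventuallyEq_of_mem (h₁o.mem_nhds ht₁)))
      (e₁ ht₁)
  · rw [e₂ ⟨ht, ht₂⟩]
    exact (h₂ t ⟨ht, ht₂⟩).congr (e₂.eventuallyEq_of_mem
      (inter_mem self_mem_nhdsWithin (mem_nhdsWithin_of_mem_nhds (h₂o.mem_nhds ht₂))))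
      (e₂ ⟨ht, ht₂⟩)

/-- If trajectories exist for a time `r` around each start time, then they exist on all of `[0,1]`:
by concatenation the existence time can be multiplied repeatedly by `3 / 2`. -/
theorem exists_trajectoryOn_of_local (hX : IsSmoothField X) {r : ℝ} (hr : 0 < r)
    (h : ∀ s ∈ Icc (0 : ℝ) 1, ∀ y : M, ∃ γ : ℝ → M, γ s = y ∧
      IsTrajectoryOn X γ (Icc 0 1 ∩ Metric.ball s r)) {s : ℝ} (hs : s ∈ Icc (0 : ℝ) 1) (y : M) :
    ∃ γ : ℝ → M, γ s = y ∧ IsTrajectoryOn X γ (Icc 0 1) := by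
  have hstep : ∀ n : ℕ, ∀ s ∈ Icc (0 : ℝ) 1, ∀ y : M, ∃ γ : ℝ → M, γ s = y ∧
      IsTrajectoryOn X γ (Icc 0 1 ∩ Metric.ball s (r * (3 / 2) ^ n)) := by
    intro n
    induction n with
    | zero => simpa using h
    | succ n ih =>
      intro s hs y
      set R := r * (3 / 2) ^ n with hR
      have hRpos : 0 < R := by positivity
      have hR' : r * (3 / 2) ^ (n + 1) = 3 / 2 * R := by rw [hR]; ring
      have hb : ∀ a : ℝ, (Metric.ball a R).OrdConnected := fun a ↦ (convex_ball a R).ordConnected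
      obtain ⟨γ, hγs, hγ⟩ := ih s hs y
      -- extension to the right of `s`
      set u := min (s + R / 2) 1 with hu
      have hu1 : u ≤ 1 := min_le_right _ _
      have hus : s ≤ u := le_min (by linarith) hs.2
      have hus' : u ≤ s + R / 2 := min_le_left _ _
      have huI : u ∈ Icc (0 : ℝ) 1 := ⟨hs.1.trans hus, hu1⟩
      have hu2 : u ∈ Metric.ball s R := by
        rw [Metric.mem_ball, Real.dist_eq, abs_lt]
        constructor <;> linarith
      obtain ⟨γ', hγ's, hγ'⟩ := ih u huI (γ u)
      obtain ⟨δ, hδ, hδt⟩ := hγ.exists_concat hX Metric.isOpen_ball Metric.isOpen_ball (hb s) (hb u)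
        hγ' huI hu2 (Metric.mem_ball_self hRpos) hγ's.symm
      -- extension to the left of `s`
      set v := max (s - R / 2) 0 with hv
      have hv1 : 0 ≤ v := le_max_right _ _
      have hvs : v ≤ s := max_le (by linarith) hs.1
      have hvs' : s - R / 2 ≤ v := le_max_left _ _
      have hvI : v ∈ Icc (0 : ℝ) 1 := ⟨hv1, hvs.trans hs.2⟩
      have hv2 : v ∈ Metric.ball s R := by
        rw [Metric.mem_ball, Real.dist_eq, abs_lt]
        constructor <;> linarith
      obtain ⟨δ', hδ's, hδ'⟩ := ih v hvI (δ v)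
      obtain ⟨η, hη, hηt⟩ := hδt.exists_concat hX (Metric.isOpen_ball.union Metric.isOpen_ball)
        Metric.isOpen_ball ((hb s).isPreconnected.union u hu2 (Metric.mem_ball_self hRpos)
          (hb u).isPreconnected).ordConnected (hb v)
        hδ' hvI (Or.inl hv2) (Metric.mem_ball_self hRpos) hδ's.symm
      refine ⟨η, ?_, hηt.mono ?_⟩
      · rw [hη (Or.inl (Metric.mem_ball_self hRpos)), hδ (Metric.mem_ball_self hRpos), hγs]
      · rintro t ⟨ht, hts⟩
        refine ⟨ht, ?_⟩
        simp only [Metric.mem_ball, Real.dist_eq, abs_lt, hR', mem_union] at hts ⊢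
        rcases le_total s t with hst | hst
        · refine Or.inl (Or.inr ⟨by linarith, ?_⟩)
          rcases min_choice (s + R / 2) 1 with h1 | h1 <;> rw [hu, h1] <;> linarith [ht.2]
        · refine Or.inr ⟨?_, by linarith⟩
          rcases max_choice (s - R / 2) 0 with h1 | h1 <;> rw [hv, h1] <;> linarith [ht.1]
  obtain ⟨n, hn⟩ := pow_unbounded_of_one_lt (2 / r) (by norm_num : (1 : ℝ) < 3 / 2)
  obtain ⟨γ, hγs, hγ⟩ := hstep n s hs y
  refine ⟨γ, hγs, hγ.mono fun t ht ↦ ⟨ht, ?_⟩⟩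
  rw [div_lt_iff₀ hr] at hn
  rw [Metric.mem_ball, Real.dist_eq, abs_lt]
  constructor <;> linarith [ht.1, ht.2, hs.1, hs.2]

/-- A smooth time-dependent vector field which vanishes outside a compact set has a smooth flow
`Φ s t`, from time `s` to time `t`. -/
theorem IsSmoothField.exists_flow (hX : IsSmoothField X) {K : Set M} (hK : IsCompact K)
    (hXK : ∀ t ∈ Icc (0 : ℝ) 1, ∀ y ∉ K, X t y = 0) :
    ∃ Φ : ℝ → ℝ → M → M, (∀ s ∈ Icc (0 : ℝ) 1, ∀ y, Φ s s y = y) ∧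
      (∀ s ∈ Icc (0 : ℝ) 1, ∀ y, IsTrajectoryOn X (fun t ↦ Φ s t y) (Icc 0 1)) ∧
      ∀ s ∈ Icc (0 : ℝ) 1, ContMDiffOn (𝓘(ℝ, ℝ).prod 𝓘(ℝ, E)) 𝓘(ℝ, E) ∞ (uncurry (Φ s))
        (Icc 0 1 ×ˢ univ) := by
  -- local flows, on time intervals of a uniform length
  have hloc : ∃ ε > 0, ∀ y ∈ K, ∃ W : Set M, IsOpen W ∧ y ∈ W ∧ ∀ s ∈ Icc (0 : ℝ) 1,
      ∃ Φ : ℝ → M → M, (∀ y ∈ W, Φ s y = y) ∧ ∀ t ∈ Icc (0 : ℝ) 1 ∩ Metric.ball s ε, ∀ y ∈ W,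
        ContMDiffWithinAt (𝓘(ℝ, ℝ).prod 𝓘(ℝ, E)) 𝓘(ℝ, E) ∞ (uncurry Φ) (Icc 0 1 ×ˢ univ) (t, y) ∧
        HasVelocityAt (fun t ↦ Φ t y) (X t (Φ t y)) t := by
    refine hK.induction_on (p := fun A ↦ ∃ ε > 0, ∀ y ∈ A, ∃ W : Set M, IsOpen W ∧ y ∈ W ∧
      ∀ s ∈ Icc (0 : ℝ) 1, ∃ Φ : ℝ → M → M, (∀ y ∈ W, Φ s y = y) ∧
        ∀ t ∈ Icc (0 : ℝ) 1 ∩ Metric.ball s ε, ∀ y ∈ W, ContMDiffWithinAt (𝓘(ℝ, ℝ).prod 𝓘(ℝ, E))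
          𝓘(ℝ, E) ∞ (uncurry Φ) (Icc 0 1 ×ˢ univ) (t, y) ∧
        HasVelocityAt (fun t ↦ Φ t y) (X t (Φ t y)) t) ?_ ?_ ?_ ?_
    · exact ⟨1, one_pos, fun y hy ↦ hy.elim⟩
    · rintro A B hAB ⟨ε, hε, h⟩
      exact ⟨ε, hε, fun y hy ↦ h y (hAB hy)⟩
    · rintro A B ⟨ε, hε, h⟩ ⟨ε', hε', h'⟩
      refine ⟨min ε ε', lt_min hε hε', ?_⟩
      rintro y (hy | hy)
      · obtain ⟨W, hW, hyW, hs⟩ := h y hy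
        refine ⟨W, hW, hyW, fun s hsI ↦ ?_⟩
        obtain ⟨Φ, hΦ, hΦ'⟩ := hs s hsI
        exact ⟨Φ, hΦ, fun t ht ↦ hΦ' t ⟨ht.1, Metric.ball_subset_ball (min_le_left _ _) ht.2⟩⟩
      · obtain ⟨W, hW, hyW, hs⟩ := h' y hy
        refine ⟨W, hW, hyW, fun s hsI ↦ ?_⟩
        obtain ⟨Φ, hΦ, hΦ'⟩ := hs s hsI
        exact ⟨Φ, hΦ, fun t ht ↦ hΦ' t ⟨ht.1, Metric.ball_subset_ball (min_le_right _ _) ht.2⟩⟩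
    · intro y _
      obtain ⟨ε, hε, W, hW, hyW, h⟩ := hX.exists_local_flow y
      exact ⟨W, mem_nhdsWithin_of_mem_nhds (hW.mem_nhds hyW), ε, hε, fun y hy ↦ ⟨W, hW, hy, h⟩⟩
  obtain ⟨ε, hε, hloc⟩ := hloc
  have hloc' : ∀ y, ∃ W : Set M, IsOpen W ∧ y ∈ W ∧ ∀ s ∈ Icc (0 : ℝ) 1,
      ∃ Φ : ℝ → M → M, (∀ y ∈ W, Φ s y = y) ∧ ∀ t ∈ Icc (0 : ℝ) 1 ∩ Metric.ball s ε, ∀ y ∈ W,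
        ContMDiffWithinAt (𝓘(ℝ, ℝ).prod 𝓘(ℝ, E)) 𝓘(ℝ, E) ∞ (uncurry Φ) (Icc 0 1 ×ˢ univ) (t, y) ∧
        HasVelocityAt (fun t ↦ Φ t y) (X t (Φ t y)) t := by
    intro y
    by_cases hy : y ∈ K
    · exact hloc y hy
    · refine ⟨Kᶜ, hK.isClosed.isOpen_compl, hy, fun s hs ↦ ⟨fun _ y ↦ y, fun _ _ ↦ rfl,
        fun t ht y hy ↦ ⟨contMDiffWithinAt_snd, ?_⟩⟩⟩
      rw [hXK t ht.1 y hy]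
      exact hasVelocityAt_const y t
  have htraj : ∀ s ∈ Icc (0 : ℝ) 1, ∀ y : M, ∃ γ : ℝ → M, γ s = y ∧
      IsTrajectoryOn X γ (Icc 0 1) := by
    intro s hs y
    refine exists_trajectoryOn_of_local hX hε (fun s hs y ↦ ?_) hs y
    obtain ⟨W, -, hyW, h⟩ := hloc' y
    obtain ⟨Φ, hΦ, hΦ'⟩ := h s hs
    exact ⟨fun t ↦ Φ t y, hΦ y hyW, fun t ht ↦ (hΦ' t ht y hyW).2⟩
  have : ∀ s : ℝ, ∃ Φ : ℝ → M → M, s ∈ Icc (0 : ℝ) 1 → (∀ y, Φ s y = y) ∧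
      ∀ y, IsTrajectoryOn X (fun t ↦ Φ t y) (Icc 0 1) := by
    intro s
    by_cases hs : s ∈ Icc (0 : ℝ) 1
    · choose γ h1 h2 using htraj s hs
      exact ⟨fun t y ↦ γ y t, fun _ ↦ ⟨h1, h2⟩⟩
    · exact ⟨fun _ y ↦ y, fun h ↦ absurd h hs⟩
  choose Φ hΦ using this
  have hΦs : ∀ s ∈ Icc (0 : ℝ) 1, ∀ y, Φ s s y = y := fun s hs ↦ (hΦ s hs).1
  have hΦt : ∀ s ∈ Icc (0 : ℝ) 1, ∀ y, IsTrajectoryOn X (fun t ↦ Φ s t y) (Icc 0 1) :=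
    fun s hs ↦ (hΦ s hs).2
  refine ⟨Φ, hΦs, hΦt, ?_⟩
  have hcocycle : ∀ s ∈ Icc (0 : ℝ) 1, ∀ u ∈ Icc (0 : ℝ) 1, ∀ t ∈ Icc (0 : ℝ) 1, ∀ y,
      Φ u t (Φ s u y) = Φ s t y := fun s hs u hu t ht y ↦
    (hΦt u hu (Φ s u y)).eqOn hX isPreconnected_Icc subset_rfl (hΦt s hs y) hu
      (hΦs u hu _) ht
  -- smoothness of `Φ s` at times `t` is known for `t` close to `s`; splitting at the midpoint
  -- doubles the admissible distance
  have hsmooth : ∀ n : ℕ, ∀ s ∈ Icc (0 : ℝ) 1, ∀ t ∈ Icc (0 : ℝ) 1, |t - s| < ε * 2 ^ n → ∀ y,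
      ContMDiffWithinAt (𝓘(ℝ, ℝ).prod 𝓘(ℝ, E)) 𝓘(ℝ, E) ∞ (uncurry (Φ s)) (Icc 0 1 ×ˢ univ)
        (t, y) := by
    intro n
    induction n with
    | zero =>
      intro s hs t ht hts y
      rw [pow_zero, mul_one] at hts
      obtain ⟨W, hW, hyW, h⟩ := hloc' y
      obtain ⟨Ψ, hΨ, hΨ'⟩ := h s hs
      have heq : ∀ y' ∈ W, ∀ t' ∈ Icc (0 : ℝ) 1 ∩ Metric.ball s ε, Φ s t' y' = Ψ t' y' :=
        fun y' hy' ↦ ((hΦt s hs y').mono inter_subset_left).eqOn hX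
          (ordConnected_Icc.inter (convex_ball s ε).ordConnected).isPreconnected inter_subset_left
          (fun t' ht' ↦ (hΨ' t' ht' y' hy').2) ⟨hs, Metric.mem_ball_self hε⟩
          ((hΦs s hs y').trans (hΨ y' hy').symm)
      have hts' : t ∈ Metric.ball s ε := by rwa [Metric.mem_ball, Real.dist_eq]
      refine ((hΨ' t ⟨ht, hts'⟩ y hyW).1).congr_of_eventuallyEq ?_ (heq y hyW t ⟨ht, hts'⟩)
      filter_upwards [self_mem_nhdsWithin, mem_nhdsWithin_of_mem_nhds
        ((Metric.isOpen_ball.prod hW).mem_nhds (show (t, y) ∈ Metric.ball s ε ×ˢ W from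
          ⟨hts', hyW⟩))] with q hq1 hq2
      exact heq q.2 hq2.2 q.1 ⟨hq1.1, hq2.1⟩
    | succ n ih =>
      intro s hs t ht hts y
      set u := (s + t) / 2 with hu
      have huI : u ∈ Icc (0 : ℝ) 1 := ⟨by linarith [hs.1, ht.1], by linarith [hs.2, ht.2]⟩
      have h1 : |u - s| < ε * 2 ^ n := by
        rw [show u - s = (t - s) / 2 by rw [hu]; ring, abs_div, abs_two, div_lt_iff₀ two_pos]
        rwa [mul_assoc, ← pow_succ]
      have h2 : |t - u| < ε * 2 ^ n := by
        rw [show t - u = (t - s) / 2 by rw [hu]; ring, abs_div, abs_two, div_lt_iff₀ two_pos]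
        rwa [mul_assoc, ← pow_succ]
      have h3 : ContMDiffWithinAt (𝓘(ℝ, ℝ).prod 𝓘(ℝ, E)) 𝓘(ℝ, E) ∞
          (fun q : ℝ × M ↦ Φ s u q.2) (Icc 0 1 ×ˢ univ) (t, y) :=
        (ih s hs u huI h1 y).comp (f := fun q : ℝ × M ↦ (u, q.2)) (t, y)
          (contMDiffWithinAt_const.prodMk contMDiffWithinAt_snd) fun q _ ↦ ⟨huI, mem_univ _⟩
      have h4 := (ih u huI t ht h2 (Φ s u y)).comp (f := fun q : ℝ × M ↦ (q.1, Φ s u q.2)) (t, y)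
        (contMDiffWithinAt_fst.prodMk h3) (t := Icc 0 1 ×ˢ univ) fun q hq ↦ ⟨hq.1, mem_univ _⟩
      exact h4.congr (fun q hq ↦ (hcocycle s hs u huI q.1 hq.1 q.2).symm)
        (hcocycle s hs u huI t ht y).symm
  rintro s hs ⟨t, y⟩ ⟨ht, -⟩
  obtain ⟨n, hn⟩ := pow_unbounded_of_one_lt (2 / ε) (by norm_num : (1 : ℝ) < 2)
  refine hsmooth n s hs t ht ?_ y
  rw [div_lt_iff₀ hε] at hn
  rw [abs_lt]
  constructor <;> linarith [ht.1, ht.2, hs.1, hs.2]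

end Flow

/-! ### Contact isotopies generated by contact Hamiltonians -/

/-- If the derivative of a path of nonzero covectors is proportional to the path, the kernel is
constant. -/
theorem apply_eq_zero_of_hasDerivWithinAt_smul {E : Type*} [NormedAddCommGroup E] [NormedSpace ℝ E]
    {a a' : ℝ → E →L[ℝ] ℝ} (ha : ∀ t ∈ Icc (0 : ℝ) 1, HasDerivWithinAt a (a' t) (Icc 0 1) t)
    (ha' : ContinuousOn a' (Icc 0 1)) (h0 : ∀ t ∈ Icc (0 : ℝ) 1, a t ≠ 0)
    (h : ∀ t ∈ Icc (0 : ℝ) 1, ∃ μ : ℝ, a' t = μ • a t) {s t : ℝ} (hs : s ∈ Icc (0 : ℝ) 1)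
    (ht : t ∈ Icc (0 : ℝ) 1) {w : E} (hw : a s w = 0) : a t w = 0 := by
  have hac : ContinuousOn a (Icc 0 1) := fun t ht ↦ (ha t ht).continuousWithinAt
  obtain ⟨C, hC⟩ := isCompact_Icc.exists_bound_of_continuousOn
    (ha'.norm.div hac.norm fun t ht ↦ norm_ne_zero_iff.2 (h0 t ht))
  have hmain := norm_le_of_norm_deriv_le (y := fun t ↦ a t w) (y' := fun t ↦ a' t w)
    (K := max C 1) (δ := 0) (ε := 0) hs (le_max_right _ _) le_rfl
    (fun t ht ↦ by simpa using (ha t ht).clm_apply (hasDerivWithinAt_const t (Icc 0 1) w))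
    (by simp [hw]) (fun t ht ↦ ?_) ht
  · simpa using hmain
  · obtain ⟨μ, hμ⟩ := h t ht
    have h1 := hC t ht
    simp only [Pi.div_apply] at h1
    rw [hμ, norm_smul, mul_div_assoc, div_self (norm_ne_zero_iff.2 (h0 t ht)), mul_one,
      norm_norm] at h1
    rw [hμ, add_zero, smul_apply, norm_smul]
    exact mul_le_mul_of_nonneg_right (h1.trans (le_max_left _ _)) (norm_nonneg _)

/-- This is the condition for the symmetry of second derivatives within `[0,1] × O`. -/
theorem mem_closure_interior_Icc_prod {Z : Type*} [TopologicalSpace Z] {O : Set Z}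
    {t : ℝ} {z : Z} (hO : IsOpen O) (ht : t ∈ Icc (0 : ℝ) 1) (hz : z ∈ O) :
    (t, z) ∈ closure (interior (Icc (0 : ℝ) 1 ×ˢ O)) := by
  rw [interior_prod_eq, interior_Icc, hO.interior_eq, closure_prod_eq, closure_Ioo zero_ne_one]
  exact ⟨ht, subset_closure hz⟩

section Slices

variable {E : Type*} [NormedAddCommGroup E] [NormedSpace ℝ E]
  {M : Type*} [TopologicalSpace M] [ChartedSpace E M]

theorem HasVelocityAt.unique {γ : ℝ → M} {v w : E} {t : ℝ} (h : HasVelocityAt γ v t)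
    (h' : HasVelocityAt γ w t) (ht : t ∈ Icc (0 : ℝ) 1) : v = w := by
  have h1 : (ContinuousLinearMap.toSpanSingleton ℝ v : ℝ →L[ℝ] E) =
      ContinuousLinearMap.toSpanSingleton ℝ w :=
    ((uniqueDiffOn_Icc zero_lt_one) t ht).uniqueMDiffWithinAt.eq h h'
  simpa using DFunLike.congr_fun h1 1

variable {Z : Type*} [NormedAddCommGroup Z] [NormedSpace ℝ Z] {f : ℝ × Z → M} {O : Set Z}
  {t : ℝ} {z : Z}

theorem hasVelocityAt_derivOn (hf : ContMDiffOn 𝓘(ℝ, ℝ × Z) 𝓘(ℝ, E) ∞ f (Icc 0 1 ×ˢ O))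
    (ht : t ∈ Icc (0 : ℝ) 1) (hz : z ∈ O) :
    HasVelocityAt (fun t ↦ f (t, z)) (derivOn (E := E) f (Icc 0 1 ×ˢ O) (t, z) (1, 0)) t := by
  have h1 : HasFDerivWithinAt (fun t : ℝ ↦ (t, z))
      ((ContinuousLinearMap.id ℝ ℝ).prod (0 : ℝ →L[ℝ] Z)) (Icc 0 1) t :=
    (hasFDerivWithinAt_id t _).prodMk (hasFDerivWithinAt_const z t _)
  have hsub : Icc (0 : ℝ) 1 ⊆ (fun t : ℝ ↦ (t, z)) ⁻¹' (Icc 0 1 ×ˢ O) := fun s hs ↦ ⟨hs, hz⟩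
  have h2 := (hasMFDerivWithinAt_derivOn (hf (t, z) ⟨ht, hz⟩)).comp t
    (hasMFDerivWithinAt_iff_hasFDerivWithinAt.2 h1) hsub
  have h3 : (derivOn (E := E) f (Icc 0 1 ×ˢ O) (t, z)).comp
      ((ContinuousLinearMap.id ℝ ℝ).prod (0 : ℝ →L[ℝ] Z)) =
      ContinuousLinearMap.toSpanSingleton ℝ
        (derivOn (E := E) f (Icc 0 1 ×ˢ O) (t, z) (1, 0)) := by
    ext
    simp
  exact h2.congr_mfderiv h3

theorem hasMFDerivAt_slice (hf : ContMDiffOn 𝓘(ℝ, ℝ × Z) 𝓘(ℝ, E) ∞ f (Icc 0 1 ×ˢ O))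
    (hO : IsOpen O) (ht : t ∈ Icc (0 : ℝ) 1) (hz : z ∈ O) :
    HasMFDerivAt 𝓘(ℝ, Z) 𝓘(ℝ, E) (fun z ↦ f (t, z)) z
      ((derivOn (E := E) f (Icc 0 1 ×ˢ O) (t, z)).comp (ContinuousLinearMap.inr ℝ ℝ Z)) := by
  have h1 : HasFDerivWithinAt (fun z : Z ↦ (t, z)) (ContinuousLinearMap.inr ℝ ℝ Z) O z :=
    (hasFDerivWithinAt_const t z _).prodMk (hasFDerivWithinAt_id z _)
  exact ((hasMFDerivWithinAt_derivOn (hf (t, z) ⟨ht, hz⟩)).comp z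
    (hasMFDerivWithinAt_iff_hasFDerivWithinAt.2 h1) fun s hs ↦ ⟨ht, hs⟩).hasMFDerivAt
    (hO.mem_nhds hz)

end Slices

section ContactIsotopy

variable {Y : Type*} [TopologicalSpace Y] [ChartedSpace (EuclideanSpace ℝ (Fin 3)) Y]

/-- The derivative of a map `Y → Y` at a point, on the model space. -/
noncomputable def dmap (f : Y → Y) (y : Y) : EuclideanSpace ℝ (Fin 3) →L[ℝ]
    EuclideanSpace ℝ (Fin 3) :=
  mfderiv (𝓡 3) (𝓡 3) f y

theorem HasVelocityAt.velocity_eq {ψ : ℝ → Y → Y} {t : ℝ} {y : Y} {v : EuclideanSpace ℝ (Fin 3)}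
    (h : HasVelocityAt (fun t ↦ ψ t y) v t) (ht : t ∈ Icc (0 : ℝ) 1) : velocity ψ t y = v := by
  have h1 : mfderivWithin 𝓘(ℝ, ℝ) (𝓡 3) (fun s : ℝ ↦ ψ s y) (Icc 0 1) t =
      (ContinuousLinearMap.toSpanSingleton ℝ v : ℝ →L[ℝ] EuclideanSpace ℝ (Fin 3)) :=
    HasMFDerivWithinAt.mfderivWithin h ((uniqueDiffOn_Icc zero_lt_one) t ht).uniqueMDiffWithinAt
  refine (congrArg (fun L : ℝ →L[ℝ] EuclideanSpace ℝ (Fin 3) ↦ L 1) h1).trans ?_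
  simp

variable [IsManifold (𝓡 3) ∞ Y] {α : OneForm Y} {H : ℝ → Y → ℝ} {ψ : ℝ → Y → Y}

theorem IsContactForm.eval_ne_zero (hα : IsContactForm α) (y : Y) : α.eval y ≠ 0 := fun h ↦ by
  obtain ⟨r, hr⟩ := (hα.isContactPair y).exists_ne_zero
  exact hr (by rw [h]; rfl)

/-- The flow of a contact vector field preserves the contact planes: the derivative in time of the
pulled back form `ψ_t^* α` is proportional to it. -/
theorem IsContactForm.eval_dmap_eq_zero (hα : IsContactForm α)
    (hH : ContMDiffOn (𝓘(ℝ, ℝ).prod (𝓡 3)) 𝓘(ℝ, ℝ) ∞ (fun z : ℝ × Y ↦ H z.1 z.2)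
      (Icc 0 1 ×ˢ univ))
    (hψ : ContMDiffOn (𝓘(ℝ, ℝ).prod (𝓡 3)) (𝓡 3) ∞ (fun z : ℝ × Y ↦ ψ z.1 z.2) (Icc 0 1 ×ˢ univ))
    (htraj : ∀ y, IsTrajectoryOn (fun t ↦ contactVec α (H t)) (fun t ↦ ψ t y) (Icc 0 1))
    (hsurj : ∀ t ∈ Icc (0 : ℝ) 1, ∀ y, Surjective (dmap (ψ t) y))
    {s t : ℝ} (hs : s ∈ Icc (0 : ℝ) 1) (ht : t ∈ Icc (0 : ℝ) 1) (y : Y)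
    {v : EuclideanSpace ℝ (Fin 3)} (hv : α.eval (ψ s y) (dmap (ψ s) y v) = 0) :
    α.eval (ψ t y) (dmap (ψ t) y v) = 0 := by
  set O := (extChartAt (𝓡 3) y).target with hOdef
  have hO : IsOpen O := isOpen_extChartAt_target y
  set x₀ := extChartAt (𝓡 3) y y with hx₀
  have hx₀O : x₀ ∈ O := mem_extChartAt_target y
  have hx₀y : (extChartAt (𝓡 3) y).symm x₀ = y := extChartAt_to_inv y
  set f : ℝ × EuclideanSpace ℝ (Fin 3) → Y := fun q ↦ ψ q.1 ((extChartAt (𝓡 3) y).symm q.2) with hf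
  set S := Icc (0 : ℝ) 1 ×ˢ O with hS
  have hu : UniqueDiffOn ℝ S := (uniqueDiffOn_Icc zero_lt_one).prod hO.uniqueDiffOn
  have hfsm : ContMDiffOn 𝓘(ℝ, ℝ × EuclideanSpace ℝ (Fin 3)) (𝓡 3) ∞ f S :=
    hψ.comp (f := fun w : ℝ × EuclideanSpace ℝ (Fin 3) ↦ (w.1, (extChartAt (𝓡 3) y).symm w.2))
      (contDiff_fst.contMDiff.contMDiffOn.prodMk
        ((contMDiffOn_extChartAt_symm (I := 𝓡 3) (n := ∞) y).comp
          contDiff_snd.contMDiff.contMDiffOn fun w hw ↦ hw.2)) fun w hw ↦ ⟨hw.1, mem_univ _⟩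
  set P := α.pull f S with hP
  have hPsm : ContDiffOn ℝ ∞ P S := OneForm.contDiffOn_pull hα.smooth hu hfsm
  set DP := fderivWithin ℝ P S with hDP
  have hPd : ∀ q ∈ S, HasFDerivWithinAt P (DP q) S q := fun q hq ↦
    (hPsm.differentiableOn (by simp) q hq).hasFDerivWithinAt
  have hDPc : ContinuousOn DP S := hPsm.continuousOn_fderivWithin hu (by simp)
  -- the derivative of `f` in time
  have hft : ∀ t ∈ Icc (0 : ℝ) 1, ∀ x ∈ O,
      derivOn f S (t, x) (1, 0) = contactVec α (H t) (f (t, x)) := fun t ht x hx ↦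
    (hasVelocityAt_derivOn hfsm ht hx).unique (htraj _ t ht) ht
  have hcv : ∀ t y, α.eval y (contactVec α (H t) y) = H t y ∧
      ∃ μ : ℝ, ∀ v, dscalar (H t) y v + α.dform y (contactVec α (H t) y) v = μ * α.eval y v :=
    fun t y ↦ (isContactHamiltonianVector_iff_exists (H t) y _).1
      ((hα.isContactHamiltonianVector_iff (H t) y _).2 rfl)
  -- the derivative of `f` in space
  have hfx : ∀ t ∈ Icc (0 : ℝ) 1, (derivOn f S (t, x₀)).comp
      (ContinuousLinearMap.inr ℝ ℝ (EuclideanSpace ℝ (Fin 3))) = dmap (ψ t) y := fun t ht ↦ by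
    have h1 := hasMFDerivAt_slice hfsm hO ht hx₀O
    have h2 : MDifferentiableAt (𝓡 3) (𝓡 3) (ψ t) ((extChartAt (𝓡 3) y).symm x₀) := by
      have h3 : ContMDiff (𝓡 3) (𝓡 3) ∞ (ψ t) := by
        rw [← contMDiffOn_univ]
        exact hψ.comp (f := fun y : Y ↦ (t, y)) (contMDiff_const.prodMk contMDiff_id).contMDiffOn
          fun y _ ↦ ⟨ht, mem_univ _⟩
      exact h3.mdifferentiable (by simp) _
    have h3 := h2.hasMFDerivAt.comp x₀ (hasMFDerivAt_chart_symm y hx₀O)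
    have h4 : (derivOn f S (t, x₀)).comp
      (ContinuousLinearMap.inr ℝ ℝ (EuclideanSpace ℝ (Fin 3))) =
        (dmap (ψ t) ((extChartAt (𝓡 3) y).symm x₀)).comp (dchartSymm y x₀) :=
      hasMFDerivAt_unique h1 h3
    have h5 := dchartSymm_comp_dchart y (mem_extChartAt_source (I := 𝓡 3) y)
    rw [dchart_self, ContinuousLinearMap.comp_id] at h5
    rw [h4, hx₀y, h5, ContinuousLinearMap.comp_id]
  set J := ContinuousLinearMap.inr ℝ ℝ (EuclideanSpace ℝ (Fin 3)) with hJ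
  have haP : ∀ t ∈ Icc (0 : ℝ) 1, (P (t, x₀)).comp J = (α.eval (ψ t y)).comp (dmap (ψ t) y) :=
    fun t ht ↦ by
      rw [← hfx t ht, ← ContinuousLinearMap.comp_assoc]
      simp only [hP, OneForm.pull, hf, hx₀y]
  have hkey : ∀ {v}, (P (s, x₀)).comp J v = 0 → (P (t, x₀)).comp J v = 0 := by
    intro v hv
    refine apply_eq_zero_of_hasDerivWithinAt_smul (a := fun t ↦ (P (t, x₀)).comp J)
      (a' := fun t ↦ (DP (t, x₀) (1, 0)).comp J) (fun t ht ↦ ?_) ?_ (fun t ht ↦ ?_)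
      (fun t ht ↦ ?_) hs ht hv
    · have h1 : HasDerivWithinAt (fun t : ℝ ↦ (t, x₀)) ((1 : ℝ), (0 : EuclideanSpace ℝ (Fin 3)))
          (Icc 0 1) t := (hasDerivWithinAt_id t _).prodMk (hasDerivWithinAt_const t _ x₀)
      have h2 := (hPd (t, x₀) ⟨ht, hx₀O⟩).comp_hasDerivWithinAt t h1
        fun s (hs : s ∈ Icc (0 : ℝ) 1) ↦ (⟨hs, hx₀O⟩ : (s, x₀) ∈ S)
      simpa using h2.clm_comp (hasDerivWithinAt_const t (Icc 0 1) J)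
    · have h1 : ContinuousOn (fun t : ℝ ↦ DP (t, x₀)) (Icc 0 1) :=
        hDPc.comp (f := fun t : ℝ ↦ (t, x₀)) (by fun_prop) fun t ht ↦ ⟨ht, hx₀O⟩
      exact (h1.clm_apply continuousOn_const).clm_comp continuousOn_const
    · rw [haP t ht]
      intro h0
      refine hα.eval_ne_zero (ψ t y) ?_
      ext w
      obtain ⟨v, rfl⟩ := hsurj t ht y w
      exact DFunLike.congr_fun h0 v
    · obtain ⟨μ, hμ⟩ := (hcv t (f (t, x₀))).2
      refine ⟨μ, ?_⟩
      ext w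
      have hq : (t, x₀) ∈ S := ⟨ht, hx₀O⟩
      have h1 := OneForm.fderivWithin_pull_sub hα.smooth hu hfsm hq
        (mem_closure_interior_Icc_prod hO ht hx₀O) (1, 0) (J w)
      -- the derivative in space of `α (∂_t f) = H_t ∘ f`
      have h2 : HasFDerivAt (fun x ↦ P (t, x) (1, 0)) (((DP (t, x₀)).flip (1, 0)).comp J) x₀ := by
        have h3 : HasFDerivWithinAt (fun q ↦ P q (1, 0)) ((DP (t, x₀)).flip (1, 0)) S (t, x₀) := by
          simpa using (hPd _ hq).clm_apply (hasFDerivWithinAt_const (1, 0) _ S)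
        exact hasFDerivAt_slice (f := fun t x ↦ P (t, x) (1, 0)) hO ht hx₀O h3
      have h3 : HasFDerivAt (fun x ↦ H t (f (t, x)))
          ((dscalar (H t) (f (t, x₀))).comp ((derivOn f S (t, x₀)).comp J)) x₀ := by
        have h4 : ContMDiff (𝓡 3) 𝓘(ℝ, ℝ) ∞ (H t) := by
          rw [← contMDiffOn_univ]
          exact hH.comp (f := fun y : Y ↦ (t, y)) (contMDiff_const.prodMk contMDiff_id).contMDiffOn
            fun y _ ↦ ⟨ht, mem_univ _⟩
        exact hasMFDerivAt_iff_hasFDerivAt.1 ((h4.mdifferentiable (by simp) _).hasMFDerivAt.comp x₀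
          (hasMFDerivAt_slice hfsm hO ht hx₀O))
      have h4 : (fun x ↦ P (t, x) (1, 0)) =ᶠ[𝓝 x₀] fun x ↦ H t (f (t, x)) := by
        filter_upwards [hO.mem_nhds hx₀O] with x hx
        have h5 : P (t, x) (1, 0) = α.eval (f (t, x)) (derivOn f S (t, x) (1, 0)) := rfl
        rw [h5, hft t ht x hx, (hcv t _).1]
      have h5 := DFunLike.congr_fun (h2.unique (h3.congr_of_eventuallyEq h4)) w
      have h6 : DP (t, x₀) (J w) (1, 0) =
          dscalar (H t) (f (t, x₀)) (derivOn f S (t, x₀) (J w)) := h5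
      have h7 := hμ (derivOn f S (t, x₀) (J w))
      rw [hft t ht x₀ hx₀O] at h1
      change DP (t, x₀) (1, 0) (J w) - DP (t, x₀) (J w) (1, 0) = _ at h1
      change DP (t, x₀) (1, 0) (J w) = μ * α.eval (f (t, x₀)) (derivOn f S (t, x₀) (J w))
      linarith
  have := @hkey v
  rw [haP s hs, haP t ht] at this
  exact this hv

/-- A contact Hamiltonian whose contact vector field has compact support generates a contact
isotopy. -/
theorem IsContactForm.exists_contactIsotopy [T2Space Y] (hα : IsContactForm α)
    (hH : ContMDiffOn (𝓘(ℝ, ℝ).prod (𝓡 3)) 𝓘(ℝ, ℝ) ∞ (fun z : ℝ × Y ↦ H z.1 z.2)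
      (Icc 0 1 ×ˢ univ)) {K : Set Y} (hK : IsCompact K)
    (hHK : ∀ t ∈ Icc (0 : ℝ) 1, ∀ y ∉ K, contactVec α (H t) y = 0) :
    ∃ ψ : ℝ → Diffeomorph (𝓡 3) (𝓡 3) Y Y ∞, IsContactIsotopy α ψ ∧
      IsGeneratedBy α (fun t ↦ ψ t) H ∧
      ∀ y, IsTrajectoryOn (fun t ↦ contactVec α (H t)) (fun t ↦ ψ t y) (Icc 0 1) := by
  have hX : IsSmoothField (fun t ↦ contactVec α (H t)) := hα.contDiffOn_dchart_contactVec hH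
  obtain ⟨Φ, hΦs, hΦt, hΦ⟩ := hX.exists_flow hK hHK
  have h0 : (0 : ℝ) ∈ Icc (0 : ℝ) 1 := left_mem_Icc.2 zero_le_one
  have hcocycle : ∀ s ∈ Icc (0 : ℝ) 1, ∀ u ∈ Icc (0 : ℝ) 1, ∀ t ∈ Icc (0 : ℝ) 1, ∀ y,
      Φ u t (Φ s u y) = Φ s t y := fun s hs u hu t ht y ↦
    (hΦt u hu (Φ s u y)).eqOn hX isPreconnected_Icc subset_rfl (hΦt s hs y) hu
      (hΦs u hu _) ht
  have hsm : ∀ s ∈ Icc (0 : ℝ) 1, ∀ t ∈ Icc (0 : ℝ) 1, ContMDiff (𝓡 3) (𝓡 3) ∞ (Φ s t) :=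
    fun s hs t ht ↦ by
      rw [← contMDiffOn_univ]
      exact (hΦ s hs).comp (f := fun y : Y ↦ (t, y))
        (contMDiff_const.prodMk contMDiff_id).contMDiffOn fun y _ ↦ ⟨ht, mem_univ _⟩
  classical
  let ψ : ℝ → Diffeomorph (𝓡 3) (𝓡 3) Y Y ∞ := fun t ↦
    if ht : t ∈ Icc (0 : ℝ) 1 then
      { toFun := Φ 0 t
        invFun := Φ t 0
        left_inv := fun y ↦ by rw [hcocycle 0 h0 t ht 0 h0, hΦs 0 h0]
        right_inv := fun y ↦ by rw [hcocycle t ht 0 h0 t ht, hΦs t ht]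
        contMDiff_toFun := hsm 0 h0 t ht
        contMDiff_invFun := hsm t ht 0 h0 }
    else Diffeomorph.refl _ _ _
  have hψ : ∀ t ∈ Icc (0 : ℝ) 1, ∀ y, ψ t y = Φ 0 t y := fun t ht y ↦ by
    simp only [ψ, dif_pos ht]
    rfl
  have hψsm : ContMDiffOn (𝓘(ℝ, ℝ).prod (𝓡 3)) (𝓡 3) ∞ (fun z : ℝ × Y ↦ ψ z.1 z.2)
      (Icc 0 1 ×ˢ univ) := (hΦ 0 h0).congr fun z hz ↦ hψ z.1 hz.1 z.2
  have hψt : ∀ y, IsTrajectoryOn (fun t ↦ contactVec α (H t)) (fun t ↦ ψ t y) (Icc 0 1) :=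
    fun y t ht ↦ by
      have h1 : HasVelocityAt (fun t ↦ Φ 0 t y) (contactVec α (H t) (Φ 0 t y)) t :=
        hΦt 0 h0 y t ht
      change HasVelocityAt (fun t ↦ ψ t y) (contactVec α (H t) (ψ t y)) t
      rw [hψ t ht y]
      refine h1.congr ?_ (hψ t ht y)
      filter_upwards [self_mem_nhdsWithin] with s hs
      exact hψ s hs y
  have hbij : ∀ t, ∀ y, Surjective (dmap (ψ t) y) := fun t y v ↦ by
    obtain ⟨w, hw⟩ := ((ψ t).mfderivToContinuousLinearEquiv (by simp) y).surjective v
    exact ⟨w, hw⟩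
  refine ⟨ψ, ⟨hψsm, fun y ↦ by rw [hψ 0 h0, hΦs 0 h0], fun t ht y ↦ ?_⟩,
    ⟨hH, fun t ht y ↦ ?_⟩, hψt⟩
  · have hd0 : dmap (ψ 0) y = ContinuousLinearMap.id ℝ _ := by
      have : (ψ 0 : Y → Y) = id := funext fun y ↦ by rw [hψ 0 h0, hΦs 0 h0]; rfl
      rw [dmap, this]
      exact mfderiv_id
    have hy0 : ψ 0 y = y := by rw [hψ 0 h0, hΦs 0 h0]
    have hiff : ∀ v, α.eval y v = 0 ↔ α.eval (ψ t y) (dmap (ψ t) y v) = 0 := fun v ↦ by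
      have h1 := fun {s t : ℝ} (hs : s ∈ Icc (0 : ℝ) 1) (ht : t ∈ Icc (0 : ℝ) 1) ↦
        @IsContactForm.eval_dmap_eq_zero Y _ _ _ α H (fun t ↦ ψ t) hα hH hψsm hψt
          (fun t _ y ↦ hbij t y) s t hs ht y v
      constructor
      · intro hv
        refine h1 h0 ht ?_
        rw [hd0, hy0]
        exact hv
      · intro hv
        have h2 := h1 ht h0 hv
        rw [hd0, hy0] at h2
        exact h2
    ext v
    constructor
    · rintro ⟨w, hw, rfl⟩
      exact (hiff w).1 hw
    · intro hv
      obtain ⟨w, hw⟩ := hbij t y v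
      refine ⟨w, (hiff w).2 ?_, hw⟩
      rw [hw]
      exact hv
  · exact (hα.isContactHamiltonianVector_iff _ _ _).2
      ((hψt y t ht).velocity_eq (ψ := fun t ↦ ψ t) ht)

end ContactIsotopy

/-! ### Local contact Hamiltonians along a moving surface -/

theorem eq_zero_of_frequently_eq_zero {E : Type*} [TopologicalSpace E] {d : E → ℝ} {z : E}
    (hd : ContinuousAt d z) (h : ∃ᶠ w in 𝓝 z, d w = 0) : d z = 0 := by
  by_contra h0
  exact h (hd.eventually_ne h0)

theorem isInvertible_of_injective {E F : Type*} [NormedAddCommGroup E] [NormedSpace ℝ E]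
    [NormedAddCommGroup F] [NormedSpace ℝ F] [FiniteDimensional ℝ E] [FiniteDimensional ℝ F]
    {L : E →L[ℝ] F} (hL : Injective L) (h : Module.finrank ℝ E = Module.finrank ℝ F) :
    L.IsInvertible := by
  refine ⟨(LinearMap.linearEquivOfInjective L.toLinearMap hL h).toContinuousLinearEquiv, ?_⟩
  ext w
  rfl

section LocalHamiltonian

variable {Y : Type*} [TopologicalSpace Y] [ChartedSpace (EuclideanSpace ℝ (Fin 3)) Y]
  [IsManifold (𝓡 3) ∞ Y] {α : OneForm Y}

/-- A family of surfaces `z ↦ F (t, (z, 0))` with constant characteristic foliation moves, to first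
order along the surfaces, by the contact vector field of a locally defined contact Hamiltonian: in
the coordinates `(z, s)` given by `F`, it is an affine function of `s`. It vanishes over the set
`V` on which `F` does not depend on time. The bound `|s| ≤ 1` confines it to a compact part of
the thickening. -/
theorem IsContactForm.exists_local_hamiltonian (hα : IsContactForm α)
    {O : Set (EuclideanSpace ℝ (Fin 2) × ℝ)} (hO : IsOpen O)
    {F : ℝ × (EuclideanSpace ℝ (Fin 2) × ℝ) → Y}
    (hF : ContMDiffOn 𝓘(ℝ, ℝ × (EuclideanSpace ℝ (Fin 2) × ℝ)) (𝓡 3) ∞ F (Icc 0 1 ×ˢ O))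
    {y₀ : Y} (hFs : ∀ q ∈ Icc (0 : ℝ) 1 ×ˢ O, F q ∈ (extChartAt (𝓡 3) y₀).source)
    {V : Set (EuclideanSpace ℝ (Fin 2))} (hV : IsOpen V) {t₀ : ℝ} (ht₀ : t₀ ∈ Icc (0 : ℝ) 1)
    {z₀ : EuclideanSpace ℝ (Fin 2)} (hz₀ : (z₀, (0 : ℝ)) ∈ O)
    (hinj : Injective ((derivOn (E := EuclideanSpace ℝ (Fin 3)) F (Icc 0 1 ×ˢ O)
      (t₀, (z₀, 0))).comp (ContinuousLinearMap.inr ℝ ℝ (EuclideanSpace ℝ (Fin 2) × ℝ))))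
    (hchar : ∀ t ∈ Icc (0 : ℝ) 1, ∀ z, (z, (0 : ℝ)) ∈ O → ∀ w : EuclideanSpace ℝ (Fin 2),
      α.pull F (Icc 0 1 ×ˢ O) (t₀, (z, 0)) (0, (w, 0)) = 0 →
        α.pull F (Icc 0 1 ×ˢ O) (t, (z, 0)) (0, (w, 0)) = 0)
    (hFV : ∀ t ∈ Icc (0 : ℝ) 1, ∀ x ∈ O, x.1 ∈ V → F (t, x) = F (t₀, x)) :
    ∃ (N : Set (ℝ × Y)) (W : Set (EuclideanSpace ℝ (Fin 2) × ℝ)) (H : ℝ → Y → ℝ), IsOpen N ∧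
      (t₀, F (t₀, (z₀, 0))) ∈ N ∧ IsOpen W ∧ (z₀, 0) ∈ W ∧ W ⊆ O ∧
      ContMDiffOn (𝓘(ℝ, ℝ).prod (𝓡 3)) 𝓘(ℝ, ℝ) ∞ (fun q : ℝ × Y ↦ H q.1 q.2)
        (N ∩ Icc 0 1 ×ˢ univ) ∧
      (∀ t ∈ Icc (0 : ℝ) 1, ∀ z, (z, (0 : ℝ)) ∈ W → (t, F (t, (z, 0))) ∈ N →
        IsContactHamiltonianVector α (H t) (F (t, (z, 0)))
          (derivOn (E := EuclideanSpace ℝ (Fin 3)) F (Icc 0 1 ×ˢ O) (t, (z, 0)) (1, 0))) ∧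
      ∀ t ∈ Icc (0 : ℝ) 1, ∀ y, (t, y) ∈ N → H t y ≠ 0 →
        ∃ x ∈ O, x.1 ∉ V ∧ |x.2| ≤ 1 ∧ F (t, x) = y := by
  set S := Icc (0 : ℝ) 1 ×ˢ O with hS
  have hu : UniqueDiffOn ℝ S := (uniqueDiffOn_Icc zero_lt_one).prod hO.uniqueDiffOn
  set P := α.pull F S with hP
  have hPsm : ContDiffOn ℝ ∞ P S := OneForm.contDiffOn_pull hα.smooth hu hF
  set DP := fderivWithin ℝ P S with hDP
  have hDPsm : ContDiffOn ℝ ∞ DP S := hPsm.fderivWithin hu (by simp)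
  have hPd : ∀ q ∈ S, HasFDerivWithinAt P (DP q) S q := fun q hq ↦
    (hPsm.differentiableOn (by simp) q hq).hasFDerivWithinAt
  set J := ContinuousLinearMap.inr ℝ ℝ (EuclideanSpace ℝ (Fin 2) × ℝ) with hJ
  set D : ℝ × (EuclideanSpace ℝ (Fin 2) × ℝ) → ℝ × (EuclideanSpace ℝ (Fin 2) × ℝ) →L[ℝ]
    EuclideanSpace ℝ (Fin 3) := derivOn F S with hD
  have hPx : ∀ t ∈ Icc (0 : ℝ) 1, ∀ x ∈ O, ∀ ξ,
      HasFDerivAt (fun x ↦ P (t, x) ξ) (((DP (t, x)).flip ξ).comp J) x := fun t ht x hx ξ ↦ by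
    have h3 : HasFDerivWithinAt (fun q ↦ P q ξ) ((DP (t, x)).flip ξ) S (t, x) := by
      simpa using (hPd _ ⟨ht, hx⟩).clm_apply (hasFDerivWithinAt_const ξ _ S)
    exact hasFDerivAt_slice (f := fun t x ↦ P (t, x) ξ) hO ht hx h3
  have hdα : ∀ t ∈ Icc (0 : ℝ) 1, ∀ x ∈ O, ∀ ξ η, DP (t, x) ξ η - DP (t, x) η ξ =
      α.dform (F (t, x)) (D (t, x) ξ) (D (t, x) η) := fun t ht x hx ξ η ↦
    OneForm.fderivWithin_pull_sub hα.smooth hu hF ⟨ht, hx⟩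
      (mem_closure_interior_Icc_prod hO ht hx) ξ η
  -- over `V` nothing depends on time
  have hDV : ∀ t ∈ Icc (0 : ℝ) 1, ∀ x ∈ O, x.1 ∈ V → D (t, x) (1, 0) = 0 :=
    fun t ht x hx hxV ↦ by
      refine (hasVelocityAt_derivOn hF ht hx).unique ((hasVelocityAt_const (F (t₀, x)) t).congr ?_
        (hFV t ht x hx hxV)) ht
      filter_upwards [self_mem_nhdsWithin] with s hs
      exact hFV s hs x hx hxV
  have hPV : ∀ t ∈ Icc (0 : ℝ) 1, ∀ x ∈ O, x.1 ∈ V → ∀ v, P (t, x) (0, v) = P (t₀, x) (0, v) :=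
    fun t ht x hx hxV v ↦ by
      have h1 : (D (t, x)).comp J = (D (t₀, x)).comp J := by
        refine hasMFDerivAt_unique (hasMFDerivAt_slice hF hO ht hx)
          ((hasMFDerivAt_slice hF hO ht₀ hx).congr_of_eventuallyEq ?_)
        filter_upwards [hO.mem_nhds hx, (hV.preimage continuous_fst).mem_nhds hxV] with x' hx' hxV'
        exact hFV t ht x' hx' hxV'
      have h2 : D (t, x) (0, v) = D (t₀, x) (0, v) := DFunLike.congr_fun h1 v
      change α.eval (F (t, x)) (D (t, x) (0, v)) = α.eval (F (t₀, x)) (D (t₀, x) (0, v))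
      rw [h2, hFV t ht x hx hxV]
  -- the restriction of `P` to the surfaces
  set O₂ : Set (EuclideanSpace ℝ (Fin 2)) := (fun z ↦ (z, (0 : ℝ))) ⁻¹' O with hO₂
  have hO₂o : IsOpen O₂ := hO.preimage (by fun_prop)
  set β : ℝ → EuclideanSpace ℝ (Fin 2) → EuclideanSpace ℝ (Fin 2) → ℝ :=
    fun t z w ↦ P (t, (z, 0)) (0, (w, 0)) with hβ
  have hemb : ContDiff ℝ ∞ (fun q : ℝ × EuclideanSpace ℝ (Fin 2) ↦ (q.1, (q.2, (0 : ℝ)))) := by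
    fun_prop
  have hβsm : ∀ w, ContDiffOn ℝ ∞ (uncurry fun t z ↦ β t z w) (Icc 0 1 ×ˢ O₂) := fun w ↦
    (hPsm.comp hemb.contDiffOn fun q hq ↦ hq).clm_apply contDiffOn_const
  have hβc : ∀ t ∈ Icc (0 : ℝ) 1, ∀ w, ContinuousOn (fun z ↦ β t z w) O₂ := fun t ht w ↦
    (hβsm w).continuousOn.comp (f := fun z ↦ (t, z)) (by fun_prop) fun z hz ↦ ⟨ht, hz⟩
  have hβadd : ∀ t z w w' (c : ℝ), β t z (w - c • w') = β t z w - c * β t z w' :=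
    fun t z w w' c ↦ by
      have : ((0 : ℝ), ((w - c • w', 0) : EuclideanSpace ℝ (Fin 2) × ℝ)) =
          (0, (w, 0)) - c • (0, (w', 0)) := by simp
      simp only [hβ]
      rw [this, map_sub, map_smul, smul_eq_mul]
  have hβd : ∀ t ∈ Icc (0 : ℝ) 1, ∀ z ∈ O₂, ∀ ξ,
      HasFDerivAt (fun z ↦ P (t, (z, 0)) ξ) ((((DP (t, (z, 0))).flip ξ).comp J).comp
        (ContinuousLinearMap.inl ℝ (EuclideanSpace ℝ (Fin 2)) ℝ)) z := fun t ht z hz ξ ↦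
    HasFDerivAt.comp (g := fun x ↦ P (t, x) ξ) z (hPx t ht (z, 0) hz ξ)
      (ContinuousLinearMap.inl ℝ (EuclideanSpace ℝ (Fin 2)) ℝ).hasFDerivAt
  -- a direction in which the characteristic form has no degenerate zero: where the form vanishes,
  -- the surface is tangent to the contact plane, so its exterior derivative does not vanish
  obtain ⟨e, he⟩ : ∃ e, β t₀ z₀ e ≠ 0 ∨ fderiv ℝ (fun z ↦ β t₀ z e) z₀ ≠ 0 := by
    by_cases h0 : ∃ e, β t₀ z₀ e ≠ 0
    · exact h0.imp fun e he ↦ Or.inl he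
    push Not at h0
    set L := ((D (t₀, (z₀, 0))).comp J).comp
      (ContinuousLinearMap.inl ℝ (EuclideanSpace ℝ (Fin 2)) ℝ) with hL
    have hLinj : Injective L := hinj.comp fun a b hab ↦ congrArg Prod.fst hab
    obtain ⟨w, w', hww⟩ := (hα.isContactPair (F (t₀, (z₀, 0)))).exists_ne_zero_of_injective
      (by simp) (by simp) hLinj h0
    have h1 := hdα t₀ ht₀ (z₀, 0) hz₀ (0, (w, 0)) (0, (w', 0))
    have h2 : DP (t₀, (z₀, 0)) (0, (w, 0)) (0, (w', 0)) ≠ 0 ∨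
        DP (t₀, (z₀, 0)) (0, (w', 0)) (0, (w, 0)) ≠ 0 := by
      by_contra! h3
      rw [h3.1, h3.2, sub_zero] at h1
      exact hww h1.symm
    have h3 : ∀ w w', DP (t₀, (z₀, 0)) (0, (w, 0)) (0, (w', 0)) ≠ 0 →
        fderiv ℝ (fun z ↦ β t₀ z w') z₀ ≠ 0 := fun w w' h h4 ↦ by
      rw [(hβd t₀ ht₀ z₀ hz₀ (0, (w', 0))).fderiv] at h4
      exact h (DFunLike.congr_fun h4 w)
    rcases h2 with h2 | h2
    · exact ⟨w', Or.inr (h3 w w' h2)⟩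
    · exact ⟨w, Or.inr (h3 w' w h2)⟩
  have husm : ContDiffOn ℝ ∞ (fun z ↦ β t₀ z e) O₂ :=
    (hβsm e).comp (f := fun z ↦ (t₀, z)) (by fun_prop) fun z hz ↦ ⟨ht₀, hz⟩
  obtain ⟨O', hO', hz₀', hO'sub, hdense, hdiv⟩ := exists_smooth_division hO₂o hz₀ husm he
  obtain ⟨g, hg, hgu⟩ := hdiv (fun t z ↦ β t z e) (hβsm e) fun t ht z hz h ↦ hchar t ht z hz e h
  have hgc : ∀ t ∈ Icc (0 : ℝ) 1, ContinuousOn (g t) O' := fun t ht ↦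
    hg.continuousOn.comp (f := fun z ↦ (t, z)) (by fun_prop) fun z hz ↦ ⟨ht, hz⟩
  -- the characteristic forms at different times are proportional: where `β t₀ z e ≠ 0`, this
  -- follows from the inclusion of kernels, and such points are dense
  have hgβ : ∀ t ∈ Icc (0 : ℝ) 1, ∀ z ∈ O', ∀ w, β t z w = g t z * β t₀ z w :=
    fun t ht z hz w ↦ by
      have hc : ContinuousAt (fun z ↦ β t z w - g t z * β t₀ z w) z :=
        (((hβc t ht w).continuousAt (hO₂o.mem_nhds (hO'sub hz))).sub
          (((hgc t ht).continuousAt (hO'.mem_nhds hz)).mul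
            ((hβc t₀ ht₀ w).continuousAt (hO₂o.mem_nhds (hO'sub hz)))) :)
      refine sub_eq_zero.1 (eq_zero_of_frequently_eq_zero
        (d := fun z ↦ β t z w - g t z * β t₀ z w) hc ?_)
      refine ((hdense z hz).and_eventually (hO'.mem_nhds hz)).mono ?_
      rintro z' ⟨hz', hzO'⟩
      have h1 := hchar t ht z' (hO'sub hzO') (w - (β t₀ z' w / β t₀ z' e) • e)
      have h2 := h1 (by
        change β t₀ z' (w - (β t₀ z' w / β t₀ z' e) • e) = 0
        rw [hβadd, div_mul_cancel₀ _ hz', sub_self])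
      change β t z' (w - (β t₀ z' w / β t₀ z' e) • e) = 0 at h2
      have h3 : β t z' e = g t z' * β t₀ z' e := hgu t ht z' hzO'
      rw [hβadd, h3] at h2
      field_simp at h2
      linarith
  have hg1 : ∀ z ∈ O', g t₀ z = 1 := fun z hz ↦ by
    refine sub_eq_zero.1 (eq_zero_of_frequently_eq_zero (d := fun z ↦ g t₀ z - 1)
      (((hgc t₀ ht₀).continuousAt (hO'.mem_nhds hz)).sub continuousAt_const) ?_)
    refine ((hdense z hz).and_eventually (hO'.mem_nhds hz)).mono ?_
    rintro z' ⟨hz', hzO'⟩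
    have h3 : β t₀ z' e = g t₀ z' * β t₀ z' e := hgu t₀ ht₀ z' hzO'
    have h4 : (g t₀ z' - 1) * β t₀ z' e = 0 := by linarith
    exact (mul_eq_zero.1 h4).resolve_right hz'
  have hgV : ∀ t ∈ Icc (0 : ℝ) 1, ∀ z ∈ O', z ∈ V → g t z = 1 := fun t ht z hz hzV ↦ by
    refine sub_eq_zero.1 (eq_zero_of_frequently_eq_zero (d := fun z ↦ g t z - 1)
      (((hgc t ht).continuousAt (hO'.mem_nhds hz)).sub continuousAt_const) ?_)
    refine ((hdense z hz).and_eventually ((hO'.inter hV).mem_nhds ⟨hz, hzV⟩)).mono ?_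
    rintro z' ⟨hz', hzO', hzV'⟩
    have h3 : β t z' e = g t z' * β t₀ z' e := hgu t ht z' hzO'
    have h5 : β t z' e = β t₀ z' e := hPV t ht (z', 0) (hO'sub hzO') hzV' (e, 0)
    have h4 : (g t z' - 1) * β t₀ z' e = 0 := by linarith
    exact (mul_eq_zero.1 h4).resolve_right hz'
  -- the time derivative of the factor of proportionality
  have hu' : UniqueDiffOn ℝ (Icc (0 : ℝ) 1 ×ˢ O') :=
    (uniqueDiffOn_Icc zero_lt_one).prod hO'.uniqueDiffOn
  set gt : ℝ × EuclideanSpace ℝ (Fin 2) → ℝ :=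
    fun q ↦ fderivWithin ℝ (uncurry g) (Icc (0 : ℝ) 1 ×ˢ O') q (1, 0) with hgt
  have hgtsm : ContDiffOn ℝ ∞ gt (Icc 0 1 ×ˢ O') :=
    (hg.fderivWithin hu' (by simp)).clm_apply contDiffOn_const
  have hgd : ∀ t ∈ Icc (0 : ℝ) 1, ∀ z ∈ O', HasDerivWithinAt (g · z) (gt (t, z)) (Icc 0 1) t :=
    fun t ht z hz ↦ by
      have h1 : HasDerivWithinAt (fun t : ℝ ↦ (t, z)) ((1 : ℝ), (0 : EuclideanSpace ℝ (Fin 2)))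
          (Icc 0 1) t := (hasDerivWithinAt_id t _).prodMk (hasDerivWithinAt_const t _ z)
      exact (hg.differentiableOn (by simp) (t, z) ⟨ht, hz⟩).hasFDerivWithinAt.comp_hasDerivWithinAt
        t h1 fun s (hs : s ∈ Icc (0 : ℝ) 1) ↦ (⟨hs, hz⟩ : (s, z) ∈ Icc (0 : ℝ) 1 ×ˢ O')
  have hgtV : ∀ t ∈ Icc (0 : ℝ) 1, ∀ z ∈ O', z ∈ V → gt (t, z) = 0 := fun t ht z hz hzV ↦
    ((uniqueDiffOn_Icc zero_lt_one) t ht).eq_deriv _ (hgd t ht z hz)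
      ((hasDerivWithinAt_const t (Icc 0 1) (1 : ℝ)).congr (fun s hs ↦ hgV s hs z hz hzV)
        (hgV t ht z hz hzV))
  have hβt : ∀ t ∈ Icc (0 : ℝ) 1, ∀ z ∈ O', ∀ w,
      DP (t, (z, 0)) (1, 0) (0, (w, 0)) = gt (t, z) * β t₀ z w := fun t ht z hz w ↦ by
    have h1 : HasDerivWithinAt (fun t : ℝ ↦ (t, (z, (0 : ℝ)))) ((1 : ℝ), 0)
        (Icc 0 1) t := (hasDerivWithinAt_id t _).prodMk (hasDerivWithinAt_const t _ (z, (0 : ℝ)))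
    have h2 := (hPd (t, (z, 0)) ⟨ht, hO'sub hz⟩).comp_hasDerivWithinAt t h1
      fun s (hs : s ∈ Icc (0 : ℝ) 1) ↦ (⟨hs, hO'sub hz⟩ : (s, (z, (0 : ℝ))) ∈ S)
    have h3 := h2.clm_apply (hasDerivWithinAt_const t (Icc 0 1) ((0 : ℝ), (w, (0 : ℝ))))
    rw [map_zero, add_zero] at h3
    exact ((uniqueDiffOn_Icc zero_lt_one) t ht).eq_deriv _ h3
      (((hgd t ht z hz).mul_const (β t₀ z w)).congr (fun s hs ↦ hgβ s hs z hz w)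
        (hgβ t ht z hz w))
  -- a neighbourhood on which the factor does not vanish
  obtain ⟨δ, hδ, hgδ⟩ : ∃ δ > 0, ∀ t ∈ Icc (0 : ℝ) 1 ∩ Metric.ball t₀ δ,
      ∀ z ∈ O' ∩ Metric.ball z₀ δ, g t z ≠ 0 := by
    have h1 : ∀ᶠ q in 𝓝[Icc (0 : ℝ) 1 ×ˢ O'] (t₀, z₀), uncurry g q ≠ 0 :=
      (hg.continuousOn (t₀, z₀) ⟨ht₀, hz₀'⟩).eventually_ne (by
        rw [uncurry_apply_pair, hg1 z₀ hz₀']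
        exact one_ne_zero)
    obtain ⟨δ, hδ, h2⟩ := Metric.mem_nhdsWithin_iff.1 h1
    refine ⟨δ, hδ, fun t ht z hz ↦ ?_⟩
    refine @h2 (t, z) ⟨?_, ht.1, hz.1⟩
    rw [← ball_prod_same]
    exact ⟨ht.2, hz.2⟩
  set O₄ := O' ∩ Metric.ball z₀ δ with hO₄
  have hO₄o : IsOpen O₄ := hO'.inter Metric.isOpen_ball
  -- the Hamiltonian in the coordinates given by `F`: the slope `κ` in the direction `s` is the one
  -- that `dH + ι_X dα = μ α` with `μ = gt / g` prescribes
  set κ : ℝ × (EuclideanSpace ℝ (Fin 2) × ℝ) → ℝ := fun q ↦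
    gt (q.1, q.2.1) / g q.1 q.2.1 * P (q.1, (q.2.1, 0)) (0, (0, 1)) -
      (DP (q.1, (q.2.1, 0)) (1, 0) (0, (0, 1)) - DP (q.1, (q.2.1, 0)) (0, (0, 1)) (1, 0)) with hκ
  set hk : ℝ × (EuclideanSpace ℝ (Fin 2) × ℝ) → ℝ := fun q ↦
    P (q.1, (q.2.1, 0)) (1, 0) + q.2.2 * κ q with hhk
  set Q : Set (ℝ × (EuclideanSpace ℝ (Fin 2) × ℝ)) :=
    (Icc (0 : ℝ) 1 ∩ Metric.ball t₀ δ) ×ˢ (O₄ ×ˢ univ) with hQ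
  have hhksm : ContDiffOn ℝ ∞ hk Q := by
    have hproj : ContDiff ℝ ∞ (fun q : ℝ × (EuclideanSpace ℝ (Fin 2) × ℝ) ↦ (q.1, q.2.1)) := by
      fun_prop
    have hproj' : ContDiff ℝ ∞
        (fun q : ℝ × (EuclideanSpace ℝ (Fin 2) × ℝ) ↦ (q.1, (q.2.1, (0 : ℝ)))) := by
      fun_prop
    have m1 : MapsTo (fun q : ℝ × (EuclideanSpace ℝ (Fin 2) × ℝ) ↦ (q.1, q.2.1)) Q
        (Icc 0 1 ×ˢ O') := fun q hq ↦ ⟨hq.1.1, hq.2.1.1⟩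
    have m2 : MapsTo (fun q : ℝ × (EuclideanSpace ℝ (Fin 2) × ℝ) ↦ (q.1, (q.2.1, (0 : ℝ)))) Q S :=
      fun q hq ↦ ⟨hq.1.1, hO'sub hq.2.1.1⟩
    have c1 := hPsm.comp hproj'.contDiffOn m2
    have c2 := hDPsm.comp hproj'.contDiffOn m2
    have c3 := (hgtsm.comp hproj.contDiffOn m1).div (hg.comp hproj.contDiffOn m1)
      fun q hq ↦ hgδ q.1 hq.1 q.2.1 hq.2.1
    exact (c1.clm_apply contDiffOn_const).add (contDiffOn_snd.snd.mul
      ((c3.mul (c1.clm_apply contDiffOn_const)).sub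
        (((c2.clm_apply contDiffOn_const).clm_apply contDiffOn_const).sub
          ((c2.clm_apply contDiffOn_const).clm_apply contDiffOn_const))))
  have hhkV : ∀ t ∈ Icc (0 : ℝ) 1, ∀ x : EuclideanSpace ℝ (Fin 2) × ℝ, x.1 ∈ O₄ → x.1 ∈ V →
      hk (t, x) = 0 := fun t ht x hx hxV ↦ by
    have h1 : P (t, (x.1, 0)) (1, 0) = 0 := by
      change α.eval (F (t, (x.1, 0))) (D (t, (x.1, 0)) (1, 0)) = 0
      rw [hDV t ht (x.1, 0) (hO'sub hx.1) hxV, map_zero]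
    have h2 := hdα t ht (x.1, 0) (hO'sub hx.1) (1, 0) (0, (0, 1))
    rw [hDV t ht (x.1, 0) (hO'sub hx.1) hxV, map_zero, zero_apply] at h2
    simp only [hhk, hκ]
    rw [h1, h2, hgtV t ht x.1 hx.1 hxV]
    simp
  -- inverting `F`
  set f : ℝ → EuclideanSpace ℝ (Fin 2) × ℝ → EuclideanSpace ℝ (Fin 3) :=
    fun t x ↦ extChartAt (𝓡 3) y₀ (F (t, x)) with hf
  set O₃ : Set (EuclideanSpace ℝ (Fin 2) × ℝ) := O ∩ (O₄ ×ˢ Metric.ball 0 1) with hO₃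
  have hO₃o : IsOpen O₃ := hO.inter (hO₄o.prod Metric.isOpen_ball)
  have hz₀₃ : (z₀, (0 : ℝ)) ∈ O₃ :=
    ⟨hz₀, ⟨hz₀', Metric.mem_ball_self hδ⟩, Metric.mem_ball_self one_pos⟩
  have hfsm : ContDiffOn ℝ ∞ (uncurry f) (Icc 0 1 ×ˢ O₃) :=
    (contDiffOn_chart_comp hF y₀).mono fun q hq ↦
      ⟨⟨hq.1, hq.2.1⟩, hFs q ⟨hq.1, hq.2.1⟩⟩
  have hfd : ∀ t ∈ Icc (0 : ℝ) 1, ∀ x ∈ O,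
      HasFDerivAt (f t) ((dchart y₀ (F (t, x))).comp ((D (t, x)).comp J)) x := fun t ht x hx ↦ by
    have h1 := (hasMFDerivAt_chart y₀ (hFs (t, x) ⟨ht, hx⟩)).comp x
      (hasMFDerivAt_slice hF hO ht hx)
    exact hasMFDerivAt_iff_hasFDerivAt.1 h1
  have hfin : Module.finrank ℝ (EuclideanSpace ℝ (Fin 2) × ℝ) =
      Module.finrank ℝ (EuclideanSpace ℝ (Fin 3)) := by simp
  have hinv : (fderiv ℝ (f t₀) (z₀, 0)).IsInvertible := by
    rw [(hfd t₀ ht₀ (z₀, 0) hz₀).fderiv]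
    refine isInvertible_of_injective ?_ hfin
    refine Injective.comp (g := dchart y₀ (F (t₀, (z₀, 0)))) ?_ hinj
    exact LeftInverse.injective (g := dchartSymm y₀ (extChartAt (𝓡 3) y₀ (F (t₀, (z₀, 0)))))
      (dchartSymm_dchart y₀ (hFs _ ⟨ht₀, hz₀⟩))
  obtain ⟨N, W, G, hN, hN₀, hW, hW₀, hWO, hG, hGf, hfG⟩ :=
    exists_inverse_family hO₃o hfsm ht₀ hz₀₃ hinv
  set NY : Set (ℝ × Y) := (univ ×ˢ (extChartAt (𝓡 3) y₀).source ∩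
    (fun q : ℝ × Y ↦ (q.1, extChartAt (𝓡 3) y₀ q.2)) ⁻¹' N) ∩ Metric.ball t₀ δ ×ˢ univ with hNY
  have hNYo : IsOpen NY := by
    refine IsOpen.inter ?_ (Metric.isOpen_ball.prod isOpen_univ)
    refine ContinuousOn.isOpen_inter_preimage ?_
      (isOpen_univ.prod (isOpen_extChartAt_source y₀)) hN
    exact continuousOn_fst.prodMk
      ((continuousOn_extChartAt y₀).comp continuousOn_snd fun q hq ↦ hq.2)
  set H : ℝ → Y → ℝ := fun t y ↦ hk (t, G t (extChartAt (𝓡 3) y₀ y)) with hH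
  have hHsm : ContMDiffOn (𝓘(ℝ, ℝ).prod (𝓡 3)) 𝓘(ℝ, ℝ) ∞ (fun q : ℝ × Y ↦ H q.1 q.2)
      (NY ∩ Icc 0 1 ×ˢ univ) := by
    have h1 : ContDiffOn ℝ ∞ (fun q : ℝ × EuclideanSpace ℝ (Fin 3) ↦ hk (q.1, uncurry G q))
        ((N ∩ Icc 0 1 ×ˢ univ) ∩ Metric.ball t₀ δ ×ˢ univ) := by
      refine hhksm.comp (contDiffOn_fst.prodMk (hG.mono inter_subset_left)) ?_
      rintro ⟨t, c⟩ ⟨⟨hc, ht, -⟩, htδ, -⟩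
      exact ⟨⟨ht, htδ⟩, (hWO (hGf t ht c hc).1).2.1, mem_univ _⟩
    have h2 : ContMDiffOn (𝓘(ℝ, ℝ).prod (𝓡 3)) 𝓘(ℝ, ℝ × EuclideanSpace ℝ (Fin 3)) ∞
        (fun q : ℝ × Y ↦ (q.1, extChartAt (𝓡 3) y₀ q.2)) (NY ∩ Icc 0 1 ×ˢ univ) := by
      refine contMDiffOn_fst.prodMk_space ?_
      refine (contMDiffOn_extChartAt (I := 𝓡 3) (n := ∞) (x := y₀)).comp contMDiffOn_snd ?_
      rintro q ⟨⟨⟨hq, -⟩, -⟩, -⟩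
      have := hq.2
      rwa [extChartAt_source] at this
    refine h1.contMDiffOn.comp h2 ?_
    rintro ⟨t, y⟩ ⟨⟨⟨-, hq⟩, hqδ⟩, hqI⟩
    exact ⟨⟨hq, hqI.1, mem_univ _⟩, hqδ.1, mem_univ _⟩
  refine ⟨NY, W, H, hNYo, ⟨⟨⟨mem_univ _, hFs _ ⟨ht₀, hz₀⟩⟩, hN₀⟩, Metric.mem_ball_self hδ,
    mem_univ _⟩, hW, hW₀, hWO.trans inter_subset_left, hHsm, fun t ht z hz hzN ↦ ?_,
    fun t ht y hy hHy ↦ ?_⟩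
  · have htδ : t ∈ Metric.ball t₀ δ := hzN.2.1
    have hzO : (z, (0 : ℝ)) ∈ O := (hWO hz).1
    have hz₄ : z ∈ O₄ := (hWO hz).2.1
    have hq : (t, (z, (0 : ℝ))) ∈ S := ⟨ht, hzO⟩
    -- in the coordinates given by `F` the Hamiltonian is `hk`
    have hloc : ∀ᶠ x in 𝓝 (z, (0 : ℝ)), x ∈ W ∧ (t, F (t, x)) ∈ NY := by
      have hc : ContinuousAt (fun x ↦ (t, F (t, x))) (z, (0 : ℝ)) :=
        continuousAt_const.prodMk (hasMFDerivAt_slice hF hO ht hzO).continuousAt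
      exact (hW.eventually_mem hz).and (hc.eventually (hNYo.eventually_mem hzN))
    have hHhk : (fun x ↦ H t (F (t, x))) =ᶠ[𝓝 (z, (0 : ℝ))] fun x ↦ hk (t, x) := by
      filter_upwards [hloc] with x hx
      exact congrArg (fun x ↦ hk (t, x)) (hfG t ht x hx.1 hx.2.1.2)
    have hopen : IsOpen {y : Y | (t, y) ∈ NY} := hNYo.preimage (by fun_prop)
    have hHd : MDifferentiableAt (𝓡 3) 𝓘(ℝ, ℝ) (H t) (F (t, (z, 0))) := by
      have h1 : ContMDiffOn (𝓡 3) 𝓘(ℝ, ℝ) ∞ (H t) {y : Y | (t, y) ∈ NY} :=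
        hHsm.comp (f := fun y : Y ↦ (t, y)) (contMDiff_const.prodMk contMDiff_id).contMDiffOn
          fun y hy ↦ ⟨hy, ht, mem_univ _⟩
      exact (h1.contMDiffAt (hopen.mem_nhds hzN)).mdifferentiableAt (by simp)
    have hHd' : HasFDerivAt (fun x ↦ H t (F (t, x)))
        ((dscalar (H t) (F (t, (z, 0)))).comp ((D (t, (z, 0))).comp J)) (z, 0) :=
      hasMFDerivAt_iff_hasFDerivAt.1 (hHd.hasMFDerivAt.comp (z, (0 : ℝ))
        (hasMFDerivAt_slice hF hO ht hzO))
    have hhkd : HasFDerivAt (fun x ↦ hk (t, x))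
        ((dscalar (H t) (F (t, (z, 0)))).comp ((D (t, (z, 0))).comp J)) (z, 0) :=
      hHd'.congr_of_eventuallyEq hHhk.symm
    -- the derivative of `hk` along the surface
    have hdz : ∀ w : EuclideanSpace ℝ (Fin 2),
        dscalar (H t) (F (t, (z, 0))) (D (t, (z, 0)) (0, (w, 0))) =
          DP (t, (z, 0)) (0, (w, 0)) (1, 0) := fun w ↦ by
      have h1 := hhkd.comp z (ContinuousLinearMap.inl ℝ (EuclideanSpace ℝ (Fin 2)) ℝ).hasFDerivAt
      have h2 : (fun z ↦ P (t, (z, 0)) (1, 0)) = (fun x ↦ hk (t, x)) ∘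
          (ContinuousLinearMap.inl ℝ (EuclideanSpace ℝ (Fin 2)) ℝ) := by
        ext z
        simp [hhk]
      exact DFunLike.congr_fun (h1.unique (h2 ▸ hβd t ht z hzO (1, 0))) w
    -- the derivative of `hk` transversally to the surface
    have hds : dscalar (H t) (F (t, (z, 0))) (D (t, (z, 0)) (0, (0, 1))) = κ (t, (z, 0)) := by
      have h1 := hhkd.comp (0 : ℝ) (hasFDerivAt_prodMk_right z (0 : ℝ))
      have h2 : (fun x ↦ hk (t, x)) ∘ (fun s : ℝ ↦ (z, s)) =
          fun s ↦ P (t, (z, 0)) (1, 0) + s * κ (t, (z, 0)) := by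
        ext s
        simp [hhk, hκ]
      rw [h2] at h1
      have h3 : HasDerivAt (fun s : ℝ ↦ P (t, (z, 0)) (1, 0) + s * κ (t, (z, 0)))
          (1 * κ (t, (z, 0))) 0 := ((hasDerivAt_id (0 : ℝ)).mul_const _).const_add _
      have h4 := h1.hasDerivAt.unique h3
      rw [one_mul] at h4
      exact h4
    -- the derivative of `F` at time `t` is invertible
    have hsurj : Surjective ((D (t, (z, 0))).comp J) := by
      have hGd : DifferentiableAt ℝ (G t) (f t (z, 0)) := by
        have h1 : ContDiffOn ℝ ∞ (G t) {c | (t, c) ∈ N} :=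
          hG.comp (f := fun c : EuclideanSpace ℝ (Fin 3) ↦ (t, c)) (by fun_prop)
            fun c hc ↦ ⟨hc, ht, mem_univ _⟩
        exact (h1.contDiffAt ((hN.preimage (by fun_prop)).mem_nhds hzN.1.2)).differentiableAt
          (by simp)
      have h1 := hGd.hasFDerivAt.comp (z, (0 : ℝ)) (hfd t ht (z, 0) hzO)
      have h2 : (G t ∘ f t) =ᶠ[𝓝 (z, (0 : ℝ))] id := by
        filter_upwards [hloc] with x hx
        exact hfG t ht x hx.1 hx.2.1.2
      have h3 := h1.unique ((hasFDerivAt_id (z, (0 : ℝ))).congr_of_eventuallyEq h2)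
      have hinj' : Injective ((D (t, (z, 0))).comp J) := fun a b hab ↦ by
        have ha := DFunLike.congr_fun h3 a
        have hb := DFunLike.congr_fun h3 b
        simp only [ContinuousLinearMap.comp_apply, ContinuousLinearMap.id_apply] at ha hb hab
        rw [← ha, ← hb, hab]
      exact (LinearMap.injective_iff_surjective_of_finrank_eq_finrank
        (f := ((D (t, (z, 0))).comp J).toLinearMap) hfin).1 hinj'
    refine (isContactHamiltonianVector_iff_exists _ _ _).2 ⟨?_, gt (t, z) / g t z, fun v ↦ ?_⟩
    · have h1 := hHhk.self_of_nhds
      simp only [hhk, zero_mul, add_zero] at h1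
      rw [h1]
      rfl
    · obtain ⟨⟨w, s⟩, rfl⟩ := hsurj v
      have hg0 : g t z ≠ 0 := hgδ t ⟨ht, htδ⟩ z hz₄
      have hJws : ((D (t, (z, 0))).comp J) (w, s) =
          D (t, (z, 0)) (0, (w, 0)) + s • D (t, (z, 0)) (0, (0, 1)) := by
        have h1 : J (w, s) = (0, (w, 0)) + s • (0, (0, 1)) := by simp [hJ]
        rw [ContinuousLinearMap.comp_apply, h1, map_add, map_smul]
      have e1 := hdα t ht (z, 0) hzO (1, 0) (0, (w, 0))
      have e2 := hdα t ht (z, 0) hzO (1, 0) (0, (0, 1))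
      have e3 := hβt t ht z hz₄.1 w
      have e4 := hgβ t ht z hz₄.1 w
      have e5 : α.eval (F (t, (z, 0))) (D (t, (z, 0)) (0, (w, 0))) = β t z w := rfl
      have e6 : α.eval (F (t, (z, 0))) (D (t, (z, 0)) (0, (0, 1))) =
          P (t, (z, 0)) (0, (0, 1)) := rfl
      rw [hJws]
      simp only [map_add, map_smul, smul_eq_mul]
      rw [hdz w, hds, ← e1, ← e2, e5, e6, e3, e4]
      simp only [hκ]
      field_simp
      ring
  · have hGW := hGf t ht _ hy.1.2
    refine ⟨G t (extChartAt (𝓡 3) y₀ y), (hWO hGW.1).1, fun hxV ↦ hHy ?_, ?_, ?_⟩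
    · exact hhkV t ht _ (hWO hGW.1).2.1 hxV
    · have := (hWO hGW.1).2.2
      rw [Metric.mem_ball, dist_zero_right, Real.norm_eq_abs] at this
      exact this.le
    · exact (extChartAt (𝓡 3) y₀).injOn (hFs _ ⟨ht, (hWO hGW.1).1⟩) hy.1.1.2 hGW.2

end LocalHamiltonian

/-! ### Immersions -/

section Immersion

variable {E H M : Type*} [NormedAddCommGroup E] [NormedSpace ℝ E] [TopologicalSpace H]
  {I : ModelWithCorners ℝ E H} [I.Boundaryless] [TopologicalSpace M] [ChartedSpace H M]
  {E' H' N : Type*} [NormedAddCommGroup E'] [NormedSpace ℝ E'] [TopologicalSpace H']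
  {I' : ModelWithCorners ℝ E' H'} [TopologicalSpace N] [ChartedSpace H' N]

/-- In the charts in which the immersion is a linear inclusion, the projection is a left inverse. -/
theorem exists_local_leftInverse_of_isImmersionAt {f : M → N} {x : M}
    (hf : Manifold.IsImmersionAt I I' ∞ f x) :
    ∃ r : N → M, (∀ᶠ p in 𝓝 x, r (f p) = p) ∧ ContMDiffAt I' I ∞ r (f x) := by
  set u := hf.domChart.extend I with hu
  set v := hf.codChart.extend I' with hv
  have hus : u.source = hf.domChart.source := hf.domChart.extend_source
  have hw : ∀ p ∈ hf.domChart.source, (hf.equiv.symm (v (f p))).1 = u p := fun p hp ↦ by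
    have h1 := hf.writtenInCharts (u.map_source (hus ▸ hp))
    simp only [comp_apply] at h1
    rw [u.left_inv (hus ▸ hp)] at h1
    rw [h1, ContinuousLinearEquiv.symm_apply_apply]
  have hr : ∀ p ∈ hf.domChart.source, u.symm (hf.equiv.symm (v (f p))).1 = p := fun p hp ↦ by
    rw [hw p hp, u.left_inv (hus ▸ hp)]
  refine ⟨fun y ↦ u.symm (hf.equiv.symm (v y)).1, ?_, ?_⟩
  · filter_upwards [hf.domChart.open_source.mem_nhds hf.mem_domChart_source] with p hp
    exact hr p hp
  · have h1 : ContMDiffAt I' 𝓘(ℝ, E') ∞ v (f x) :=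
      (hf.codChart.contMDiffOn_extend hf.codChart_mem_maximalAtlas).contMDiffAt
        (hf.codChart.open_source.mem_nhds hf.mem_codChart_source)
    have h2 : ContMDiff 𝓘(ℝ, E') 𝓘(ℝ, E) ∞ (fun w ↦ (hf.equiv.symm w).1) :=
      (contDiff_fst.comp hf.equiv.symm.contDiff).contMDiff
    have hmem : (hf.equiv.symm (v (f x))).1 ∈ u.target := by
      rw [hw x hf.mem_domChart_source]
      exact u.map_source (hus ▸ hf.mem_domChart_source)
    have h3 : ContMDiffAt 𝓘(ℝ, E) I ∞ u.symm (hf.equiv.symm (v (f x))).1 := by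
      have h4 := contMDiffOn_extend_symm hf.domChart_mem_maximalAtlas
      have h5 : I '' hf.domChart.target = u.target := by
        rw [hu, OpenPartialHomeomorph.extend_target', I.image_eq]
      rw [← hu, h5] at h4
      exact h4.contMDiffAt (hf.domChart.isOpen_extend_target.mem_nhds hmem)
    exact h3.comp (f x) ((h2 _).comp (f x) h1)

/-- The derivative of an immersion in a parametrization of its source is injective. -/
theorem injective_of_hasMFDerivAt_isImmersionAt {Z : Type*} [NormedAddCommGroup Z]
    [NormedSpace ℝ Z] {f : M → N} {ρ : Z → M} {σ : M → Z} {z : Z}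
    (hf : Manifold.IsImmersionAt I I' ∞ f (ρ z)) (hρ : ContinuousAt ρ z)
    (hσ : ContMDiffAt I 𝓘(ℝ, Z) ∞ σ (ρ z)) (hσρ : ∀ᶠ z' in 𝓝 z, σ (ρ z') = z') {L : Z →L[ℝ] E'}
    (hL : HasMFDerivAt 𝓘(ℝ, Z) I' (fun z ↦ f (ρ z)) z L) : Injective L := by
  obtain ⟨r, hr, hrs⟩ := exists_local_leftInverse_of_isImmersionAt hf
  have hg : ContMDiffAt I' 𝓘(ℝ, Z) ∞ (fun y ↦ σ (r y)) (f (ρ z)) := by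
    refine ContMDiffAt.comp (f (ρ z)) ?_ hrs
    rw [hr.self_of_nhds]
    exact hσ
  obtain ⟨g', hg'⟩ : ∃ g' : E' →L[ℝ] Z,
      HasMFDerivAt I' 𝓘(ℝ, Z) (fun y ↦ σ (r y)) (f (ρ z)) g' :=
    ⟨_, (hg.mdifferentiableAt (by simp)).hasMFDerivAt⟩
  have h1 : HasFDerivAt (fun z' ↦ σ (r (f (ρ z')))) (g'.comp L) z :=
    hasMFDerivAt_iff_hasFDerivAt.1
      (HasMFDerivAt.comp (g := fun y ↦ σ (r y)) (f := fun z ↦ f (ρ z)) z hg' hL)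
  have h2 : (fun z' ↦ σ (r (f (ρ z')))) =ᶠ[𝓝 z] id := by
    filter_upwards [hρ.eventually hr, hσρ] with z' h3 h4
    rw [h3, h4, id]
  have h3 := h1.unique ((hasFDerivAt_id z).congr_of_eventuallyEq h2)
  exact LeftInverse.injective (g := g') fun w ↦ DFunLike.congr_fun h3 w

end Immersion

/-! ### Existence of local contact Hamiltonians -/

section LocalHamiltonianExistence

variable {Y : Type*} [TopologicalSpace Y] [ChartedSpace (EuclideanSpace ℝ (Fin 3)) Y]
  {S : Type*} [TopologicalSpace S]

/-- Near the point `j t₀ p₀` and for times near `t₀` there is a contact Hamiltonian whose contact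
vector field moves the points `j t p`, and which vanishes at time `t` outside `Q t`. The velocity is
prescribed only for `p` near `p₀`, since other parts of the surface may enter `N`. -/
def HasLocalHamiltonian (α : OneForm Y) (j : ℝ → S → Y) (Q : ℝ → Set Y) (t₀ : ℝ) (p₀ : S) : Prop :=
  ∃ (N : Set (ℝ × Y)) (W : Set S) (H : ℝ → Y → ℝ), IsOpen N ∧ (t₀, j t₀ p₀) ∈ N ∧ IsOpen W ∧
    p₀ ∈ W ∧ ContMDiffOn (𝓘(ℝ, ℝ).prod (𝓡 3)) 𝓘(ℝ, ℝ) ∞ (fun q : ℝ × Y ↦ H q.1 q.2)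
      (N ∩ Icc 0 1 ×ˢ univ) ∧
    (∀ t ∈ Icc (0 : ℝ) 1, ∀ p ∈ W, (t, j t p) ∈ N →
      HasVelocityAt (fun t ↦ j t p) (contactVec α (H t) (j t p)) t) ∧
    ∀ t ∈ Icc (0 : ℝ) 1, ∀ y, (t, y) ∈ N → H t y ≠ 0 → y ∈ Q t

theorem HasLocalHamiltonian.mono {α : OneForm Y} {j : ℝ → S → Y} {t₀ : ℝ} {Q Q' : ℝ → Set Y}
    {p₀ : S} (h : HasLocalHamiltonian α j Q t₀ p₀) (hQ : ∀ t ∈ Icc (0 : ℝ) 1, Q t ⊆ Q' t) :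
    HasLocalHamiltonian α j Q' t₀ p₀ := by
  obtain ⟨N, W, H, hN, hN₀, hW, hW₀, hHsm, hHj, hHQ⟩ := h
  exact ⟨N, W, H, hN, hN₀, hW, hW₀, hHsm, hHj, fun t ht y hy h0 ↦ hQ t ht (hHQ t ht y hy h0)⟩

variable [IsManifold (𝓡 3) ∞ Y] {α : OneForm Y} [ChartedSpace (EuclideanSpace ℝ (Fin 2)) S]
  [IsManifold (𝓡 2) ∞ S]

/-- A family `F` of parametrizations, defined for times near `t₀`, yields a local contact
Hamiltonian. Time is reparametrized so that it stays near `t₀`. -/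
theorem IsContactForm.hasLocalHamiltonian (hα : IsContactForm α) {j : ℝ → S → Y}
    (hj : ∀ t ∈ Icc (0 : ℝ) 1, ContMDiff (𝓡 2) (𝓡 3) ∞ (j t))
    (hjξ : ∀ t ∈ Icc (0 : ℝ) 1, ∀ p,
      characteristicFoliation α (j t) p = characteristicFoliation α (j 0) p)
    {V : Set S} (hV : IsOpen V) {t₀ : ℝ} (ht₀ : t₀ ∈ Icc (0 : ℝ) 1) {p₀ : S} {δ₀ : ℝ}
    (hδ₀ : 0 < δ₀) {O : Set (EuclideanSpace ℝ (Fin 2) × ℝ)} (hO : IsOpen O)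
    (hOT : ∀ x ∈ O, x.1 ∈ (extChartAt (𝓡 2) p₀).target)
    (hz₀ : (extChartAt (𝓡 2) p₀ p₀, (0 : ℝ)) ∈ O)
    {F : ℝ × (EuclideanSpace ℝ (Fin 2) × ℝ) → Y}
    (hF : ContMDiffOn 𝓘(ℝ, ℝ × (EuclideanSpace ℝ (Fin 2) × ℝ)) (𝓡 3) ∞ F
      ((Icc 0 1 ∩ Metric.ball t₀ δ₀) ×ˢ O))
    (hFj : ∀ t ∈ Icc (0 : ℝ) 1 ∩ Metric.ball t₀ δ₀, ∀ z, (z, (0 : ℝ)) ∈ O →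
      F (t, (z, 0)) = j t ((extChartAt (𝓡 2) p₀).symm z))
    (hinj : ∀ L : EuclideanSpace ℝ (Fin 2) × ℝ →L[ℝ] EuclideanSpace ℝ (Fin 3),
      HasMFDerivAt 𝓘(ℝ, EuclideanSpace ℝ (Fin 2) × ℝ) (𝓡 3) (fun x ↦ F (t₀, x))
        (extChartAt (𝓡 2) p₀ p₀, (0 : ℝ)) L → Injective L)
    (hFV : ∀ t ∈ Icc (0 : ℝ) 1 ∩ Metric.ball t₀ δ₀, ∀ x ∈ O,
      (extChartAt (𝓡 2) p₀).symm x.1 ∈ V → F (t, x) = F (t₀, x)) :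
    HasLocalHamiltonian α j
      (fun t ↦ {y | ∃ x ∈ O, (extChartAt (𝓡 2) p₀).symm x.1 ∉ V ∧ |x.2| ≤ 1 ∧ F (t, x) = y})
      t₀ p₀ := by
  set z₀ := extChartAt (𝓡 2) p₀ p₀ with hz₀def
  have hT : IsOpen (extChartAt (𝓡 2) p₀).target := isOpen_extChartAt_target p₀
  have ht₀' : t₀ ∈ Icc (0 : ℝ) 1 ∩ Metric.ball t₀ δ₀ := ⟨ht₀, Metric.mem_ball_self hδ₀⟩
  have hF₀ : F (t₀, (z₀, 0)) = j t₀ p₀ := by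
    rw [hFj t₀ ht₀' z₀ hz₀, extChartAt_to_inv]
  -- a time interval and a neighbourhood on which `F` stays in one chart
  have hmem : (extChartAt (𝓡 3) (j t₀ p₀)).source ∈ 𝓝 (F (t₀, (z₀, 0))) := by
    rw [hF₀]
    exact extChartAt_source_mem_nhds _
  obtain ⟨ε, hε, hεs⟩ := Metric.mem_nhdsWithin_iff.1
    (hF.continuousOn (t₀, (z₀, 0)) ⟨ht₀', hz₀⟩ hmem)
  set δ := min ε δ₀ with hδ
  have hδ0 : 0 < δ := lt_min hε hδ₀
  let b : ContDiffBump t₀ := ⟨δ / 2, δ, by linarith, by linarith⟩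
  set τ : ℝ → ℝ := fun t ↦ t₀ + b t * (t - t₀) with hτ
  have hτsm : ContDiff ℝ ∞ τ :=
    contDiff_const.add (b.contDiff.mul (contDiff_id.sub contDiff_const))
  have hτδ : ∀ t, τ t ∈ Metric.ball t₀ δ := fun t ↦ by
    rw [Metric.mem_ball, Real.dist_eq]
    simp only [hτ, add_sub_cancel_left, abs_mul, abs_of_nonneg b.nonneg]
    by_cases ht : t ∈ Metric.ball t₀ δ
    · rw [Metric.mem_ball, Real.dist_eq] at ht
      exact (mul_le_of_le_one_left (abs_nonneg _) b.le_one).trans_lt ht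
    · rw [b.zero_of_le_dist (not_lt.1 ht), zero_mul]
      exact hδ0
  have hτI : ∀ t ∈ Icc (0 : ℝ) 1, τ t ∈ Icc (0 : ℝ) 1 := fun t ht ↦ by
    have h1 : 0 ≤ b t := b.nonneg
    have h2 : b t ≤ 1 := b.le_one
    have h3 : τ t = (1 - b t) * t₀ + b t * t := by simp only [hτ]; ring
    rw [h3]
    constructor
    · exact add_nonneg (mul_nonneg (by linarith) ht₀.1) (mul_nonneg h1 ht.1)
    · nlinarith [mul_le_mul_of_nonneg_left ht₀.2 (by linarith : 0 ≤ 1 - b t),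
        mul_le_mul_of_nonneg_left ht.2 h1]
  have hτid : ∀ t ∈ Metric.ball t₀ (δ / 2), τ t = t := fun t ht ↦ by
    have h1 : b t = 1 := b.one_of_mem_closedBall (Metric.ball_subset_closedBall ht)
    simp only [hτ, h1]
    ring
  have hτ₀ : τ t₀ = t₀ := hτid t₀ (Metric.mem_ball_self (half_pos hδ0))
  have hτA : ∀ t ∈ Icc (0 : ℝ) 1, τ t ∈ Icc (0 : ℝ) 1 ∩ Metric.ball t₀ δ₀ := fun t ht ↦
    ⟨hτI t ht, Metric.ball_subset_ball (min_le_right _ _) (hτδ t)⟩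
  set O' := O ∩ Metric.ball (z₀, (0 : ℝ)) ε with hO'
  have hO'o : IsOpen O' := hO.inter Metric.isOpen_ball
  have hz₀' : (z₀, (0 : ℝ)) ∈ O' := ⟨hz₀, Metric.mem_ball_self hε⟩
  set F' : ℝ × (EuclideanSpace ℝ (Fin 2) × ℝ) → Y := fun q ↦ F (τ q.1, q.2) with hF'
  have hF'sm : ContMDiffOn 𝓘(ℝ, ℝ × (EuclideanSpace ℝ (Fin 2) × ℝ)) (𝓡 3) ∞ F'
      (Icc 0 1 ×ˢ O') :=
    hF.comp (f := fun q : ℝ × (EuclideanSpace ℝ (Fin 2) × ℝ) ↦ (τ q.1, q.2))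
      ((hτsm.comp contDiff_fst).prodMk contDiff_snd).contMDiff.contMDiffOn
      fun q hq ↦ ⟨hτA q.1 hq.1, hq.2.1⟩
  have hF's : ∀ q ∈ Icc (0 : ℝ) 1 ×ˢ O', F' q ∈ (extChartAt (𝓡 3) (j t₀ p₀)).source :=
    fun q hq ↦ by
      refine @hεs (τ q.1, q.2) ⟨?_, hτA q.1 hq.1, hq.2.1⟩
      rw [← ball_prod_same]
      exact ⟨Metric.ball_subset_ball (min_le_left _ _) (hτδ q.1), hq.2.2⟩
  set V' : Set (EuclideanSpace ℝ (Fin 2)) := (extChartAt (𝓡 2) p₀).target ∩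
    (extChartAt (𝓡 2) p₀).symm ⁻¹' V with hV'
  have hV'o : IsOpen V' := (continuousOn_extChartAt_symm p₀).isOpen_inter_preimage hT hV
  -- the derivative along the surface, in terms of `j`
  have hDz : ∀ t ∈ Icc (0 : ℝ) 1, ∀ z, (z, (0 : ℝ)) ∈ O' → ∀ w : EuclideanSpace ℝ (Fin 2),
      α.pull F' (Icc 0 1 ×ˢ O') (t, (z, 0)) (0, (w, 0)) = 0 ↔
        (dchartSymm p₀ z w : EuclideanSpace ℝ (Fin 2)) ∈
          characteristicFoliation α (j 0) ((extChartAt (𝓡 2) p₀).symm z) := fun t ht z hz w ↦ by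
    have h1 : HasFDerivAt (fun z : EuclideanSpace ℝ (Fin 2) ↦ (z, (0 : ℝ)))
        (ContinuousLinearMap.inl ℝ (EuclideanSpace ℝ (Fin 2)) ℝ) z :=
      (ContinuousLinearMap.inl ℝ (EuclideanSpace ℝ (Fin 2)) ℝ).hasFDerivAt
    have h2 := HasMFDerivAt.comp z (hasMFDerivAt_slice hF'sm hO'o ht hz)
      (hasMFDerivAt_iff_hasFDerivAt.2 h1)
    obtain ⟨A, hA, hA'⟩ : ∃ A : EuclideanSpace ℝ (Fin 2) →L[ℝ] EuclideanSpace ℝ (Fin 3),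
        A = mfderiv (𝓡 2) (𝓡 3) (j (τ t)) ((extChartAt (𝓡 2) p₀).symm z) ∧
        HasMFDerivAt (𝓡 2) (𝓡 3) (j (τ t)) ((extChartAt (𝓡 2) p₀).symm z) A :=
      ⟨_, rfl, ((hj (τ t) (hτI t ht)).mdifferentiable (by simp) _).hasMFDerivAt⟩
    have h3 := HasMFDerivAt.comp z hA' (hasMFDerivAt_chart_symm p₀ (hOT _ hz.1))
    have h4 : (fun z ↦ F' (t, (z, 0))) =ᶠ[𝓝 z] j (τ t) ∘ (extChartAt (𝓡 2) p₀).symm := by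
      have : ∀ᶠ z' in 𝓝 z, (z', (0 : ℝ)) ∈ O' :=
        (hO'o.preimage (f := fun z' ↦ (z', (0 : ℝ))) (by fun_prop)).mem_nhds hz
      filter_upwards [this] with z' hz'
      exact hFj (τ t) (hτA t ht) z' hz'.1
    have h5 : ((derivOn (E := EuclideanSpace ℝ (Fin 3)) F' (Icc 0 1 ×ˢ O') (t, (z, 0))).comp
        (ContinuousLinearMap.inr ℝ ℝ (EuclideanSpace ℝ (Fin 2) × ℝ))).comp
        (ContinuousLinearMap.inl ℝ (EuclideanSpace ℝ (Fin 2)) ℝ) = A.comp (dchartSymm p₀ z) :=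
      hasMFDerivAt_unique h2 (h3.congr_of_eventuallyEq h4)
    have h6 : derivOn (E := EuclideanSpace ℝ (Fin 3)) F' (Icc 0 1 ×ˢ O') (t, (z, 0)) (0, (w, 0)) =
        A (dchartSymm p₀ z w) := DFunLike.congr_fun h5 w
    rw [← hjξ (τ t) (hτI t ht)]
    change α.eval (F' (t, (z, 0))) (derivOn (E := EuclideanSpace ℝ (Fin 3)) F' (Icc 0 1 ×ˢ O')
      (t, (z, 0)) (0, (w, 0))) = 0 ↔ _
    rw [h6, hA, show F' (t, (z, 0)) = _ from hFj (τ t) (hτA t ht) z hz.1]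
    rfl
  obtain ⟨N, W, H, hN, hN₀, hW, hW₀, hWO, hHsm, hHj, hHQ⟩ :=
    hα.exists_local_hamiltonian hO'o hF'sm hF's hV'o ht₀ hz₀'
      (hinj _ (by
        have := hasMFDerivAt_slice hF'sm hO'o ht₀ hz₀'
        refine this.congr_of_eventuallyEq (Eventually.of_forall fun x ↦ ?_)
        simp only [hF', hτ₀]))
      (fun t ht z hz w h ↦ (hDz t ht z hz w).2 ((hDz t₀ ht₀ z hz w).1 h))
      (fun t ht x hx hxV ↦ by
        simp only [hF', hτ₀]
        exact hFV (τ t) (hτA t ht) x hx.1 hxV.2)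
  refine ⟨N ∩ Metric.ball t₀ (δ / 2) ×ˢ univ, (extChartAt (𝓡 2) p₀).source ∩
    extChartAt (𝓡 2) p₀ ⁻¹' ((fun z ↦ (z, (0 : ℝ))) ⁻¹' W), H,
    hN.inter (Metric.isOpen_ball.prod isOpen_univ), ⟨?_, Metric.mem_ball_self (half_pos hδ0),
      mem_univ _⟩, ?_, ⟨mem_extChartAt_source p₀, hW₀⟩,
    hHsm.mono (inter_subset_inter_left _ inter_subset_left), ?_, ?_⟩
  · rw [← hF₀]
    simpa only [hF', hτ₀] using hN₀
  · exact (continuousOn_extChartAt p₀).isOpen_inter_preimage (isOpen_extChartAt_source p₀)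
      (hW.preimage (by fun_prop))
  · rintro t ht p ⟨hps, hpW⟩ ⟨hpN, htδ, -⟩
    have hFt : ∀ s ∈ Icc (0 : ℝ) 1 ∩ Metric.ball t₀ (δ / 2),
        F' (s, (extChartAt (𝓡 2) p₀ p, 0)) = j s p := fun s hs ↦ by
      have h1 := hFj (τ s) (hτA s hs.1) _ (hWO hpW).1
      rw [(extChartAt (𝓡 2) p₀).left_inv hps] at h1
      have h2 : F' (s, (extChartAt (𝓡 2) p₀ p, 0)) = j (τ s) p := h1
      rw [h2, hτid s hs.2]
    have h1 := (hα.isContactHamiltonianVector_iff _ _ _).1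
      (hHj t ht _ hpW ((hFt t ⟨ht, htδ⟩).symm ▸ hpN))
    have h2 := hasVelocityAt_derivOn hF'sm ht (hWO hpW)
    rw [h1, hFt t ⟨ht, htδ⟩] at h2
    refine h2.congr ?_ (hFt t ⟨ht, htδ⟩).symm
    filter_upwards [self_mem_nhdsWithin, mem_nhdsWithin_of_mem_nhds
      (Metric.isOpen_ball.mem_nhds htδ)] with s hs hsδ
    exact (hFt s ⟨hs, hsδ⟩).symm
  · rintro t ht y ⟨hyN, htδ, -⟩ hHy
    obtain ⟨x, hx, hxV, hx1, hxy⟩ := hHQ t ht y hyN hHy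
    refine ⟨x, hx.1, fun h ↦ hxV ⟨hOT x hx.1, h⟩, hx1, ?_⟩
    simp only [hF', hτid t htδ] at hxy
    exact hxy

end LocalHamiltonianExistence

/-! ### Patching local contact Hamiltonians -/

section Patching

variable {Y : Type*} [TopologicalSpace Y] [ChartedSpace (EuclideanSpace ℝ (Fin 3)) Y]

theorem dscalar_eq {h : Y → ℝ} {y : Y} {L : EuclideanSpace ℝ (Fin 3) →L[ℝ] ℝ}
    (hL : HasMFDerivAt (𝓡 3) 𝓘(ℝ, ℝ) h y L) : dscalar h y = L :=
  hL.mfderiv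

theorem contactVec_eq_zero (α : OneForm Y) {h : Y → ℝ} {y : Y} (hh : h =ᶠ[𝓝 y] fun _ ↦ 0) :
    contactVec α h y = 0 := by
  have h1 : dscalar h y = 0 :=
    dscalar_eq ((hasMFDerivAt_const (0 : ℝ) y).congr_of_eventuallyEq hh)
  have h2 : h y = 0 := hh.eq_of_nhds
  rw [contactVec, h1, h2, neg_zero, ← Prod.zero_eq_mk, map_zero, Prod.fst_zero]

theorem hasMFDerivAt_sum {ι : Type*} (s : Finset ι) {f : ι → Y → ℝ} {y : Y}
    {L : ι → EuclideanSpace ℝ (Fin 3) →L[ℝ] ℝ}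
    (hL : ∀ i, HasMFDerivAt (𝓡 3) 𝓘(ℝ, ℝ) (f i) y (L i)) :
    HasMFDerivAt (𝓡 3) 𝓘(ℝ, ℝ) (fun z ↦ ∑ i ∈ s, f i z) y (∑ i ∈ s, L i) := by
  classical
  induction s using Finset.induction_on with
  | empty => exact hasMFDerivAt_const (0 : ℝ) y
  | insert i s hi ih =>
    have h1 : (fun z ↦ ∑ k ∈ insert i s, f k z) = f i + fun z ↦ ∑ k ∈ s, f k z :=
      funext fun z ↦ Finset.sum_insert hi
    have h2 : ∑ k ∈ insert i s, L k = L i + ∑ k ∈ s, L k := Finset.sum_insert hi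
    rw [h1]
    exact ((hL i).add ih).congr_mfderiv h2.symm

variable [IsManifold (𝓡 3) ∞ Y] {α : OneForm Y}

/-- A linear combination of contact Hamiltonians with a common contact vector `X` at `y` again
has contact vector `X` at `y`, provided that the coefficients form a partition of unity or that
`X = 0`: the differential of the combination is `∑ ρᵢ dhᵢ + α(X) ∑ dρᵢ`, and the last term
vanishes. -/
theorem IsContactForm.contactVec_sum_mul (hα : IsContactForm α) {ι : Type*} [Fintype ι]
    {ρ h : ι → Y → ℝ} {y : Y} {X : EuclideanSpace ℝ (Fin 3)}
    (hi : ∀ i, ρ i =ᶠ[𝓝 y] (fun _ ↦ 0) ∨ (MDifferentiableAt (𝓡 3) 𝓘(ℝ, ℝ) (ρ i) y ∧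
      MDifferentiableAt (𝓡 3) 𝓘(ℝ, ℝ) (h i) y ∧ contactVec α (h i) y = X))
    (hX : X = 0 ∨ (fun y ↦ ∑ i, ρ i y) =ᶠ[𝓝 y] fun _ ↦ 1) :
    contactVec α (fun y ↦ ∑ i, ρ i y * h i y) y = X := by
  have key : ∀ i, ∃ (R P : EuclideanSpace ℝ (Fin 3) →L[ℝ] ℝ) (μ : ℝ),
      HasMFDerivAt (𝓡 3) 𝓘(ℝ, ℝ) (ρ i) y R ∧
      HasMFDerivAt (𝓡 3) 𝓘(ℝ, ℝ) (ρ i * h i) y P ∧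
      ρ i y * h i y = ρ i y * α.eval y X ∧
      ∀ v, P v + ρ i y * α.dform y X v = μ * α.eval y v + α.eval y X * R v := fun i ↦ by
    rcases hi i with h0 | ⟨h1, h2, h3⟩
    · have hy : ρ i y = 0 := h0.eq_of_nhds
      refine ⟨0, 0, 0, (hasMFDerivAt_const (0 : ℝ) y).congr_of_eventuallyEq h0,
        (hasMFDerivAt_const (0 : ℝ) y).congr_of_eventuallyEq ?_, by simp [hy], by simp [hy]⟩
      filter_upwards [h0] with z hz
      simp [hz]
    · obtain ⟨R, hR⟩ : ∃ R : EuclideanSpace ℝ (Fin 3) →L[ℝ] ℝ,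
          HasMFDerivAt (𝓡 3) 𝓘(ℝ, ℝ) (ρ i) y R := ⟨_, h1.hasMFDerivAt⟩
      obtain ⟨L, hL⟩ : ∃ L : EuclideanSpace ℝ (Fin 3) →L[ℝ] ℝ,
          HasMFDerivAt (𝓡 3) 𝓘(ℝ, ℝ) (h i) y L := ⟨_, h2.hasMFDerivAt⟩
      obtain ⟨h4, μ, h5⟩ := (isContactHamiltonianVector_iff_exists (h i) y X).1
        ((hα.isContactHamiltonianVector_iff _ _ _).2 h3.symm)
      refine ⟨R, ρ i y • L + h i y • R, ρ i y * μ, hR, hR.mul hL, by rw [h4], fun v ↦ ?_⟩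
      have h6 := h5 v
      rw [dscalar_eq hL] at h6
      change ρ i y * L v + h i y * R v + ρ i y * α.dform y X v = _
      rw [← h4]
      linear_combination ρ i y * h6
  choose R P μ hR hP hval hid using key
  have hsumP : HasMFDerivAt (𝓡 3) 𝓘(ℝ, ℝ) (fun y ↦ ∑ i, ρ i y * h i y) y (∑ i, P i) :=
    hasMFDerivAt_sum Finset.univ hP
  have hsumR : HasMFDerivAt (𝓡 3) 𝓘(ℝ, ℝ) (fun y ↦ ∑ i, ρ i y) y (∑ i, R i) :=
    hasMFDerivAt_sum Finset.univ hR
  refine ((hα.isContactHamiltonianVector_iff _ _ _).1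
    ((isContactHamiltonianVector_iff_exists _ y X).2 ⟨?_, ∑ i, μ i, fun v ↦ ?_⟩)).symm
  · rw [Finset.sum_congr rfl fun i _ ↦ hval i, ← Finset.sum_mul]
    rcases hX with hX | hX
    · simp [hX]
    · rw [hX.eq_of_nhds, one_mul]
  · rw [dscalar_eq hsumP]
    have h1 : (∑ i, P i v) + (∑ i, ρ i y) * α.dform y X v =
        (∑ i, μ i) * α.eval y v + α.eval y X * ∑ i, R i v := by
      rw [Finset.sum_mul, Finset.sum_mul, Finset.mul_sum, ← Finset.sum_add_distrib,
        ← Finset.sum_add_distrib]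
      exact Finset.sum_congr rfl fun i _ ↦ hid i v
    have h2 : (∑ i, P i) v = ∑ i, P i v := sum_apply _ _ _
    refine (congrArg (· + α.dform y X v) h2).trans ?_
    rcases hX with hX | hX
    · simpa [hX] using h1
    · have h3 : (∑ i, R i) = 0 :=
        hasMFDerivAt_unique hsumR ((hasMFDerivAt_const (1 : ℝ) y).congr_of_eventuallyEq hX)
      have h4 : ∑ i, R i v = 0 := by
        have := DFunLike.congr_fun h3 v
        simpa using this
      have h5 : ∑ i, ρ i y = 1 := hX.eq_of_nhds
      rw [h4, h5] at h1
      linarith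

variable [T2Space Y] [SecondCountableTopology Y]
  {S : Type*} [TopologicalSpace S] [CompactSpace S]
  [ChartedSpace (EuclideanSpace ℝ (Fin 2)) S]

/-- Local contact Hamiltonians moving the points `j t p` are patched by a partition of unity and
integrated to a contact isotopy. -/
theorem IsContactForm.exists_contactIsotopy_of_hasLocalHamiltonian (hα : IsContactForm α)
    {V : Set S} (hV : IsOpen V) {j : ℝ → S → Y} (hj : IsEmbeddingFamily (𝓡 2) j)
    (hjV : ∀ t ∈ Icc (0 : ℝ) 1, ∀ p ∈ V, j t p = j 0 p) {Q : ℝ → Set Y}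
    (hQ : ∀ t ∈ Icc (0 : ℝ) 1, IsClosed (Q t))
    (hloc : ∀ t ∈ Icc (0 : ℝ) 1, ∀ p ∈ Vᶜ, HasLocalHamiltonian α j Q t p)
    {U : Set (ℝ × Y)} (hU : IsOpen U) (hjU : ∀ t ∈ Icc (0 : ℝ) 1, ∀ p ∈ Vᶜ, (t, j t p) ∈ U) :
    ∃ (ψ : ℝ → Diffeomorph (𝓡 3) (𝓡 3) Y Y ∞) (H : ℝ → Y → ℝ),
      IsContactIsotopy α ψ ∧ IsGeneratedBy α (fun t ↦ ψ t) H ∧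
      (∀ t ∈ Icc (0 : ℝ) 1, ∀ p, ψ t (j 0 p) = j t p) ∧
      ∀ t ∈ Icc (0 : ℝ) 1,
        supportAt (fun t ↦ ψ t) t ⊆ {y | (t, y) ∈ U} ∧
        HasCompactSupport (H t) ∧
        tsupport (H t) ⊆ {y | (t, y) ∈ U} ∩ Q t := by
  have : LocallyCompactSpace Y :=
    ChartedSpace.locallyCompactSpace (EuclideanSpace ℝ (Fin 3)) Y
  have hcomp : ∀ A : Set S, IsClosed A →
      IsCompact ((fun q : ℝ × S ↦ (q.1, j q.1 q.2)) '' (Icc 0 1 ×ˢ A)) := fun A hA ↦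
    (isCompact_Icc.prod hA.isCompact).image_of_continuousOn
      (continuousOn_fst.prodMk (hj.smooth.continuousOn.mono (prod_mono_right (subset_univ A))))
  set C := (fun q : ℝ × S ↦ (q.1, j q.1 q.2)) '' (Icc 0 1 ×ˢ Vᶜ) with hC
  have hCc : IsCompact C := hcomp _ hV.isClosed_compl
  -- the neighbourhoods are shrunk so that they meet the graph of `j t p` only for `p ∈ W`
  have hloc' : ∀ c ∈ C, ∃ (N : Set (ℝ × Y)) (H : ℝ → Y → ℝ), IsOpen N ∧ c ∈ N ∧ N ⊆ U ∧
      ContMDiffOn (𝓘(ℝ, ℝ).prod (𝓡 3)) 𝓘(ℝ, ℝ) ∞ (fun q : ℝ × Y ↦ H q.1 q.2)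
        (N ∩ Icc 0 1 ×ˢ univ) ∧
      (∀ t ∈ Icc (0 : ℝ) 1, ∀ p, (t, j t p) ∈ N →
        HasVelocityAt (fun t ↦ j t p) (contactVec α (H t) (j t p)) t) ∧
      ∀ t ∈ Icc (0 : ℝ) 1, ∀ y, (t, y) ∈ N → H t y ≠ 0 → y ∈ Q t := by
    rintro _ ⟨⟨t₀, p₀⟩, ⟨ht₀, hp₀⟩, rfl⟩
    obtain ⟨N, W, H, hN, hN₀, hW, hW₀, hHsm, hHj, hHQ⟩ := hloc t₀ ht₀ p₀ hp₀
    refine ⟨N ∩ U ∩ ((fun q : ℝ × S ↦ (q.1, j q.1 q.2)) '' (Icc 0 1 ×ˢ Wᶜ))ᶜ, H,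
      (hN.inter hU).inter (hcomp _ hW.isClosed_compl).isClosed.isOpen_compl,
      ⟨⟨hN₀, hjU t₀ ht₀ p₀ hp₀⟩, ?_⟩, fun q hq ↦ hq.1.2, hHsm.mono fun q hq ↦ ⟨hq.1.1.1, hq.2⟩,
      fun t ht p htp ↦ hHj t ht p ?_ htp.1.1, fun t ht y hty ↦ hHQ t ht y hty.1.1⟩
    · rintro ⟨⟨t, p⟩, ⟨-, hp⟩, heq⟩
      obtain ⟨rfl, h2⟩ := Prod.mk.inj heq
      exact hp ((hj.embedding t ht₀).isEmbedding.injective h2 ▸ hW₀)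
    · by_contra hpW
      exact htp.2 ⟨(t, p), ⟨ht, hpW⟩, rfl⟩
  choose! N H hNo hcN hNU hHsm hHj hHQ using hloc'
  obtain ⟨I, hIC, hI⟩ := hCc.elim_nhds_subcover N fun c hc ↦ (hNo c hc).mem_nhds (hcN c hc)
  obtain ⟨K, hK, hCK, hKN⟩ := exists_compact_between hCc
    (isOpen_biUnion fun c hc ↦ hNo c (hIC c hc)) hI
  obtain ⟨K₂, hK₂, hKK₂, -⟩ := exists_compact_between hK isOpen_univ (subset_univ K)
  obtain ⟨f, hf⟩ := SmoothPartitionOfUnity.exists_isSubordinate (𝓘(ℝ, ℝ).prod (𝓡 3)) hK.isClosed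
    (fun c : I ↦ N c ∩ interior K₂) (fun c ↦ (hNo c (hIC c c.2)).inter isOpen_interior)
    (fun q hq ↦ by
      obtain ⟨c, hc, hq'⟩ := mem_iUnion₂.1 (hKN hq)
      exact mem_iUnion.2 ⟨⟨c, hc⟩, hq', hKK₂ hq⟩)
  set G : ℝ → Y → ℝ := fun t y ↦ ∑ c : I, f c (t, y) * H c t y with hG
  have hGsm : ContMDiffOn (𝓘(ℝ, ℝ).prod (𝓡 3)) 𝓘(ℝ, ℝ) ∞ (fun q : ℝ × Y ↦ G q.1 q.2)
      (Icc 0 1 ×ˢ univ) := by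
    refine contMDiffOn_finsetSum fun c _ q hq ↦ ?_
    by_cases hqc : q ∈ tsupport (f c)
    · refine (f c).contMDiff.contMDiffAt.contMDiffWithinAt.mul ?_
      refine (hHsm c (hIC c c.2) q ⟨(hf c hqc).1, hq⟩).mono_of_mem_nhdsWithin ?_
      exact inter_mem (mem_nhdsWithin_of_mem_nhds ((hNo c (hIC c c.2)).mem_nhds (hf c hqc).1))
        self_mem_nhdsWithin
    · have h0 : (fun q : ℝ × Y ↦ f c (q.1, q.2) * H c q.1 q.2) =ᶠ[𝓝 q] fun _ ↦ 0 := by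
        filter_upwards [notMem_tsupport_iff_eventuallyEq.1 hqc] with q' hq'
        simp [hq']
      exact (contMDiffAt_const.congr_of_eventuallyEq h0).contMDiffWithinAt
  -- the supports
  set T : Set (ℝ × Y) := ⋃ c : I, tsupport (f c) with hT
  have hTc : IsClosed T := isClosed_iUnion_of_finite fun c ↦ isClosed_tsupport _
  have hTU : T ⊆ U := iUnion_subset fun c q hq ↦ hNU c (hIC c c.2) (hf c hq).1
  have hTK : T ⊆ K₂ := iUnion_subset fun c q hq ↦ interior_subset (hf c hq).2
  have hsupp : ∀ t ∈ Icc (0 : ℝ) 1, tsupport (G t) ⊆ {y | (t, y) ∈ T} ∩ Q t := fun t ht ↦ by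
    refine closure_minimal (fun y hy ↦ ?_)
      ((hTc.preimage (Continuous.prodMk_right t)).inter (hQ t ht))
    obtain ⟨c, -, hc⟩ := Finset.exists_ne_zero_of_sum_ne_zero hy
    have h1 : (t, y) ∈ tsupport (f c) := subset_tsupport _ (left_ne_zero_of_mul hc)
    exact ⟨mem_iUnion.2 ⟨c, h1⟩,
      hHQ c (hIC c c.2) t ht y (hf c h1).1 (right_ne_zero_of_mul hc)⟩
  have hKY : IsCompact (Prod.snd '' K₂) := hK₂.image continuous_snd
  have hsuppK : ∀ t ∈ Icc (0 : ℝ) 1, tsupport (G t) ⊆ Prod.snd '' K₂ := fun t ht y hy ↦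
    ⟨(t, y), hTK (hsupp t ht hy).1, rfl⟩
  have hvec0 : ∀ t, ∀ y ∉ tsupport (G t), contactVec α (G t) y = 0 := fun t y hy ↦
    contactVec_eq_zero α (notMem_tsupport_iff_eventuallyEq.1 hy)
  -- the points of the surface move along the contact vector field
  have htraj : ∀ p, IsTrajectoryOn (fun t ↦ contactVec α (G t)) (fun t ↦ j t p) (Icc 0 1) := by
    intro p t ht
    obtain ⟨X, hX⟩ : ∃ X : EuclideanSpace ℝ (Fin 3), HasVelocityAt (fun t ↦ j t p) X t := by
      have h1 : ContMDiffOn 𝓘(ℝ, ℝ) (𝓡 3) ∞ (fun t ↦ j t p) (Icc 0 1) :=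
        hj.smooth.comp (f := fun t : ℝ ↦ (t, p))
          (contMDiff_id.prodMk contMDiff_const).contMDiffOn fun t ht ↦ ⟨ht, mem_univ _⟩
      obtain ⟨L, hL⟩ : ∃ L : ℝ →L[ℝ] EuclideanSpace ℝ (Fin 3),
          HasMFDerivWithinAt 𝓘(ℝ, ℝ) (𝓡 3) (fun t ↦ j t p) (Icc 0 1) t L :=
        ⟨_, ((h1 t ht).mdifferentiableWithinAt (by simp)).hasMFDerivWithinAt⟩
      refine ⟨L 1, ?_⟩
      have h2 : ContinuousLinearMap.toSpanSingleton ℝ (L 1) = L := by ext; simp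
      exact hL.congr_mfderiv h2.symm
    have h1 : contactVec α (G t) (j t p) = X := by
      refine hα.contactVec_sum_mul (ρ := fun (c : I) y ↦ f c (t, y)) (h := fun c ↦ H c t)
        (fun c ↦ ?_) ?_
      · by_cases hc : (t, j t p) ∈ tsupport (f c)
        · have hcN := (hf c hc).1
          refine Or.inr ⟨?_, ?_, (hHj c (hIC c c.2) t ht p hcN).unique hX ht⟩
          · exact ((f c).contMDiff.comp (contMDiff_const.prodMk contMDiff_id)).mdifferentiable
              (by simp) _
          · have h2 : ContMDiffOn (𝓡 3) 𝓘(ℝ, ℝ) ∞ (H c t) ((fun y ↦ (t, y)) ⁻¹' N c) :=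
              (hHsm c (hIC c c.2)).comp (f := fun y : Y ↦ (t, y))
                (contMDiff_const.prodMk contMDiff_id).contMDiffOn
                fun y hy ↦ ⟨hy, ht, mem_univ _⟩
            exact (h2.contMDiffAt (((hNo c (hIC c c.2)).preimage
              (Continuous.prodMk_right t)).mem_nhds hcN)).mdifferentiableAt (by simp)
        · exact Or.inl ((Continuous.prodMk_right t).continuousAt.eventually
            (notMem_tsupport_iff_eventuallyEq.1 hc))
      · by_cases hp : p ∈ V
        · refine Or.inl (hX.unique ?_ ht)
          refine (hasVelocityAt_const (j 0 p) t).congr ?_ (hjV t ht p hp)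
          filter_upwards [self_mem_nhdsWithin] with s hs
          exact hjV s hs p hp
        · right
          have h2 : ∀ᶠ y in 𝓝 (j t p), (t, y) ∈ interior K :=
            (isOpen_interior.preimage (Continuous.prodMk_right t)).mem_nhds
              (hCK ⟨(t, p), ⟨ht, hp⟩, rfl⟩)
          filter_upwards [h2] with y hy
          rw [← f.sum_eq_one (interior_subset hy), finsum_eq_sum_of_fintype]
    change HasVelocityAt _ (contactVec α (G t) (j t p)) t
    rwa [h1]
  obtain ⟨ψ, hψ, hψG, hψt⟩ := hα.exists_contactIsotopy hGsm hKY
    fun t ht y hy ↦ hvec0 t y fun h ↦ hy (hsuppK t ht h)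
  refine ⟨ψ, G, hψ, hψG, fun t ht p ↦ ?_, fun t ht ↦ ⟨?_, ?_, fun y hy ↦
    ⟨hTU (hsupp t ht hy).1, (hsupp t ht hy).2⟩⟩⟩
  · have hX : IsSmoothField (fun t ↦ contactVec α (G t)) := hα.contDiffOn_dchart_contactVec hGsm
    exact (hψt (j 0 p)).eqOn hX isPreconnected_Icc subset_rfl
      (htraj p) (left_mem_Icc.2 zero_le_one) (hψ.zero _) ht
  · refine (closure_minimal ?_ (isClosed_tsupport (G t))).trans
      fun y hy ↦ hTU (hsupp t ht hy).1
    rintro _ ⟨y, rfl, hy⟩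
    by_contra hz
    exact hy (((hψt y) t ht).velocity_eq ht |>.trans (hvec0 t _ hz))
  · exact hKY.of_isClosed_subset (isClosed_tsupport _) (hsuppK t ht)

end Patching

/-! ### Thickenings of a surface -/

section Thickening

variable {Y : Type*} [TopologicalSpace Y] [ChartedSpace (EuclideanSpace ℝ (Fin 3)) Y]
  [IsManifold (𝓡 3) ∞ Y] {α : OneForm Y} {S : Type*} [TopologicalSpace S]
  [ChartedSpace (EuclideanSpace ℝ (Fin 2)) S] [IsManifold (𝓡 2) ∞ S]
  {V : Set S} {j : ℝ → S → Y} {t₀ : ℝ}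

/-- A global thickening `φ` of the surface provides the parametrizations. -/
theorem IsContactForm.hasLocalHamiltonian_of_thickening (hα : IsContactForm α)
    (hj : IsEmbeddingFamily (𝓡 2) j)
    (hjξ : ∀ t ∈ Icc (0 : ℝ) 1, ∀ p,
      characteristicFoliation α (j t) p = characteristicFoliation α (j 0) p)
    (hV : IsOpen V) {φ : ℝ → S × ℝ → Y} (hφ : IsEmbeddingFamily ((𝓡 2).prod 𝓘(ℝ, ℝ)) φ)
    (hφj : ∀ t ∈ Icc (0 : ℝ) 1, ∀ p, φ t (p, 0) = j t p)
    (hφV : ∀ t ∈ Icc (0 : ℝ) 1, ∀ p ∈ V, ∀ s, φ t (p, s) = φ 0 (p, s))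
    (ht₀ : t₀ ∈ Icc (0 : ℝ) 1) (p₀ : S) :
    HasLocalHamiltonian α j (fun t ↦ φ t '' (Vᶜ ×ˢ Icc (-1) 1)) t₀ p₀ := by
  have hT : (extChartAt (𝓡 2) p₀).target ∈ 𝓝 (extChartAt (𝓡 2) p₀ p₀) :=
    (isOpen_extChartAt_target p₀).mem_nhds (mem_extChartAt_target p₀)
  have hρ : ContMDiffOn 𝓘(ℝ, EuclideanSpace ℝ (Fin 2) × ℝ) ((𝓡 2).prod 𝓘(ℝ, ℝ)) ∞
      (fun x : EuclideanSpace ℝ (Fin 2) × ℝ ↦ ((extChartAt (𝓡 2) p₀).symm x.1, x.2))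
      ((extChartAt (𝓡 2) p₀).target ×ˢ univ) :=
    ((contMDiffOn_extChartAt_symm p₀).comp contDiff_fst.contMDiff.contMDiffOn
      fun x hx ↦ hx.1).prodMk contDiff_snd.contMDiff.contMDiffOn
  refine (hα.hasLocalHamiltonian (fun t ht ↦ (hj.embedding t ht).contMDiff) hjξ hV ht₀
    (p₀ := p₀) one_pos (O := (extChartAt (𝓡 2) p₀).target ×ˢ univ)
    (F := fun q ↦ φ q.1 ((extChartAt (𝓡 2) p₀).symm q.2.1, q.2.2))
    ((isOpen_extChartAt_target p₀).prod isOpen_univ) (fun x hx ↦ hx.1)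
    ⟨mem_extChartAt_target p₀, mem_univ _⟩ ?_ (fun t ht z _ ↦ hφj t ht.1 _) ?_ ?_).mono ?_
  · refine hφ.smooth.comp (f := fun q : ℝ × (EuclideanSpace ℝ (Fin 2) × ℝ) ↦
      (q.1, ((extChartAt (𝓡 2) p₀).symm q.2.1, q.2.2))) ?_ fun q hq ↦ ⟨hq.1.1, mem_univ _⟩
    exact contDiff_fst.contMDiff.contMDiffOn.prodMk
      (hρ.comp contDiff_snd.contMDiff.contMDiffOn fun q hq ↦ hq.2)
  · intro L hL
    refine injective_of_hasMFDerivAt_isImmersionAt (I := (𝓡 2).prod 𝓘(ℝ, ℝ)) (f := φ t₀)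
      (ρ := fun x : EuclideanSpace ℝ (Fin 2) × ℝ ↦ ((extChartAt (𝓡 2) p₀).symm x.1, x.2))
      (σ := fun q ↦ (extChartAt (𝓡 2) p₀ q.1, q.2))
      ((hφ.embedding t₀ ht₀).isImmersion.isImmersionAt _)
      (hρ.continuousOn.continuousAt (prod_mem_nhds hT univ_mem)) ?_ ?_ hL
    · refine ContMDiffAt.prodMk_space ?_ contMDiffAt_snd
      refine ContMDiffAt.comp _ ?_ contMDiffAt_fst
      simp only [extChartAt_to_inv]
      exact contMDiffAt_extChartAt
    · filter_upwards [prod_mem_nhds hT univ_mem] with x hx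
      rw [(extChartAt (𝓡 2) p₀).right_inv hx.1]
  · intro t ht x _ hxV
    exact (hφV t ht.1 _ hxV _).trans (hφV t₀ ht₀ _ hxV _).symm
  · rintro t - y ⟨x, -, hxV, hx1, rfl⟩
    exact ⟨((extChartAt (𝓡 2) p₀).symm x.1, x.2), ⟨hxV, abs_le.1 hx1⟩, rfl⟩

/-- Without a global thickening, the surface is thickened locally by adding multiples of a vector
transverse to it in a chart of `Y`. -/
theorem IsContactForm.hasLocalHamiltonian_of_embedding (hα : IsContactForm α)
    (hj : IsEmbeddingFamily (𝓡 2) j)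
    (hjξ : ∀ t ∈ Icc (0 : ℝ) 1, ∀ p,
      characteristicFoliation α (j t) p = characteristicFoliation α (j 0) p)
    (hV : IsOpen V) (hjV : ∀ t ∈ Icc (0 : ℝ) 1, ∀ p ∈ V, j t p = j 0 p)
    (ht₀ : t₀ ∈ Icc (0 : ℝ) 1) (p₀ : S) :
    HasLocalHamiltonian α j (fun _ ↦ univ) t₀ p₀ := by
  set T := (extChartAt (𝓡 2) p₀).target with hTdef
  set z₀ := extChartAt (𝓡 2) p₀ p₀ with hz₀
  have hTo : IsOpen T := isOpen_extChartAt_target p₀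
  have hz₀T : z₀ ∈ T := mem_extChartAt_target p₀
  set γ : ℝ × EuclideanSpace ℝ (Fin 2) → Y := fun q ↦ j q.1 ((extChartAt (𝓡 2) p₀).symm q.2)
    with hγ
  have hγ₀ : γ (t₀, z₀) = j t₀ p₀ := by simp only [hγ, hz₀, extChartAt_to_inv]
  have hγsm : ContMDiffOn 𝓘(ℝ, ℝ × EuclideanSpace ℝ (Fin 2)) (𝓡 3) ∞ γ (Icc 0 1 ×ˢ T) := by
    refine hj.smooth.comp (f := fun q : ℝ × EuclideanSpace ℝ (Fin 2) ↦
      (q.1, (extChartAt (𝓡 2) p₀).symm q.2)) ?_ fun q hq ↦ ⟨hq.1, mem_univ _⟩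
    exact contDiff_fst.contMDiff.contMDiffOn.prodMk
      ((contMDiffOn_extChartAt_symm p₀).comp contDiff_snd.contMDiff.contMDiffOn fun q hq ↦ hq.2)
  set x := extChartAt (𝓡 3) (j t₀ p₀) with hx
  have hγx : γ (t₀, z₀) ∈ x.source := by
    rw [hγ₀]
    exact mem_extChartAt_source _
  -- a vector transverse to the surface
  obtain ⟨A, hA, hAinj⟩ : ∃ A : EuclideanSpace ℝ (Fin 2) →L[ℝ] EuclideanSpace ℝ (Fin 3),
      HasFDerivAt (fun z ↦ x (γ (t₀, z))) A z₀ ∧ Injective A := by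
    obtain ⟨D, hD⟩ : ∃ D : EuclideanSpace ℝ (Fin 2) →L[ℝ] EuclideanSpace ℝ (Fin 3),
        HasMFDerivAt 𝓘(ℝ, EuclideanSpace ℝ (Fin 2)) (𝓡 3) (fun z ↦ γ (t₀, z)) z₀ D := by
      have h1 : ContMDiffOn 𝓘(ℝ, EuclideanSpace ℝ (Fin 2)) (𝓡 3) ∞ (fun z ↦ γ (t₀, z)) T :=
        (hj.embedding t₀ ht₀).contMDiff.comp_contMDiffOn (contMDiffOn_extChartAt_symm p₀)
      exact ⟨_, ((h1.contMDiffAt (hTo.mem_nhds hz₀T)).mdifferentiableAt (by simp)).hasMFDerivAt⟩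
    have hDinj : Injective D := by
      refine injective_of_hasMFDerivAt_isImmersionAt (I := 𝓡 2) (f := j t₀)
        (ρ := (extChartAt (𝓡 2) p₀).symm) (σ := extChartAt (𝓡 2) p₀)
        ((hj.embedding t₀ ht₀).isImmersion.isImmersionAt _)
        ((continuousOn_extChartAt_symm p₀).continuousAt (hTo.mem_nhds hz₀T)) ?_ ?_ hD
      · rw [hz₀, extChartAt_to_inv]
        exact contMDiffAt_extChartAt
      · filter_upwards [hTo.mem_nhds hz₀T] with z hz
        exact (extChartAt (𝓡 2) p₀).right_inv hz
    refine ⟨(dchart (j t₀ p₀) (γ (t₀, z₀))).comp D, hasFDerivWithinAt_univ.1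
      (hasFDerivWithinAt_chart_comp hD.hasMFDerivWithinAt _ hγx), ?_⟩
    exact (LeftInverse.injective (dchartSymm_dchart (j t₀ p₀) hγx)).comp hDinj
  obtain ⟨n, hn⟩ : ∃ n, n ∉ range A := by
    by_contra! h
    have h1 := LinearMap.finrank_le_finrank_of_surjective (f := A.toLinearMap) h
    simp at h1
  -- the thickening, and a domain on which it takes values in the chart
  set u : ℝ × EuclideanSpace ℝ (Fin 2) → EuclideanSpace ℝ (Fin 3) := fun q ↦ x (γ q) with hu
  set g : ℝ × (EuclideanSpace ℝ (Fin 2) × ℝ) → ℝ × EuclideanSpace ℝ (Fin 2) :=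
    fun q ↦ (q.1, q.2.1) with hg
  have hgsm : ContDiff ℝ ∞ g := contDiff_fst.prodMk (contDiff_fst.comp contDiff_snd)
  set Ψ : ℝ × (EuclideanSpace ℝ (Fin 2) × ℝ) → EuclideanSpace ℝ (Fin 3) :=
    fun q ↦ u (g q) + q.2.2 • n with hΨ
  have husm : ContDiffOn ℝ ∞ u (Icc 0 1 ×ˢ T ∩ γ ⁻¹' x.source) := contDiffOn_chart_comp hγsm _
  set B := g ⁻¹' (Icc 0 1 ×ˢ T ∩ γ ⁻¹' x.source) with hB
  have hΨsm : ContDiffOn ℝ ∞ Ψ B :=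
    (husm.comp hgsm.contDiffOn fun q hq ↦ hq).add
      ((contDiff_snd.comp contDiff_snd).smul contDiff_const).contDiffOn
  have hq₀ : (t₀, (z₀, (0 : ℝ))) ∈ B := ⟨⟨ht₀, hz₀T⟩, hγx⟩
  have hΨ₀ : Ψ (t₀, (z₀, 0)) = x (j t₀ p₀) := by
    simp only [hΨ, hu, hg, hγ₀, zero_smul, add_zero]
  obtain ⟨ε₁, hε₁, h₁⟩ := Metric.mem_nhdsWithin_iff.1
    ((hγsm.continuousOn.comp hgsm.continuous.continuousOn (fun q hq ↦ hq) :
      ContinuousOn (γ ∘ g) (g ⁻¹' (Icc 0 1 ×ˢ T))) (t₀, (z₀, 0)) hq₀.1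
      ((isOpen_extChartAt_source (I := 𝓡 3) (j t₀ p₀)).mem_nhds hγx))
  have hΨt : x.target ∈ 𝓝 (Ψ (t₀, (z₀, 0))) := by
    rw [hΨ₀]
    exact (isOpen_extChartAt_target _).mem_nhds (mem_extChartAt_target _)
  obtain ⟨ε₂, hε₂, h₂⟩ := Metric.mem_nhdsWithin_iff.1 (hΨsm.continuousOn _ hq₀ hΨt)
  set ε := min ε₁ ε₂ with hε
  have hε0 : 0 < ε := lt_min hε₁ hε₂
  set O : Set (EuclideanSpace ℝ (Fin 2) × ℝ) := Metric.ball (z₀, (0 : ℝ)) ε ∩ T ×ˢ univ with hO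
  have hOo : IsOpen O := Metric.isOpen_ball.inter (hTo.prod isOpen_univ)
  have hz₀O : (z₀, (0 : ℝ)) ∈ O := ⟨Metric.mem_ball_self hε0, hz₀T, mem_univ _⟩
  have hball : ∀ q ∈ (Icc 0 1 ∩ Metric.ball t₀ ε) ×ˢ O, q ∈ Metric.ball (t₀, (z₀, (0 : ℝ))) ε :=
    fun q hq ↦ by
      rw [← ball_prod_same]
      exact ⟨hq.1.2, hq.2.1⟩
  have hmemB : ∀ q ∈ (Icc 0 1 ∩ Metric.ball t₀ ε) ×ˢ O, q ∈ B := fun q hq ↦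
    ⟨⟨hq.1.1, hq.2.2.1⟩,
      h₁ ⟨Metric.ball_subset_ball (min_le_left _ _) (hball q hq), hq.1.1, hq.2.2.1⟩⟩
  have hmemt : ∀ q ∈ (Icc 0 1 ∩ Metric.ball t₀ ε) ×ˢ O, Ψ q ∈ x.target := fun q hq ↦
    h₂ ⟨Metric.ball_subset_ball (min_le_right _ _) (hball q hq), hmemB q hq⟩
  refine (hα.hasLocalHamiltonian (fun t ht ↦ (hj.embedding t ht).contMDiff) hjξ hV ht₀
    (p₀ := p₀) hε0 hOo (F := fun q ↦ x.symm (Ψ q)) (fun y hy ↦ hy.2.1) hz₀O ?_ ?_ ?_ ?_).mono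
    fun t _ ↦ subset_univ _
  · exact (contMDiffOn_extChartAt_symm (j t₀ p₀)).comp (hΨsm.mono hmemB).contMDiffOn hmemt
  · intro t ht z hz
    have h3 := (hmemB (t, (z, 0)) ⟨ht, hz⟩).2
    simp only [hΨ, zero_smul, add_zero, hu]
    exact x.left_inv h3
  · intro L hL
    have h3 : HasFDerivAt (fun y ↦ Ψ (t₀, y)) (A.comp (ContinuousLinearMap.fst ℝ _ ℝ) +
        (ContinuousLinearMap.snd ℝ (EuclideanSpace ℝ (Fin 2)) ℝ).smulRight n) (z₀, (0 : ℝ)) :=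
      (HasFDerivAt.comp (z₀, (0 : ℝ)) (f := Prod.fst) hA hasFDerivAt_fst).add
        (hasFDerivAt_snd.smul_const n)
    have h4 : x.symm (Ψ (t₀, (z₀, 0))) ∈ x.source := by
      rw [hΨ₀, hx, extChartAt_to_inv]
      exact mem_extChartAt_source _
    have h5 := hasFDerivWithinAt_univ.1
      (hasFDerivWithinAt_chart_comp hL.hasMFDerivWithinAt (j t₀ p₀) h4)
    have h6 : (fun y ↦ Ψ (t₀, y)) =ᶠ[𝓝 (z₀, (0 : ℝ))] fun y ↦ x (x.symm (Ψ (t₀, y))) := by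
      filter_upwards [hOo.mem_nhds hz₀O] with y hy
      exact (x.right_inv (hmemt (t₀, y) ⟨⟨ht₀, Metric.mem_ball_self hε0⟩, hy⟩)).symm
    have h7 := h3.unique (h5.congr_of_eventuallyEq h6)
    rw [injective_iff_map_eq_zero]
    rintro ⟨w, s⟩ hws
    have h8 : A w + s • n = 0 := by
      have := DFunLike.congr_fun h7 (w, s)
      simpa [hws] using this
    have hs : s = 0 := by
      by_contra hs
      refine hn ⟨-s⁻¹ • w, ?_⟩
      rw [map_smul, eq_neg_of_add_eq_zero_left h8, neg_smul_neg, smul_smul, inv_mul_cancel₀ hs,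
        one_smul]
    rw [hs, zero_smul, add_zero] at h8
    rw [hs, hAinj (h8.trans (map_zero A).symm), Prod.zero_eq_mk]
  · intro t ht y _ hyV
    simp only [hΨ, hu, hg, hγ, hjV t ht.1 _ hyV, hjV t₀ ht₀ _ hyV]

end Thickening

end ContactGeom

theorem mainTheorem4
    {Y : Type*} [TopologicalSpace Y] [T2Space Y] [SecondCountableTopology Y]
    [ChartedSpace (EuclideanSpace ℝ (Fin 3)) Y] [IsManifold (𝓡 3) ∞ Y]
    {S : Type*} [TopologicalSpace S] [T2Space S] [CompactSpace S]
    [ChartedSpace (EuclideanSpace ℝ (Fin 2)) S] [IsManifold (𝓡 2) ∞ S]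
    (α : ContactGeom.OneForm Y) (hα : ContactGeom.IsContactForm α)
    (V : Set S) (hV : IsOpen V)
    (j : ℝ → S → Y) (hj : ContactGeom.IsEmbeddingFamily (𝓡 2) j)
    (hjV : ∀ t ∈ Icc (0 : ℝ) 1, ∀ p ∈ V, j t p = j 0 p)
    (hjξ : ∀ t ∈ Icc (0 : ℝ) 1, ∀ p,
      ContactGeom.characteristicFoliation α (j t) p =
        ContactGeom.characteristicFoliation α (j 0) p) :
    -- `U` is an arbitrarily small open neighbourhood of the sets `j_t(S \ V)`, `t ∈ [0,1]`
    (∀ U : Set (ℝ × Y), IsOpen U → (∀ t ∈ Icc (0 : ℝ) 1, ∀ p ∈ Vᶜ, (t, j t p) ∈ U) →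
      ∃ (ψ : ℝ → Diffeomorph (𝓡 3) (𝓡 3) Y Y ∞) (H : ℝ → Y → ℝ),
        ContactGeom.IsContactIsotopy α ψ ∧
        ContactGeom.IsGeneratedBy α (fun t ↦ ψ t) H ∧
        (∀ t ∈ Icc (0 : ℝ) 1, ∀ p, ψ t (j 0 p) = j t p) ∧
        ∀ t ∈ Icc (0 : ℝ) 1,
          ContactGeom.supportAt (fun t ↦ ψ t) t ⊆ {y | (t, y) ∈ U} ∧
          HasCompactSupport (H t) ∧
          tsupport (H t) ⊆ {y | (t, y) ∈ U}) ∧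
    -- the refinement for an extension `φ_t` of `j_t` to `S × ℝ`
    (∀ φ : ℝ → S × ℝ → Y,
      ContactGeom.IsEmbeddingFamily ((𝓡 2).prod 𝓘(ℝ, ℝ)) φ →
      (∀ t ∈ Icc (0 : ℝ) 1, ∀ p, φ t (p, 0) = j t p) →
      (∀ t ∈ Icc (0 : ℝ) 1, ∀ p ∈ V, ∀ s, φ t (p, s) = φ 0 (p, s)) →
      ∀ U : Set (ℝ × Y), IsOpen U → (∀ t ∈ Icc (0 : ℝ) 1, ∀ p ∈ Vᶜ, (t, j t p) ∈ U) →
      ∃ (ψ : ℝ → Diffeomorph (𝓡 3) (𝓡 3) Y Y ∞) (H : ℝ → Y → ℝ),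
        ContactGeom.IsContactIsotopy α ψ ∧
        ContactGeom.IsGeneratedBy α (fun t ↦ ψ t) H ∧
        (∀ t ∈ Icc (0 : ℝ) 1, ∀ p, ψ t (j 0 p) = j t p) ∧
        ∀ t ∈ Icc (0 : ℝ) 1,
          ContactGeom.supportAt (fun t ↦ ψ t) t ⊆ {y | (t, y) ∈ U} ∧
          HasCompactSupport (H t) ∧
          tsupport (H t) ⊆ {y | (t, y) ∈ U} ∩ φ t '' (Vᶜ ×ˢ univ)) := by
  have hcompact : ∀ t ∈ Icc (0 : ℝ) 1, ∀ φ : ℝ → S × ℝ → Y,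
      ContactGeom.IsEmbeddingFamily ((𝓡 2).prod 𝓘(ℝ, ℝ)) φ →
      IsClosed (φ t '' (Vᶜ ×ˢ Icc (-1) 1)) := fun t ht φ hφ ↦
    ((hV.isClosed_compl.isCompact.prod isCompact_Icc).image
      (hφ.embedding t ht).contMDiff.continuous).isClosed
  refine ⟨fun U hU hjU ↦ ?_, fun φ hφ hφj hφV U hU hjU ↦ ?_⟩
  · obtain ⟨ψ, H, h1, h2, h3, h4⟩ := hα.exists_contactIsotopy_of_hasLocalHamiltonian hV hj hjV
      (fun t _ ↦ isClosed_univ)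
      (fun t ht p _ ↦ hα.hasLocalHamiltonian_of_embedding hj hjξ hV hjV ht p) hU hjU
    exact ⟨ψ, H, h1, h2, h3, fun t ht ↦
      ⟨(h4 t ht).1, (h4 t ht).2.1, (h4 t ht).2.2.trans inter_subset_left⟩⟩
  · obtain ⟨ψ, H, h1, h2, h3, h4⟩ := hα.exists_contactIsotopy_of_hasLocalHamiltonian hV hj hjV
      (fun t ht ↦ hcompact t ht φ hφ)
      (fun t ht p _ ↦ hα.hasLocalHamiltonian_of_thickening hj hjξ hV hφ hφj hφV ht p) hU hjU
    exact ⟨ψ, H, h1, h2, h3, fun t ht ↦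
      ⟨(h4 t ht).1, (h4 t ht).2.1, (h4 t ht).2.2.trans (inter_subset_inter_right _
        (image_mono (prod_mono_right (subset_univ _))))⟩⟩
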